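/- **Setting.** $\mathsf{PRA}^2$ is the two-sorted theory (numbers and functions) with a symbol for each primitive recursive function, whose axioms are the successor axioms, the defining equations of $<$ and of all primitive recursive functions, induction for quantifier-free formulas with number and function parameters, and closure of the function sort under composition and primitive recursion. A model is a pair $(M,\mathcal X)$, where $M$ is a possibly nonstandard number universe and $\mathcal X$ a collection of finitary functions on $M$. Constant functions, for every element of $M$, belong to $\mathcal X$. "Over $\mathsf{PRA}^2$, $A$ implies $B$" means that $B$ holds in every model of $\mathsf{PRA}^2$ in which $A$ holds. The following principles are considered in such a model; all functions mentioned are in $\mathcal X$. * $\mathsf{RCA}_0$ is identified with $\mathsf{QF}\text{-}\mathsf{AC}$: for each quantifier-free $\theta$ with parameters, $\forall n\,\exists m\,\theta(n,m)\to\exists f\,\forall n\,\theta(n,f(n))$. * $\mathsf{WKL}_0$: for every function $T:2^{<\mathbb N}\to 2$ such that $T^{-1}(1)$ is an infinite (i.e. unbounded) tree, there is a function $P:\mathbb N\to 2$ with $T(\langle P(0),\dots,P(n-1)\rangle)=1$ for all $n$. * A real is a function $x:\mathbb N\to\mathbb Q$ with $|x(i)-x(i+1)|<2^{-i-1}$ for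 all $i$. A presentation of a continuous function $X$ on $[0,1]$ is a pair $(f,\delta)$ of functions, $f:\mathbb Q\times\mathbb N\to\mathbb Q$ and $\delta:\mathbb Q\times\mathbb N\to\mathbb N$, such that $f(r,\cdot)$ is a real for each rational $r\in[0,1]$ and, for every real $x\in[0,1]$ of the model, (i) there is a real $X(x)$ of the model such that $|X(x)-f(r)|<2^{-n}$ for all $n$ and all rational $r\in[0,1]$ with $|x-r|<2^{-\delta(r,n)}$ (in particular $X(r)=f(r)$ for rational $r$), and (ii) for each $n$ there is a rational $r\in[0,1]$ with $|x-r|<2^{-\delta(r,n)}$. * A modulus of uniform continuity of $X$ is a function $h:\mathbb N\to\mathbb N$ such that for all $n$ and all reals $x,\hat x\in[0,1]$ of the model, $|x-\hat x|<2^{-h(n)}$ implies $|X(x)-X(\hat x)|<2^{-n}$. * $\mathsf{UniformContinuityOn[0,1]}$: every presented continuous function on $[0,1]$ has a modulus of uniform continuity. **Theorem.** 1. Over $\mathsf{PRA}^2$, $\mathsf{UniformContinuityOn[0,1]}$ is equivalent to $\mathsf{WKL}_0+\mathsf{RCA}_0$. 2. Over $\mathsf{PRA}^2$, $\mathsf{UniformContinuityOn[0,1]}$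 is strictly stronger than $\mathsf{WKL}_0$: it implies $\mathsf{WKL}_0$ by (1), and there is a model of $\mathsf{PRA}^2+\mathsf{WKL}_0$ in which it fails. 3. For every computable $g:\mathbb N\to\mathbb N$ (on the standard natural numbers) there are primitive recursive $f,\delta$ such that $(f,\delta)$ presents a continuous function on $[0,1]$ (on all real numbers of $[0,1]$) and for each of its moduli of uniform continuity $m:\mathbb N\to\mathbb N$ there is a function $D$, primitive recursive in $m$, with $g(i)\le D(i)$ for all $i$. -/

import Mathlib

universe u

/-- Primitive recursive schemes: one function symbol of the language of `PRA` for each scheme. -/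
inductive PRCode : ℕ → Type
  | zero : PRCode 0
  | succ : PRCode 1
  | proj {n : ℕ} (i : Fin n) : PRCode n
  | comp {n k : ℕ} (f : PRCode k) (g : Fin k → PRCode n) : PRCode n
  | prec {n : ℕ} (f : PRCode n) (g : PRCode (n + 2)) : PRCode (n + 1)

namespace PRCode

/-- Addition, `0 + x = x`, `(m+1) + x = (m + x) + 1`. -/
def add : PRCode 2 := prec (proj 0) (comp succ ![proj 1])

/-- Multiplication, `0 * x = 0`, `(m+1) * x = m * x + x`. -/
def mul : PRCode 2 := prec (comp zero ![]) (comp add ![proj 1, proj 2])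

/-- The function `k ↦ 2 ^ k - 1`: `0 ↦ 0`, and if `k ↦ y` then `k + 1 ↦ (y + y) + 1`. -/
def predTwoPow : PRCode 1 := prec zero (comp succ ![comp add ![proj 1, proj 1]])

/-- The standard meaning of a scheme. -/
def eval : {n : ℕ} → PRCode n → (Fin n → ℕ) → ℕ
  | _, zero, _ => 0
  | _, succ, v => v 0 + 1
  | _, proj i, v => v i
  | _, comp f g, v => f.eval fun i => (g i).eval v
  | _, prec f g, v =>
      Nat.rec (f.eval (Fin.tail v))
        (fun m y => g.eval (Fin.cons m (Fin.cons y (Fin.tail v)))) (v 0)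

end PRCode

/-- A (Henkin) structure for the two-sorted language of `PRA²` with number universe `M`:
an interpretation of each primitive recursive function symbol (zero and successor among them),
an order relation, and for each arity a collection of functions, the range of
the function variables of that arity. -/
structure PRA2Structure (M : Type u) where
  sym : {n : ℕ} → PRCode n → (Fin n → M) → M
  lt : M → M → Prop
  Fun : (n : ℕ) → Set ((Fin n → M) → M)

namespace PRA2Structure

variable {M : Type u}

def zero (S : PRA2Structure M) : M := S.sym PRCode.zero ![]

def succ (S : PRA2Structure M) (x : M) : M := S.sym PRCode.succ ![x]

def add (S : PRA2Structure M) (x y : M) : M := S.sym PRCode.add ![x, y]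

def mul (S : PRA2Structure M) (x y : M) : M := S.sym PRCode.mul ![x, y]

/-- `2 ^ k - 1`, computed inside the structure. -/
def predTwoPow (S : PRA2Structure M) (k : M) : M := S.sym PRCode.predTwoPow ![k]

def one (S : PRA2Structure M) : M := S.succ S.zero

/-- Unary functions of the structure. -/
def Fun₁ (S : PRA2Structure M) : Set (M → M) := {F | (fun v : Fin 1 → M => F (v 0)) ∈ S.Fun 1}

end PRA2Structure

section Formulas

variable {M : Type u}

/-- Terms in `k` number variables, with number parameters and function parameters from `S`. -/
inductive QFTerm (S : PRA2Structure M) (k : ℕ) : Type u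
  | var (i : Fin k) : QFTerm S k
  | param (c : M) : QFTerm S k
  | sym {n : ℕ} (c : PRCode n) (t : Fin n → QFTerm S k) : QFTerm S k
  | app {n : ℕ} (F : (Fin n → M) → M) (hF : F ∈ S.Fun n) (t : Fin n → QFTerm S k) : QFTerm S k

def QFTerm.eval {S : PRA2Structure M} {k : ℕ} (v : Fin k → M) : QFTerm S k → M
  | .var i => v i
  | .param c => c
  | .sym c t => S.sym c fun i => (t i).eval v
  | .app F _ t => F fun i => (t i).eval v

/-- Quantifier-free formulas in `k` number variables, with parameters from `S`. -/
inductive QFFormula (S : PRA2Structure M) (k : ℕ) : Type u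
  | eq (s t : QFTerm S k) : QFFormula S k
  | lt (s t : QFTerm S k) : QFFormula S k
  | not (φ : QFFormula S k) : QFFormula S k
  | and (φ ψ : QFFormula S k) : QFFormula S k

def QFFormula.Holds {S : PRA2Structure M} {k : ℕ} (v : Fin k → M) : QFFormula S k → Prop
  | .eq s t => s.eval v = t.eval v
  | .lt s t => S.lt (s.eval v) (t.eval v)
  | .not φ => ¬ φ.Holds v
  | .and φ ψ => φ.Holds v ∧ ψ.Holds v

end Formulas

namespace PRA2Structure

variable {M : Type u}

/-- `S` is a model of `PRA²`: the successor axioms, the defining axioms of `<` and of all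
primitive recursive function symbols, quantifier-free induction with parameters, and
closure of the function sort under composition and primitive recursion (numbers being
identified with functions of arity zero). -/
structure IsModel (S : PRA2Structure M) : Prop where
  zero_ne_succ : ∀ x, S.zero ≠ S.succ x
  succ_inj : ∀ x y, S.succ x = S.succ y → x = y
  not_lt_zero : ∀ x, ¬ S.lt x S.zero
  lt_succ_iff : ∀ x y, S.lt x (S.succ y) ↔ S.lt x y ∨ x = y
  sym_proj : ∀ {n : ℕ} (i : Fin n) (v : Fin n → M), S.sym (PRCode.proj i) v = v i
  sym_comp : ∀ {n k : ℕ} (f : PRCode k) (g : Fin k → PRCode n) (v : Fin n → M),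
    S.sym (PRCode.comp f g) v = S.sym f fun i => S.sym (g i) v
  sym_prec_zero : ∀ {n : ℕ} (f : PRCode n) (g : PRCode (n + 2)) (v : Fin n → M),
    S.sym (PRCode.prec f g) (Fin.cons S.zero v) = S.sym f v
  sym_prec_succ : ∀ {n : ℕ} (f : PRCode n) (g : PRCode (n + 2)) (m : M) (v : Fin n → M),
    S.sym (PRCode.prec f g) (Fin.cons (S.succ m) v) =
      S.sym g (Fin.cons m (Fin.cons (S.sym (PRCode.prec f g) (Fin.cons m v)) v))
  induction : ∀ θ : QFFormula S 1, θ.Holds ![S.zero] →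
    (∀ x, θ.Holds ![x] → θ.Holds ![S.succ x]) → ∀ x, θ.Holds ![x]
  sym_mem : ∀ {n : ℕ} (c : PRCode n), S.sym c ∈ S.Fun n
  const_mem : ∀ c : M, (fun _ : Fin 0 → M => c) ∈ S.Fun 0
  comp_mem : ∀ {n k : ℕ} (f : (Fin k → M) → M) (g : Fin k → (Fin n → M) → M),
    f ∈ S.Fun k → (∀ i, g i ∈ S.Fun n) → (fun v => f fun i => g i v) ∈ S.Fun n
  prec_mem : ∀ {n : ℕ} (f : (Fin n → M) → M) (g : (Fin (n + 2) → M) → M),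
    f ∈ S.Fun n → g ∈ S.Fun (n + 2) → ∃ h ∈ S.Fun (n + 1), ∀ v : Fin n → M,
      h (Fin.cons S.zero v) = f v ∧
      ∀ m, h (Fin.cons (S.succ m) v) = g (Fin.cons m (Fin.cons (h (Fin.cons m v)) v))

/-- The quantifier-free axiom of choice `QF-AC`; over `PRA²` this is `RCA₀`. -/
def QFAC (S : PRA2Structure M) : Prop :=
  ∀ θ : QFFormula S 2, (∀ x, ∃ y, θ.Holds ![x, y]) →
    ∃ F ∈ S.Fun₁, ∀ x, θ.Holds ![x, F x]

/-! ### Weak Kőnig's lemma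

Binary strings are coded by positive numbers: the empty string by `1`, and the extension by the
bit `i` of the string with code `m` by `2 m + i`. This is a bijection of the set of binary strings
with the set of positive numbers. -/

/-- The code of the string with code `m`, extended by the bit `i`. -/
def snoc (S : PRA2Structure M) (m i : M) : M := S.add (S.add m m) i

/-- `T` is the characteristic function of a set of binary strings closed under prefixes. -/
def IsBinaryTree (S : PRA2Structure M) (T : M → M) : Prop :=
  T ∈ S.Fun₁ ∧ (∀ m, T m = S.zero ∨ T m = S.one) ∧
    ∀ m i, S.lt S.zero m → (i = S.zero ∨ i = S.one) → T (S.snoc m i) = S.one → T m = S.one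

/-- `T` is infinite, that is, contains strings with arbitrarily large codes. -/
def IsInfiniteTree (S : PRA2Structure M) (T : M → M) : Prop :=
  ∀ b, ∃ m, S.lt b m ∧ T m = S.one

/-- `P` is an infinite path through `T`; `c n` is the code of `⟨P 0, …, P (n-1)⟩`. -/
def IsPath (S : PRA2Structure M) (T P : M → M) : Prop :=
  P ∈ S.Fun₁ ∧ (∀ n, P n = S.zero ∨ P n = S.one) ∧
    ∃ c ∈ S.Fun₁, c S.zero = S.one ∧ (∀ n, c (S.succ n) = S.snoc (c n) (P n)) ∧
      ∀ n, T (c n) = S.one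

def WKL (S : PRA2Structure M) : Prop :=
  ∀ T, S.IsBinaryTree T → S.IsInfiniteTree T → ∃ P, S.IsPath T P

end PRA2Structure

/-! ### Rationals, reals, and continuous functions on `[0,1]` inside a structure -/

/-- The triple `(pos, neg, den)` represents the rational `(pos - neg) / (den + 1)`. -/
structure RatCode (M : Type u) where
  pos : M
  neg : M
  den : M

/-- The data of a function on the reals: `val r` is a sequence of rationals (for the value of the
function at the rational `r`), and `δ` is the attempted modulus of continuity. -/
structure FunCode (M : Type u) where
  val : RatCode M → M → RatCode M
  δ : RatCode M → M → M

namespace PRA2Structure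

variable {M : Type u}

def ratZero (S : PRA2Structure M) : RatCode M := ⟨S.zero, S.zero, S.zero⟩

def ratOne (S : PRA2Structure M) : RatCode M := ⟨S.one, S.zero, S.zero⟩

def ratNeg (a : RatCode M) : RatCode M := ⟨a.neg, a.pos, a.den⟩

def ratAdd (S : PRA2Structure M) (a b : RatCode M) : RatCode M :=
  ⟨S.add (S.mul a.pos (S.succ b.den)) (S.mul b.pos (S.succ a.den)),
   S.add (S.mul a.neg (S.succ b.den)) (S.mul b.neg (S.succ a.den)),
   S.add (S.mul a.den b.den) (S.add a.den b.den)⟩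

def ratSub (S : PRA2Structure M) (a b : RatCode M) : RatCode M := S.ratAdd a (ratNeg b)

def ratLt (S : PRA2Structure M) (a b : RatCode M) : Prop :=
  S.lt (S.add (S.mul a.pos (S.succ b.den)) (S.mul b.neg (S.succ a.den)))
    (S.add (S.mul b.pos (S.succ a.den)) (S.mul a.neg (S.succ b.den)))

/-- `|a| < q`. -/
def ratAbsLt (S : PRA2Structure M) (a q : RatCode M) : Prop := S.ratLt a q ∧ S.ratLt (ratNeg a) q

/-- The rational `2 ^ (-k)`. -/
def twoPowNeg (S : PRA2Structure M) (k : M) : RatCode M := ⟨S.one, S.zero, S.predTwoPow k⟩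

/-- The rational `r` lies in `[0,1]`. -/
def RatInUnit (S : PRA2Structure M) (r : RatCode M) : Prop :=
  ¬ S.ratLt r S.ratZero ∧ ¬ S.ratLt S.ratOne r

/-- `x` is (a representation of) a real: a function of the structure from numbers to
rationals with `|x i - x (i+1)| < 2 ^ (-(i+1))`. -/
def IsReal (S : PRA2Structure M) (x : M → RatCode M) : Prop :=
  ((fun i => (x i).pos) ∈ S.Fun₁ ∧ (fun i => (x i).neg) ∈ S.Fun₁ ∧ (fun i => (x i).den) ∈ S.Fun₁) ∧
    ∀ i, S.ratAbsLt (S.ratSub (x i) (x (S.succ i))) (S.twoPowNeg (S.succ i))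

/-- `|x - y| < q` for the reals represented by `x`, `y` and the rational `q`. As the error of
`x k` and of `y k` is at most `2 ^ (-k)`, this says that
`|x k - y k| < q - (2 ^ (-k) + 2 ^ (-k))` for some `k`. -/
def DistLt (S : PRA2Structure M) (x y : M → RatCode M) (q : RatCode M) : Prop :=
  ∃ k, S.ratAbsLt (S.ratSub (x k) (y k))
    (S.ratSub q (S.ratAdd (S.twoPowNeg k) (S.twoPowNeg k)))

/-- The real represented by `x` lies in `[0,1]`: `-2 ^ (-k) ≤ x k ≤ 1 + 2 ^ (-k)` for all `k`. -/
def RealInUnit (S : PRA2Structure M) (x : M → RatCode M) : Prop :=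
  ∀ k, ¬ S.ratLt (x k) (ratNeg (S.twoPowNeg k)) ∧
    ¬ S.ratLt (S.ratAdd S.ratOne (S.twoPowNeg k)) (x k)

/-- The components of the code `P` are functions of the structure. -/
def HasFunCode (S : PRA2Structure M) (P : FunCode M) : Prop :=
  (fun v : Fin 4 → M => (P.val ⟨v 0, v 1, v 2⟩ (v 3)).pos) ∈ S.Fun 4 ∧
  (fun v : Fin 4 → M => (P.val ⟨v 0, v 1, v 2⟩ (v 3)).neg) ∈ S.Fun 4 ∧
  (fun v : Fin 4 → M => (P.val ⟨v 0, v 1, v 2⟩ (v 3)).den) ∈ S.Fun 4 ∧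
  (fun v : Fin 4 → M => P.δ ⟨v 0, v 1, v 2⟩ (v 3)) ∈ S.Fun 4

/-- `x` lies in the neighbourhood `(r - 2 ^ (-δ(r,n)), r + 2 ^ (-δ(r,n)))`. -/
def InNbhd (S : PRA2Structure M) (P : FunCode M) (x : M → RatCode M) (r : RatCode M) (n : M) :
    Prop :=
  S.DistLt x (fun _ => r) (S.twoPowNeg (P.δ r n))

/-- The real `y` is the value at `x` of the function on `[0,1]` coded by `P`: it is within
`2 ^ (-n)` of `P.val r` whenever `x` lies in the `n`-th neighbourhood of `r`. -/
def IsValue (S : PRA2Structure M) (P : FunCode M) (x y : M → RatCode M) : Prop :=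
  S.IsReal y ∧ ∀ r n, S.RatInUnit r → S.InNbhd P x r n → S.DistLt y (P.val r) (S.twoPowNeg n)

/-- The code `P` is continuous at `x`: for each `n`, some rational in `[0,1]` has
`x` in its `n`-th neighbourhood. -/
def IsContinuousAt (S : PRA2Structure M) (P : FunCode M) (x : M → RatCode M) : Prop :=
  ∀ n, ∃ r, S.RatInUnit r ∧ S.InNbhd P x r n

/-- `P` presents, in `S`, a continuous function on `[0,1]`: at each real `x` of the structure in
`[0,1]` the function has a value (at a rational `r` this is necessarily `P.val r`, since
`r` lies in all its own neighbourhoods), and the code is continuous at `x`. -/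
def IsContinuousFun (S : PRA2Structure M) (P : FunCode M) : Prop :=
  S.HasFunCode P ∧ (∀ r, S.RatInUnit r → S.IsReal (P.val r)) ∧
    ∀ x, S.IsReal x → S.RealInUnit x → S.IsContinuousAt P x ∧ ∃ y, S.IsValue P x y

/-- `h` is a modulus of uniform continuity of the function on `[0,1]` presented by `P`. -/
def IsModulus (S : PRA2Structure M) (P : FunCode M) (h : M → M) : Prop :=
  h ∈ S.Fun₁ ∧ ∀ n x x' y y', S.IsReal x → S.RealInUnit x → S.IsReal x' → S.RealInUnit x' →
    S.IsValue P x y → S.IsValue P x' y' →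
    S.DistLt x x' (S.twoPowNeg (h n)) → S.DistLt y y' (S.twoPowNeg n)

def UniformContinuityOnUnitInterval (S : PRA2Structure M) : Prop :=
  ∀ P, S.IsContinuousFun P → ∃ h, S.IsModulus P h

/-- The structure over the standard natural numbers with the given function sort. -/
def standard (F : (n : ℕ) → Set ((Fin n → ℕ) → ℕ)) : PRA2Structure ℕ where
  sym c := c.eval
  lt x y := x < y
  Fun := F

/-- The minimal `ω`-model: its functions are the primitive recursive ones. -/
def minimalOmega : PRA2Structure ℕ := standard fun _ => {f | Primrec f}

/-- The full `ω`-model: its functions are all functions. -/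
def fullOmega : PRA2Structure ℕ := standard fun _ => Set.univ

end PRA2Structure

/-- `f` is primitive recursive relative to `m`. -/
inductive PrimrecIn (m : ℕ → ℕ) : {n : ℕ} → ((Fin n → ℕ) → ℕ) → Prop
  | oracle : PrimrecIn m (fun v : Fin 1 → ℕ => m (v 0))
  | zero : PrimrecIn m (fun _ : Fin 0 → ℕ => 0)
  | succ : PrimrecIn m (fun v : Fin 1 → ℕ => v 0 + 1)
  | proj {n : ℕ} (i : Fin n) : PrimrecIn m (fun v : Fin n → ℕ => v i)
  | comp {n k : ℕ} {f : (Fin k → ℕ) → ℕ} {g : Fin k → (Fin n → ℕ) → ℕ} :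
      PrimrecIn m f → (∀ i, PrimrecIn m (g i)) → PrimrecIn m (fun v => f fun i => g i v)
  | prec {n : ℕ} {f : (Fin n → ℕ) → ℕ} {g : (Fin (n + 2) → ℕ) → ℕ} :
      PrimrecIn m f → PrimrecIn m g →
      PrimrecIn m (fun v : Fin (n + 1) → ℕ => Nat.rec (f (Fin.tail v))
        (fun k y => g (Fin.cons k (Fin.cons y (Fin.tail v)))) (v 0))

/-! Uniform continuity follows from `WKL` and `QFAC` by compactness. For fixed n, consider the
binary strings whose slightly enlarged dyadic interval is not contained in the n-th neighbourhood of
any rational with a small code. They form a tree, and a path through it would be a real at which the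
presentation is not continuous. So the tree is bounded (`exists_bound_of_wkl`), and `QFAC` selects a
bounding level for all n at once (`uniformContinuity_of_wkl_qfac`).

For the converse, functions are built from a `Scheme`: dead strings, closed under extension, and a
weight on strings. Strings are carried by the intervals of a Cantor-like subdivision of [0,1] in
base 8. Over each interval whose string is the first dead one on its branch stands a tent of height
2^(-weight) (`Scheme.tents`). Comparing the foot and the peak of a tent of level l and weight w
shows that every modulus h satisfies l ≤ h(w+1) (`Scheme.FirstDead.le_modulus`).

Two things make this work. First, the presentation may use only bounded searches. The subdivision
therefore discards at level i every interval that contains a multiple of 1/i; a rational u/D then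
lies in no interval of level D, and all searches at u/D end by level 2D. Second, the function must
be continuous, and have a value, at each real of the model. For this it is enough that every path of
the model reaches, for each k, a string that is dead or has weight above k (`Scheme.PathSettled`,
`Scheme.isContinuousFun_code`): tents beyond such a string are absent or low.

Two schemes suffice. If T is a tree without a path, let the strings outside T be dead, with weight
0. A modulus bounds the level at which a branch leaves T, so T is not infinite
(`wkl_of_uniformContinuity`). If θ is total, let 0ⁿ1τ have weight n and die once τ is as long as a
witness for n, while 0ⁿ has weight n and stays alive. A modulus h then bounds a witness for n by
h(n+1) (`exists_le_modulus`), and a bounded search gives `QFAC`. The third claim is the same scheme,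
with "g(n) is computed within j steps and is at most j" as θ(n,j). To have f and δ primitive
recursive there, the construction is carried out in an arbitrary class Φ (`FunClass`) of functions
closed under primitive recursion, inside the full ω-model.

For the separation, the ω-model of all functions bounded by some level of the Ackermann function
contains every 0-1-valued function. So it satisfies `WKL`, but `QFAC` would produce the diagonal of
the Ackermann function. -/

/-- A type carrying a model of `PRA²`. -/
class PRAModel (M : Type u) where
  toStr : PRA2Structure M
  isModel : toStr.IsModel

/-- The model of `PRA²` carried by `M`. -/
abbrev str (M : Type u) [PRAModel M] : PRA2Structure M := PRAModel.toStr

/-- A class of functions of the model that is closed under composition and primitive recursion. -/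
structure FunClass (M : Type u) [PRAModel M] where
  Mem : (n : ℕ) → Set ((Fin n → M) → M)
  sub : ∀ {n : ℕ} {f : (Fin n → M) → M}, f ∈ Mem n → f ∈ (str M).Fun n
  sym_mem : ∀ {n : ℕ} (c : PRCode n), (str M).sym c ∈ Mem n
  const_mem : ∀ c : M, (fun _ : Fin 0 → M => c) ∈ Mem 0
  comp_mem : ∀ {n k : ℕ} (f : (Fin k → M) → M) (g : Fin k → (Fin n → M) → M),
    f ∈ Mem k → (∀ i, g i ∈ Mem n) → (fun v => f fun i => g i v) ∈ Mem n
  prec_mem : ∀ {n : ℕ} (f : (Fin n → M) → M) (g : (Fin (n + 2) → M) → M),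
    f ∈ Mem n → g ∈ Mem (n + 2) → ∃ h ∈ Mem (n + 1), ∀ v : Fin n → M,
      h (Fin.cons (str M).zero v) = f v ∧
      ∀ m, h (Fin.cons ((str M).succ m) v) = g (Fin.cons m (Fin.cons (h (Fin.cons m v)) v))

/-- All functions of the model. -/
def FunClass.full (M : Type u) [PRAModel M] : FunClass M where
  Mem := (str M).Fun
  sub h := h
  sym_mem := PRAModel.isModel.sym_mem
  const_mem := PRAModel.isModel.const_mem
  comp_mem := PRAModel.isModel.comp_mem
  prec_mem := PRAModel.isModel.prec_mem

/-- The function `f` belongs to the class `Φ`. -/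
def IsFun {M : Type u} [PRAModel M] (Φ : FunClass M) {n : ℕ} (f : (Fin n → M) → M) : Prop :=
  f ∈ Φ.Mem n

/-! ### Closure properties of classes of functions -/

section Basic

variable {M : Type u} [PRAModel M]

instance : Zero M := ⟨(str M).zero⟩
instance : One M := ⟨(str M).one⟩
instance : Add M := ⟨(str M).add⟩
instance : Mul M := ⟨(str M).mul⟩
instance : LT M := ⟨(str M).lt⟩

namespace IsFun

variable {Φ : FunClass M} {n : ℕ}

theorem comp {k : ℕ} {f : (Fin k → M) → M} {g : Fin k → (Fin n → M) → M} (hf : IsFun Φ f)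
    (hg : ∀ i, IsFun Φ (g i)) : IsFun Φ fun v => f fun i => g i v :=
  Φ.comp_mem f g hf hg

theorem sym (c : PRCode n) : IsFun Φ ((str M).sym c) := Φ.sym_mem c

theorem proj (i : Fin n) : IsFun Φ (fun v : Fin n → M => v i) := by
  have := Φ.sym_mem (PRCode.proj i)
  rwa [show (str M).sym (PRCode.proj i) = fun v : Fin n → M => v i from
    funext fun v => PRAModel.isModel.sym_proj i v] at this

theorem const (c : M) : IsFun Φ (fun _ : Fin n → M => c) :=
  Φ.comp_mem (n := n) (k := 0) _ (fun i => i.elim0) (Φ.const_mem c) (fun i => i.elim0)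

theorem comp₁ {F : M → M} {f : (Fin n → M) → M} (hF : IsFun Φ fun v : Fin 1 → M => F (v 0))
    (hf : IsFun Φ f) : IsFun Φ fun v => F (f v) :=
  hF.comp (g := fun _ => f) fun _ => hf

theorem comp₂ {F : M → M → M} {f g : (Fin n → M) → M}
    (hF : IsFun Φ fun v : Fin 2 → M => F (v 0) (v 1))
    (hf : IsFun Φ f) (hg : IsFun Φ g) : IsFun Φ fun v => F (f v) (g v) :=
  hF.comp (g := ![f, g]) fun i => by fin_cases i <;> assumption

theorem comp₃ {F : M → M → M → M} {f g h : (Fin n → M) → M}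
    (hF : IsFun Φ fun v : Fin 3 → M => F (v 0) (v 1) (v 2))
    (hf : IsFun Φ f) (hg : IsFun Φ g) (hh : IsFun Φ h) : IsFun Φ fun v => F (f v) (g v) (h v) :=
  hF.comp (g := ![f, g, h]) fun i => by fin_cases i <;> assumption

theorem comp₄ {F : M → M → M → M → M} {f g h k : (Fin n → M) → M}
    (hF : IsFun Φ fun v : Fin 4 → M => F (v 0) (v 1) (v 2) (v 3))
    (hf : IsFun Φ f) (hg : IsFun Φ g) (hh : IsFun Φ h) (hk : IsFun Φ k) :
    IsFun Φ fun v => F (f v) (g v) (h v) (k v) :=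
  hF.comp (g := ![f, g, h, k]) fun i => by fin_cases i <;> assumption

theorem sym₁ (c : PRCode 1) {f : (Fin n → M) → M} (hf : IsFun Φ f) :
    IsFun Φ fun v => (str M).sym c ![f v] := by
  have := (sym (Φ := Φ) c).comp (g := ![f]) (fun i => by fin_cases i; exact hf)
  convert this using 3 with v
  funext i; fin_cases i; rfl

theorem sym₂ (c : PRCode 2) {f g : (Fin n → M) → M} (hf : IsFun Φ f) (hg : IsFun Φ g) :
    IsFun Φ fun v => (str M).sym c ![f v, g v] := by
  have := (sym (Φ := Φ) c).comp (g := ![f, g]) (fun i => by fin_cases i <;> assumption)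
  convert this using 3 with v
  funext i; fin_cases i <;> rfl

theorem succ {f : (Fin n → M) → M} (hf : IsFun Φ f) : IsFun Φ fun v => (str M).succ (f v) :=
  hf.sym₁ _

theorem add {f g : (Fin n → M) → M} (hf : IsFun Φ f) (hg : IsFun Φ g) :
    IsFun Φ fun v => f v + g v :=
  hf.sym₂ PRCode.add hg

theorem mul {f g : (Fin n → M) → M} (hf : IsFun Φ f) (hg : IsFun Φ g) :
    IsFun Φ fun v => f v * g v :=
  hf.sym₂ PRCode.mul hg

end IsFun

end Basic

/-! ### The numbers of a model as an ordered semiring, by quantifier-free induction -/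

section Arithmetic

variable {M : Type u} [PRAModel M]

/-- A predicate defined by a quantifier-free formula with parameters. -/
def QFDef {n : ℕ} (p : (Fin n → M) → Prop) : Prop :=
  ∃ φ : QFFormula (str M) n, ∀ v, φ.Holds v ↔ p v

namespace QFDef

variable {n : ℕ} {p q : (Fin n → M) → Prop} {f g : (Fin n → M) → M}

theorem eq (hf : IsFun (.full M) f) (hg : IsFun (.full M) g) : QFDef fun v => f v = g v :=
  ⟨.eq (.app f hf .var) (.app g hg .var), fun _ => Iff.rfl⟩

theorem lt (hf : IsFun (.full M) f) (hg : IsFun (.full M) g) : QFDef fun v => f v < g v :=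
  ⟨.lt (.app f hf .var) (.app g hg .var), fun _ => Iff.rfl⟩

theorem not (hp : QFDef p) : QFDef fun v => ¬ p v := by
  obtain ⟨φ, hφ⟩ := hp
  exact ⟨.not φ, fun v => not_congr (hφ v)⟩

theorem and (hp : QFDef p) (hq : QFDef q) : QFDef fun v => p v ∧ q v := by
  obtain ⟨φ, hφ⟩ := hp
  obtain ⟨ψ, hψ⟩ := hq
  exact ⟨.and φ ψ, fun v => and_congr (hφ v) (hψ v)⟩

theorem or (hp : QFDef p) (hq : QFDef q) : QFDef fun v => p v ∨ q v := by
  simpa only [not_and_or, not_not] using (hp.not.and hq.not).not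

theorem imp (hp : QFDef p) (hq : QFDef q) : QFDef fun v => p v → q v := by
  simpa only [imp_iff_not_or] using hp.not.or hq

end QFDef

namespace PRAModel

theorem not_lt_zero (x : M) : ¬ x < 0 := isModel.not_lt_zero x

theorem lt_succ_iff (x y : M) : x < (str M).succ y ↔ x < y ∨ x = y := isModel.lt_succ_iff x y

theorem induct {p : M → Prop} (hp : QFDef fun v : Fin 1 → M => p (v 0)) (h0 : p 0)
    (hs : ∀ x, p x → p ((str M).succ x)) (x : M) : p x := by
  obtain ⟨φ, hφ⟩ := hp
  refine (hφ ![x]).1 (isModel.induction φ ((hφ _).2 h0) (fun y hy => (hφ _).2 ?_) x)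
  exact hs y ((hφ _).1 hy)

theorem sym_proj {n : ℕ} (i : Fin n) (v : Fin n → M) : (str M).sym (.proj i) v = v i :=
  isModel.sym_proj i v

theorem sym_comp {n k : ℕ} (f : PRCode k) (g : Fin k → PRCode n) (v : Fin n → M) :
    (str M).sym (.comp f g) v = (str M).sym f fun i => (str M).sym (g i) v :=
  isModel.sym_comp f g v

theorem sym_comp₁ {n : ℕ} (f : PRCode 1) (g : PRCode n) (v : Fin n → M) :
    (str M).sym (.comp f ![g]) v = (str M).sym f ![(str M).sym g v] := by
  rw [sym_comp]; congr 1; funext i; fin_cases i; rfl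

theorem sym_comp₂ {n : ℕ} (f : PRCode 2) (g h : PRCode n) (v : Fin n → M) :
    (str M).sym (.comp f ![g, h]) v = (str M).sym f ![(str M).sym g v, (str M).sym h v] := by
  rw [sym_comp]; congr 1; funext i; fin_cases i <;> rfl

theorem sym_zero (v : Fin 0 → M) : (str M).sym .zero v = 0 := by
  rw [Subsingleton.elim v ![]]; rfl

theorem sym_comp_zero {n : ℕ} (v : Fin n → M) : (str M).sym (.comp .zero ![]) v = 0 := by
  rw [sym_comp, sym_zero]

/-- The scheme of the predecessor function. -/
def predCode : PRCode 1 := .prec .zero (.proj 0)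

/-- The predecessor function. -/
def pred (x : M) : M := (str M).sym predCode ![x]

theorem pred_zero : pred (0 : M) = 0 := by
  have := (isModel (M := M)).sym_prec_zero .zero (.proj 0) ![]
  exact this

theorem pred_succ (x : M) : pred ((str M).succ x) = x := by
  have := (isModel (M := M)).sym_prec_succ .zero (.proj 0) x ![]
  exact this.trans (sym_proj _ _)

theorem zero_add' (x : M) : 0 + x = x := by
  have := (isModel (M := M)).sym_prec_zero (.proj 0) (.comp .succ ![.proj 1]) ![x]
  exact this.trans (sym_proj _ _)

theorem succ_add' (x y : M) : (str M).succ x + y = (str M).succ (x + y) := by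
  have := (isModel (M := M)).sym_prec_succ (.proj 0) (.comp .succ ![.proj 1]) x ![y]
  refine this.trans ?_
  rw [sym_comp₁, sym_proj]
  rfl

theorem zero_mul' (x : M) : 0 * x = 0 := by
  have := (isModel (M := M)).sym_prec_zero (.comp .zero ![]) (.comp .add ![.proj 1, .proj 2]) ![x]
  exact this.trans (sym_comp_zero _)

theorem succ_mul' (x y : M) : (str M).succ x * y = x * y + y := by
  have := (isModel (M := M)).sym_prec_succ (.comp .zero ![]) (.comp .add ![.proj 1, .proj 2]) x ![y]
  refine this.trans ?_
  rw [sym_comp₂, sym_proj, sym_proj]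
  rfl

theorem add_zero' (x : M) : x + 0 = x := by
  refine induct (p := fun x : M => x + 0 = x) (.eq (.add (.proj 0) (.const 0)) (.proj 0)) (zero_add' 0)
    (fun x h => ?_) x
  rw [succ_add', h]

theorem add_succ' (x y : M) : x + (str M).succ y = (str M).succ (x + y) := by
  refine induct (p := fun x : M => x + (str M).succ y = (str M).succ (x + y))
    (.eq (.add (.proj 0) (.const _)) (.succ (.add (.proj 0) (.const _)))) ?_ (fun x h => ?_) x
  · rw [zero_add', zero_add']
  · rw [succ_add', h, succ_add']

theorem add_comm' (x y : M) : x + y = y + x := by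
  refine induct (p := fun x : M => x + y = y + x)
    (.eq (.add (.proj 0) (.const _)) (.add (.const _) (.proj 0))) ?_ (fun x h => ?_) x
  · rw [zero_add', add_zero']
  · rw [succ_add', add_succ', h]

theorem add_assoc' (x y z : M) : x + y + z = x + (y + z) := by
  refine induct (p := fun x : M => x + y + z = x + (y + z))
    (.eq (.add (.add (.proj 0) (.const _)) (.const _)) (.add (.proj 0) (.const _)))
    ?_ (fun x h => ?_) x
  · rw [zero_add', zero_add']
  · rw [succ_add', succ_add', succ_add', h]

theorem succ_eq (x : M) : (str M).succ x = x + 1 := by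
  rw [show (1 : M) = (str M).succ 0 from rfl, add_succ', add_zero']

instance : AddCommMonoid M where
  add_assoc := add_assoc'
  zero_add := zero_add'
  add_zero := add_zero'
  add_comm := add_comm'
  nsmul := nsmulRec

theorem mul_zero' (x : M) : x * 0 = 0 := by
  refine induct (p := fun x : M => x * 0 = 0) (.eq (.mul (.proj 0) (.const _)) (.const _))
    (zero_mul' 0) (fun x h => ?_) x
  rw [succ_mul', h, add_zero]

theorem mul_succ' (x y : M) : x * (str M).succ y = x * y + x := by
  refine induct (p := fun x : M => x * (str M).succ y = x * y + x)
    (.eq (.mul (.proj 0) (.const _)) (.add (.mul (.proj 0) (.const _)) (.proj 0)))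
    ?_ (fun x h => ?_) x
  · rw [zero_mul', zero_mul', add_zero]
  · rw [succ_mul', h, succ_mul', succ_eq, succ_eq]; abel

theorem mul_comm' (x y : M) : x * y = y * x := by
  refine induct (p := fun x : M => x * y = y * x)
    (.eq (.mul (.proj 0) (.const _)) (.mul (.const _) (.proj 0))) ?_ (fun x h => ?_) x
  · rw [zero_mul', mul_zero']
  · rw [succ_mul', mul_succ', h]

theorem add_mul' (x y z : M) : (x + y) * z = x * z + y * z := by
  refine induct (p := fun x : M => (x + y) * z = x * z + y * z)
    (.eq (.mul (.add (.proj 0) (.const _)) (.const _))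
      (.add (.mul (.proj 0) (.const _)) (.const _))) ?_ (fun x h => ?_) x
  · rw [zero_mul', zero_add, zero_add]
  · rw [succ_add', succ_mul', h, succ_mul']; abel

theorem mul_assoc' (x y z : M) : x * y * z = x * (y * z) := by
  refine induct (p := fun x : M => x * y * z = x * (y * z))
    (.eq (.mul (.mul (.proj 0) (.const _)) (.const _)) (.mul (.proj 0) (.const _)))
    ?_ (fun x h => ?_) x
  · rw [zero_mul', zero_mul', zero_mul']
  · rw [succ_mul', add_mul', h, succ_mul']

theorem one_mul' (x : M) : 1 * x = x := by
  rw [show (1 : M) = (str M).succ 0 from rfl, succ_mul', zero_mul', zero_add]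

instance : CommSemiring M where
  __ := (inferInstance : AddCommMonoid M)
  mul_assoc := mul_assoc'
  one_mul := one_mul'
  mul_one x := by rw [mul_comm', one_mul']
  zero_mul := zero_mul'
  mul_zero := mul_zero'
  left_distrib x y z := by rw [mul_comm', add_mul', mul_comm' y, mul_comm' z]
  right_distrib := add_mul'
  mul_comm := mul_comm'
  natCast := Nat.unaryCast
  npow := npowRec

theorem lt_add_one_iff' (x y : M) : x < y + 1 ↔ x < y ∨ x = y := by
  rw [← succ_eq, lt_succ_iff]

theorem induct_add_one {p : M → Prop} (hp : QFDef fun v : Fin 1 → M => p (v 0)) (h0 : p 0)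
    (hs : ∀ x, p x → p (x + 1)) (x : M) : p x :=
  induct hp h0 (fun x hx => succ_eq x ▸ hs x hx) x

theorem eq_zero_or_eq_add_one (x : M) : x = 0 ∨ ∃ y, x = y + 1 := by
  have : x = 0 ∨ x = pred x + 1 := by
    refine induct (p := fun x : M => x = 0 ∨ x = pred x + 1)
      (.or (.eq (.proj 0) (.const _)) (.eq (.proj 0) (.add (.sym₁ _ (.proj 0)) (.const _))))
      (.inl rfl) (fun x _ => .inr ?_) x
    rw [pred_succ, succ_eq]
  exact this.imp id fun h => ⟨_, h⟩

theorem add_one_lt_add_one' {x y : M} (h : x < y) : x + 1 < y + 1 := by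
  revert h
  refine induct_add_one (p := fun y : M => x < y → x + 1 < y + 1)
    (.imp (.lt (.const _) (.proj 0)) (.lt (.const _) (.add (.proj 0) (.const _))))
    (fun h => (not_lt_zero _ h).elim) (fun y ih h => ?_) y
  rcases (lt_add_one_iff' _ _).1 h with h | rfl
  · exact (lt_add_one_iff' _ _).2 (.inl (ih h))
  · exact (lt_add_one_iff' _ _).2 (.inr rfl)

theorem lt_trans' {x y z : M} (hxy : x < y) (h : y < z) : x < z := by
  revert h
  refine induct_add_one (p := fun z : M => y < z → x < z)
    (.imp (.lt (.const _) (.proj 0)) (.lt (.const _) (.proj 0)))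
    (fun h => (not_lt_zero _ h).elim) (fun z ih h => ?_) z
  rcases (lt_add_one_iff' _ _).1 h with h | rfl
  · exact (lt_add_one_iff' _ _).2 (.inl (ih h))
  · exact (lt_add_one_iff' _ _).2 (.inl hxy)

theorem lt_irrefl' (x : M) : ¬ x < x := by
  refine induct_add_one (p := fun x : M => ¬ x < x) (.not (.lt (.proj 0) (.proj 0)))
    (not_lt_zero _) (fun x ih h => ih ?_) x
  have hx : x < x + 1 := (lt_add_one_iff' _ _).2 (.inr rfl)
  rcases (lt_add_one_iff' _ _).1 h with h | h
  · exact lt_trans' hx h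
  · rwa [h] at hx

theorem zero_lt_add_one (x : M) : 0 < x + 1 := by
  refine induct_add_one (p := fun x : M => 0 < x + 1) (.lt (.const _) (.add (.proj 0) (.const _)))
    ((lt_add_one_iff' _ _).2 (.inr rfl)) (fun x ih => (lt_add_one_iff' _ _).2 (.inl ih)) x

theorem lt_trichotomy' (x y : M) : x < y ∨ x = y ∨ y < x := by
  refine induct_add_one (p := fun x : M => x < y ∨ x = y ∨ y < x)
    (.or (.lt (.proj 0) (.const _)) (.or (.eq (.proj 0) (.const _)) (.lt (.const _) (.proj 0))))
    ?_ (fun x ih => ?_) x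
  · rcases eq_zero_or_eq_add_one y with rfl | ⟨y, rfl⟩
    · exact .inr (.inl rfl)
    · exact .inl (zero_lt_add_one y)
  · rcases ih with h | rfl | h
    · have := add_one_lt_add_one' h
      rcases (lt_add_one_iff' _ _).1 this with h | h
      · exact .inl h
      · exact .inr (.inl h)
    · exact .inr (.inr ((lt_add_one_iff' _ _).2 (.inr rfl)))
    · exact .inr (.inr ((lt_add_one_iff' _ _).2 (.inl h)))

noncomputable instance : LinearOrder M where
  le x y := x < y ∨ x = y
  le_refl _ := .inr rfl
  le_trans x y z := by
    rintro (h | rfl) (h' | rfl)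
    · exact .inl (lt_trans' h h')
    · exact .inl h
    · exact .inl h'
    · exact .inr rfl
  le_antisymm x y := by
    rintro (h | rfl) (h' | h')
    · exact (lt_irrefl' _ (lt_trans' h h')).elim
    · exact h'.symm
    · rfl
    · rfl
  lt_iff_le_not_ge x y := by
    constructor
    · exact fun h => ⟨.inl h, by
        rintro (h' | rfl)
        · exact lt_irrefl' _ (lt_trans' h h')
        · exact lt_irrefl' _ h⟩
    · rintro ⟨h | rfl, h'⟩
      · exact h
      · exact (h' (.inr rfl)).elim
  le_total x y := by
    rcases lt_trichotomy' x y with h | h | h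
    · exact .inl (.inl h)
    · exact .inl (.inr h)
    · exact .inr (.inl h)
  toDecidableLE := Classical.decRel _

theorem lt_add_one_iff {x y : M} : x < y + 1 ↔ x ≤ y := lt_add_one_iff' x y

theorem zero_le' (x : M) : 0 ≤ x := not_lt.1 (not_lt_zero x)

theorem lt_self_add_one (x : M) : x < x + 1 := lt_add_one_iff.2 le_rfl

theorem add_one_le_iff {x y : M} : x + 1 ≤ y ↔ x < y := by
  constructor
  · exact fun h => (lt_self_add_one x).trans_le h
  · exact fun h => lt_add_one_iff.1 (add_one_lt_add_one' h)

theorem add_lt_add_left' {x y : M} (h : x < y) (z : M) : z + x < z + y := by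
  refine induct_add_one (p := fun z : M => z + x < z + y)
    (.lt (.add (.proj 0) (.const _)) (.add (.proj 0) (.const _))) (by simpa using h)
    (fun z ih => ?_) z
  rw [add_right_comm, add_right_comm z 1]
  exact add_one_lt_add_one' ih

theorem le_self_add' (x y : M) : x ≤ x + y := by
  rcases (zero_le' y).eq_or_lt with rfl | h
  · simp
  · simpa using (add_lt_add_left' h x).le

/-- The existential statement is not open to quantifier-free induction. If it fails, then `x + z <
y` for all z follows by induction on z, which is absurd at z = y. -/
theorem exists_add_of_le' {x y : M} (h : x ≤ y) : ∃ z, y = x + z := by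
  by_contra! H
  have : ∀ z, x + z < y := by
    refine induct_add_one (p := fun z : M => x + z < y)
      (.lt (.add (.const _) (.proj 0)) (.const _)) ?_ (fun z ih => ?_)
    · exact lt_of_le_of_ne (by simpa using h) (H 0).symm
    · rw [← add_assoc]
      exact lt_of_le_of_ne (add_one_le_iff.2 ih) (by rw [add_assoc]; exact (H (z + 1)).symm)
  have h1 := this y
  rw [add_comm] at h1
  exact absurd (le_self_add' y x) (not_le.2 h1)

theorem mul_pos' {x y : M} (hx : 0 < x) (hy : 0 < y) : 0 < x * y := by
  rcases eq_zero_or_eq_add_one x with rfl | ⟨x, rfl⟩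
  · exact absurd hx (lt_irrefl _)
  · rw [add_mul, one_mul, add_comm]
    exact hy.trans_le (le_self_add' _ _)

instance : IsOrderedAddMonoid M where
  add_le_add_left x y h z := by
    rcases h.eq_or_lt with rfl | h
    · exact le_rfl
    · rw [add_comm x, add_comm y]
      exact (add_lt_add_left' h z).le

instance : IsOrderedCancelAddMonoid M where
  le_of_add_le_add_left x y z h := by
    by_contra! h'
    exact absurd h (not_le.2 (add_lt_add_left' h' x))

instance : CanonicallyOrderedAdd M where
  exists_add_of_le := exists_add_of_le'
  le_add_self x y := by rw [add_comm]; exact le_self_add' _ _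
  le_self_add := le_self_add'

instance : Nontrivial M := ⟨⟨0, 1, (zero_lt_add_one (0 : M)).ne.trans_eq (zero_add 1)⟩⟩

theorem mul_lt_mul_left' {x y z : M} (h : x < y) (hz : 0 < z) : z * x < z * y := by
  obtain ⟨w, rfl⟩ := exists_add_of_le' h.le
  have hw : 0 < w := by
    by_contra! hw
    rw [le_antisymm hw (zero_le' _), add_zero] at h
    exact lt_irrefl _ h
  rw [mul_add]
  simpa using add_lt_add_left' (mul_pos' hz hw) (z * x)

instance : IsStrictOrderedRing M where
  zero_le_one := zero_le' _
  le_of_add_le_add_left x y z := le_of_add_le_add_left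
  mul_lt_mul_of_pos_left z hz x y h := mul_lt_mul_left' h hz
  mul_lt_mul_of_pos_right z hz x y h := by
    show x * z < y * z
    rw [mul_comm x, mul_comm y]; exact mul_lt_mul_left' h hz

end PRAModel

end Arithmetic

/-! ### The integers and the ordered field of rationals of a model, formed externally -/

section Field

variable (M : Type u) [PRAModel M]

/-- Pairs of numbers up to equality of formal differences. -/
def diffSetoid : Setoid (M × M) where
  r a b := a.1 + b.2 = b.1 + a.2
  iseqv := ⟨fun _ => rfl, fun h => h.symm, fun {a b c} h h' => by
    have : a.1 + c.2 + (b.1 + b.2) = c.1 + a.2 + (b.1 + b.2) := by linear_combination h + h'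
    exact add_right_cancel this⟩

/-- The ring of integers of the model. -/
def IntOf : Type u := Quotient (diffSetoid M)

variable {M}

namespace IntOf

/-- The formal difference of two numbers. -/
def mk (a b : M) : IntOf M := Quotient.mk (diffSetoid M) (a, b)

theorem mk_eq_mk {a b c d : M} : mk a b = mk c d ↔ a + d = c + b :=
  ⟨fun h => Quotient.exact h, fun h => Quotient.sound h⟩

theorem ind {p : IntOf M → Prop} (h : ∀ a b, p (mk a b)) (x : IntOf M) : p x :=
  Quotient.ind (fun ⟨a, b⟩ => h a b) x

instance : Zero (IntOf M) := ⟨mk 0 0⟩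
instance : One (IntOf M) := ⟨mk 1 0⟩

instance : Neg (IntOf M) :=
  ⟨Quotient.lift (fun a => mk a.2 a.1) fun a b (h : a.1 + b.2 = b.1 + a.2) =>
    mk_eq_mk.2 (by rw [add_comm, ← h, add_comm])⟩

instance : Add (IntOf M) :=
  ⟨Quotient.lift₂ (fun a b => mk (a.1 + b.1) (a.2 + b.2))
    fun a b c d (h : a.1 + c.2 = c.1 + a.2) (h' : b.1 + d.2 = d.1 + b.2) =>
    mk_eq_mk.2 (by linear_combination h + h')⟩

instance : Mul (IntOf M) :=
  ⟨Quotient.lift₂ (fun a b => mk (a.1 * b.1 + a.2 * b.2) (a.1 * b.2 + a.2 * b.1))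
    fun a b c d (h : a.1 + c.2 = c.1 + a.2) (h' : b.1 + d.2 = d.1 + b.2) => by
    refine mk_eq_mk.2 (add_right_cancel (b := c.1 * b.1 + c.2 * b.1 + c.1 * b.2 + c.2 * b.2) ?_)
    linear_combination b.1 * h + b.2 * h.symm + c.1 * h' + c.2 * h'.symm⟩

theorem zero_def : (0 : IntOf M) = mk 0 0 := rfl
theorem one_def : (1 : IntOf M) = mk 1 0 := rfl
theorem neg_mk (a b : M) : -mk a b = mk b a := rfl
theorem mk_add_mk (a b c d : M) : mk a b + mk c d = mk (a + c) (b + d) := rfl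
theorem mk_mul_mk (a b c d : M) : mk a b * mk c d = mk (a * c + b * d) (a * d + b * c) := rfl

instance : CommRing (IntOf M) where
  add_assoc x y z := by
    induction x using ind; induction y using ind; induction z using ind
    simp only [mk_add_mk, add_assoc]
  zero_add x := by induction x using ind; simp only [zero_def, mk_add_mk, zero_add]
  add_zero x := by induction x using ind; simp only [zero_def, mk_add_mk, add_zero]
  add_comm x y := by
    induction x using ind; induction y using ind
    simp only [mk_add_mk, mk_eq_mk]; ring
  neg_add_cancel x := by
    induction x using ind
    simp only [neg_mk, mk_add_mk, zero_def, mk_eq_mk]; ring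
  mul_assoc x y z := by
    induction x using ind; induction y using ind; induction z using ind
    simp only [mk_mul_mk, mk_eq_mk]; ring
  mul_comm x y := by
    induction x using ind; induction y using ind
    simp only [mk_mul_mk, mk_eq_mk]; ring
  one_mul x := by
    induction x using ind; simp only [one_def, mk_mul_mk, mk_eq_mk]; ring
  mul_one x := by
    induction x using ind; simp only [one_def, mk_mul_mk, mk_eq_mk]; ring
  zero_mul x := by
    induction x using ind; simp only [zero_def, mk_mul_mk, mk_eq_mk]; ring
  mul_zero x := by
    induction x using ind; simp only [zero_def, mk_mul_mk, mk_eq_mk]; ring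
  left_distrib x y z := by
    induction x using ind; induction y using ind; induction z using ind
    simp only [mk_mul_mk, mk_add_mk, mk_eq_mk]; ring
  right_distrib x y z := by
    induction x using ind; induction y using ind; induction z using ind
    simp only [mk_mul_mk, mk_add_mk, mk_eq_mk]; ring
  nsmul := nsmulRec
  zsmul := zsmulRec

/-- A number, regarded as an integer. -/
def of : M →+* IntOf M where
  toFun a := mk a 0
  map_one' := rfl
  map_zero' := rfl
  map_add' a b := by simp [mk_add_mk]
  map_mul' a b := by simp [mk_mul_mk]

theorem of_injective : Function.Injective (of : M → IntOf M) := fun a b h => by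
  simpa using mk_eq_mk.1 h

theorem eq_of_or_neg (x : IntOf M) : (∃ a : M, x = of a) ∨ ∃ a : M, x = -of a := by
  induction x using ind with | _ a b
  rcases le_total b a with h | h
  · obtain ⟨c, rfl⟩ := exists_add_of_le h
    exact .inl ⟨c, mk_eq_mk.2 (by ring)⟩
  · obtain ⟨c, rfl⟩ := exists_add_of_le h
    exact .inr ⟨c, mk_eq_mk.2 (by ring)⟩

theorem of_mul_of_eq_zero {a b : M} (h : (of a * of b : IntOf M) = 0) : a = 0 ∨ b = 0 := by
  rw [← map_mul, ← map_zero of] at h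
  exact mul_eq_zero.1 (of_injective h)

instance : Nontrivial (IntOf M) := of_injective.nontrivial

instance : NoZeroDivisors (IntOf M) where
  eq_zero_or_eq_zero_of_mul_eq_zero {x y} h := by
    rcases eq_of_or_neg x with ⟨a, rfl⟩ | ⟨a, rfl⟩ <;>
    rcases eq_of_or_neg y with ⟨b, rfl⟩ | ⟨b, rfl⟩ <;>
    rcases of_mul_of_eq_zero (a := a) (b := b)
      (by simpa only [neg_mul, mul_neg, neg_eq_zero] using h) with rfl | rfl <;>
    simp

instance : IsDomain (IntOf M) := NoZeroDivisors.to_isDomain _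

end IntOf

variable (M) in
/-- The field of rational numbers of the model. -/
def RatOf : Type u := FractionRing (IntOf M)

namespace RatOf

noncomputable instance : Field (RatOf M) := inferInstanceAs (Field (FractionRing (IntOf M)))

noncomputable instance : Algebra (IntOf M) (RatOf M) :=
  inferInstanceAs (Algebra (IntOf M) (FractionRing (IntOf M)))

instance : IsFractionRing (IntOf M) (RatOf M) :=
  inferInstanceAs (IsFractionRing (IntOf M) (FractionRing (IntOf M)))

/-- The embedding of the numbers into the rationals. -/
noncomputable def of : M →+* RatOf M := (algebraMap (IntOf M) (RatOf M)).comp IntOf.of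

theorem of_injective : Function.Injective (of : M → RatOf M) :=
  (IsFractionRing.injective (IntOf M) (RatOf M)).comp IntOf.of_injective

theorem of_eq_zero {a : M} : of a = 0 ↔ a = 0 := map_eq_zero_iff _ of_injective

theorem eq_div_or_neg (x : RatOf M) :
    ∃ a b : M, b ≠ 0 ∧ (x = of a / of b ∨ x = -(of a / of b)) := by
  obtain ⟨y, z, hz, rfl⟩ := IsFractionRing.div_surjective (A := IntOf M) x
  have hz0 := nonZeroDivisors.ne_zero hz
  rcases IntOf.eq_of_or_neg y with ⟨a, rfl⟩ | ⟨a, rfl⟩ <;>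
  rcases IntOf.eq_of_or_neg z with ⟨b, rfl⟩ | ⟨b, rfl⟩ <;>
  refine ⟨a, b, by rintro rfl; simp at hz0, ?_⟩
  · exact .inl rfl
  · exact .inr (by rw [map_neg, div_neg]; rfl)
  · exact .inr (by rw [map_neg, neg_div]; rfl)
  · exact .inl (by rw [map_neg, map_neg, neg_div_neg_eq]; rfl)

variable (M) in
/-- The cone of nonnegative rationals. -/
noncomputable def cone : RingCone (RatOf M) where
  carrier := {x | ∃ a b : M, b ≠ 0 ∧ x = of a / of b}
  mul_mem' := by
    rintro _ _ ⟨a, b, hb, rfl⟩ ⟨c, d, hd, rfl⟩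
    exact ⟨a * c, b * d, mul_ne_zero hb hd, by rw [map_mul, map_mul, div_mul_div_comm]⟩
  one_mem' := ⟨1, 1, one_ne_zero, by simp⟩
  add_mem' := by
    rintro _ _ ⟨a, b, hb, rfl⟩ ⟨c, d, hd, rfl⟩
    refine ⟨a * d + b * c, b * d, mul_ne_zero hb hd, ?_⟩
    rw [div_add_div _ _ (of_eq_zero.not.2 hb) (of_eq_zero.not.2 hd)]
    simp only [map_add, map_mul]
  zero_mem' := ⟨0, 1, one_ne_zero, by simp⟩
  eq_zero_of_mem_of_neg_mem' := by
    rintro _ ⟨a, b, hb, rfl⟩ ⟨c, d, hd, h⟩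
    have hb' := of_eq_zero.not.2 hb
    have hd' := of_eq_zero.not.2 hd
    have : of (a * d + c * b) = 0 := by
      simp only [map_add, map_mul]
      field_simp at h
      linear_combination -h
    rw [of_eq_zero, add_eq_zero] at this
    rcases mul_eq_zero.1 this.1 with rfl | h
    · simp
    · exact (hd h).elim

instance : HasMemOrNegMem (cone M) where
  mem_or_neg_mem x := by
    obtain ⟨a, b, hb, h | h⟩ := eq_div_or_neg x
    · exact .inl ⟨a, b, hb, h⟩
    · exact .inr ⟨a, b, hb, by rw [h, neg_neg]⟩

open Classical in
noncomputable instance : LinearOrder (RatOf M) := .mkOfAddGroupCone (cone M)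

instance : IsOrderedRing (RatOf M) := .mkOfCone (cone M)

instance : IsStrictOrderedRing (RatOf M) := IsOrderedRing.toIsStrictOrderedRing _

theorem nonneg_iff {x : RatOf M} : 0 ≤ x ↔ ∃ a b : M, b ≠ 0 ∧ x = of a / of b := by
  show x - 0 ∈ cone M ↔ _
  rw [sub_zero]; rfl

theorem of_nonneg (a : M) : 0 ≤ of a := nonneg_iff.2 ⟨a, 1, one_ne_zero, by simp⟩

theorem of_mono : Monotone (of : M → RatOf M) := fun a b h => by
  obtain ⟨c, rfl⟩ := exists_add_of_le h
  rw [map_add]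
  exact le_add_of_nonneg_right (of_nonneg c)

theorem of_strictMono : StrictMono (of : M → RatOf M) := of_mono.strictMono_of_injective of_injective

@[simp] theorem of_le {a b : M} : of a ≤ of b ↔ a ≤ b := of_strictMono.le_iff_le
@[simp] theorem of_lt {a b : M} : of a < of b ↔ a < b := of_strictMono.lt_iff_lt

theorem of_add_one_pos (a : M) : 0 < of a + 1 := by linarith [of_nonneg a]

theorem of_pos {a : M} : 0 < of a ↔ 0 < a := by rw [← map_zero of, of_lt]

theorem nonneg_iff' {x : RatOf M} : 0 ≤ x ↔ ∃ a d : M, x = of a / (of d + 1) := by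
  rw [nonneg_iff]
  constructor
  · rintro ⟨a, b, hb, rfl⟩
    obtain rfl | ⟨d, rfl⟩ := PRAModel.eq_zero_or_eq_add_one b
    · exact (hb rfl).elim
    · exact ⟨a, d, by simp⟩
  · rintro ⟨a, d, rfl⟩
    exact ⟨a, d + 1, (PRAModel.zero_lt_add_one d).ne', by simp⟩

end RatOf

end Field

/-! ### Truncated subtraction, decidable predicates and bounded search -/

section Functions

variable {M : Type u} [PRAModel M]

open PRAModel

namespace IsFun

variable {Φ : FunClass M} {n : ℕ}

theorem toFull {f : (Fin n → M) → M} (hf : IsFun Φ f) : IsFun (.full M) f := Φ.sub hf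

theorem exists_prec {f : (Fin n → M) → M} {g : (Fin (n + 2) → M) → M} (hf : IsFun Φ f)
    (hg : IsFun Φ g) : ∃ h : M → (Fin n → M) → M,
      IsFun Φ (fun v : Fin (n + 1) → M => h (v 0) (Fin.tail v)) ∧ (∀ v, h 0 v = f v) ∧
      ∀ m v, h (m + 1) v = g (Fin.cons m (Fin.cons (h m v) v)) := by
  obtain ⟨h, hh, H⟩ := Φ.prec_mem f g hf hg
  refine ⟨fun m v => h (Fin.cons m v), ?_, fun v => (H v).1, fun m v => ?_⟩
  · simpa only [IsFun, Fin.cons_self_tail] using hh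
  · rw [← succ_eq]; exact (H v).2 m

theorem exists_rec₃ {F : M → M → M} {G : M → M → M → M → M}
    (hF : IsFun Φ fun v : Fin 2 → M => F (v 0) (v 1))
    (hG : IsFun Φ fun v : Fin 4 → M => G (v 0) (v 1) (v 2) (v 3)) :
    ∃ h : M → M → M → M, IsFun Φ (fun v : Fin 3 → M => h (v 0) (v 1) (v 2)) ∧
      (∀ x y, h 0 x y = F x y) ∧ ∀ m x y, h (m + 1) x y = G m (h m x y) x y := by
  obtain ⟨h, hh, h0, hs⟩ := exists_prec hF hG
  refine ⟨fun m x y => h m ![x, y], ?_, fun x y => h0 _, fun m x y => hs m _⟩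
  convert hh using 2 with v
  refine congrArg (h (v 0)) ?_; funext i; fin_cases i <;> rfl

end IsFun

namespace PRAModel

/-- The scheme of truncated subtraction, with the arguments in reversed order. -/
def subCode : PRCode 2 := .prec (.proj 0) (.comp predCode ![.proj 1])

instance : Sub M := ⟨fun x y => (str M).sym subCode ![y, x]⟩

theorem sub_zero' (x : M) : x - 0 = x := by
  have := (isModel (M := M)).sym_prec_zero (.proj 0) (.comp predCode ![.proj 1]) ![x]
  exact this.trans (sym_proj _ _)

theorem sub_add_one (x y : M) : x - (y + 1) = pred (x - y) := by
  have := (isModel (M := M)).sym_prec_succ (.proj 0) (.comp predCode ![.proj 1]) y ![x]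
  rw [← succ_eq]
  refine this.trans ?_
  rw [sym_comp₁, sym_proj]
  rfl

theorem isFun_sub {Φ : FunClass M} {n : ℕ} {f g : (Fin n → M) → M} (hf : IsFun Φ f)
    (hg : IsFun Φ g) : IsFun Φ fun v => f v - g v :=
  hg.sym₂ subCode hf

theorem pred_add_one (x : M) : pred (x + 1) = x := by rw [← succ_eq, pred_succ]

theorem add_one_sub_add_one (x y : M) : (x + 1) - (y + 1) = x - y := by
  refine induct_add_one (p := fun y : M => (x + 1) - (y + 1) = x - y)
    (.eq (isFun_sub (.const _) (.add (.proj 0) (.const _))) (isFun_sub (.const _) (.proj 0)))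
    ?_ (fun y ih => ?_) y
  · rw [sub_add_one, sub_zero', sub_zero', pred_add_one]
  · rw [sub_add_one, ih, sub_add_one]

theorem zero_sub' (x : M) : 0 - x = 0 := by
  refine induct_add_one (p := fun x : M => 0 - x = 0)
    (.eq (isFun_sub (.const _) (.proj 0)) (.const _)) (sub_zero' 0) (fun y ih => ?_) x
  rw [sub_add_one, ih, pred_zero]

theorem add_sub_cancel_right' (x y : M) : x + y - y = x := by
  refine induct_add_one (p := fun y : M => x + y - y = x)
    (.eq (isFun_sub (.add (.const _) (.proj 0)) (.proj 0)) (.const _)) (by rw [sub_zero', add_zero])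
    (fun y ih => ?_) y
  rw [← add_assoc, add_one_sub_add_one, ih]

theorem sub_self_add' (x y : M) : x - (x + y) = 0 := by
  refine induct_add_one (p := fun x : M => x - (x + y) = 0)
    (.eq (isFun_sub (.proj 0) (.add (.proj 0) (.const _))) (.const _)) (zero_sub' _)
    (fun x ih => ?_) x
  rw [add_right_comm, add_one_sub_add_one, ih]

instance : OrderedSub M where
  tsub_le_iff_right x y z := by
    rcases le_total x y with h | h <;> obtain ⟨w, rfl⟩ := exists_add_of_le h
    · rw [sub_self_add']
      exact iff_of_true (zero_le' z) (h.trans (by rw [add_comm z]; exact le_self_add))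
    · rw [add_comm y, add_sub_cancel_right']
      exact (add_le_add_iff_right y).symm

end PRAModel

namespace IsFun

variable {Φ : FunClass M} {n : ℕ}

theorem tsub {f g : (Fin n → M) → M} (hf : IsFun Φ f) (hg : IsFun Φ g) :
    IsFun Φ fun v => f v - g v :=
  isFun_sub hf hg

end IsFun

open Classical in
/-- The predicate `p` has its characteristic function in the class `Φ`. -/
def DecP (Φ : FunClass M) {n : ℕ} (p : (Fin n → M) → Prop) : Prop :=
  IsFun Φ fun v => if p v then (1 : M) else 0

theorem one_tsub_eq_ite (x : M) [Decidable (x = 0)] : 1 - x = if x = 0 then 1 else 0 := by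
  split_ifs with h
  · rw [h, tsub_zero]
  · exact tsub_eq_zero_of_le (by simpa using add_one_le_iff.2 (pos_iff_ne_zero.2 h))

namespace DecP

variable {Φ : FunClass M} {n : ℕ} {p q : (Fin n → M) → Prop} {f g : (Fin n → M) → M}

theorem of_ite {dec : ∀ v, Decidable (p v)} (h : IsFun Φ fun v => if p v then (1 : M) else 0) :
    DecP Φ p := by
  unfold DecP
  convert h

theorem of_iff (hp : DecP Φ p) (h : ∀ v, q v ↔ p v) : DecP Φ q := by
  rwa [show q = p from funext fun v => propext (h v)]

theorem toFull (hp : DecP Φ p) : DecP (.full M) p := Φ.sub hp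

theorem comp {k : ℕ} {p : (Fin k → M) → Prop} {g : Fin k → (Fin n → M) → M} (hp : DecP Φ p)
    (hg : ∀ i, IsFun Φ (g i)) : DecP Φ fun v => p fun i => g i v :=
  IsFun.comp hp hg

theorem comp₁ {p : M → Prop} (hp : DecP Φ fun v : Fin 1 → M => p (v 0)) (hf : IsFun Φ f) :
    DecP Φ fun v => p (f v) :=
  hp.comp (g := fun _ => f) fun _ => hf

theorem comp₂ {p : M → M → Prop} (hp : DecP Φ fun v : Fin 2 → M => p (v 0) (v 1))
    (hf : IsFun Φ f) (hg : IsFun Φ g) : DecP Φ fun v => p (f v) (g v) :=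
  hp.comp (g := ![f, g]) fun i => by fin_cases i <;> assumption

theorem eq (hf : IsFun Φ f) (hg : IsFun Φ g) : DecP Φ fun v => f v = g v := by
  have := (IsFun.const 1).tsub ((hf.tsub hg).add (hg.tsub hf))
  simp only [one_tsub_eq_ite, add_eq_zero, tsub_eq_zero_iff_le, ← le_antisymm_iff] at this
  exact .of_ite this

theorem not (hp : DecP Φ p) : DecP Φ fun v => ¬ p v := by
  have := (IsFun.const 1).tsub hp
  simp only [one_tsub_eq_ite] at this
  exact (DecP.of_ite this).of_iff fun v => by simp

theorem le (hf : IsFun Φ f) (hg : IsFun Φ g) : DecP Φ fun v => f v ≤ g v :=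
  (DecP.eq (hf.tsub hg) (.const 0)).of_iff fun _ => tsub_eq_zero_iff_le.symm

theorem lt (hf : IsFun Φ f) (hg : IsFun Φ g) : DecP Φ fun v => f v < g v :=
  (DecP.le hg hf).not.of_iff fun _ => not_le.symm

theorem and (hp : DecP Φ p) (hq : DecP Φ q) : DecP Φ fun v => p v ∧ q v := by
  have := hp.mul hq
  simp only [← ite_and, mul_ite, mul_one, mul_zero] at this
  exact DecP.of_iff (p := fun v => q v ∧ p v) (.of_ite this) fun _ => and_comm

theorem or (hp : DecP Φ p) (hq : DecP Φ q) : DecP Φ fun v => p v ∨ q v :=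
  (hp.not.and hq.not).not.of_iff fun _ => by rw [not_and_or, not_not, not_not]

theorem imp (hp : DecP Φ p) (hq : DecP Φ q) : DecP Φ fun v => p v → q v :=
  (hp.not.or hq).of_iff fun _ => imp_iff_not_or

theorem const (P : Prop) : DecP Φ fun _ : Fin n → M => P := IsFun.const _

theorem qfDef (hp : DecP Φ p) : QFDef p := by
  obtain ⟨φ, hφ⟩ := QFDef.eq hp.toFull (IsFun.const 1)
  exact ⟨φ, fun v => (hφ v).trans (by simp)⟩

/-- Together with `qfDef` this identifies quantifier-free definability with having a characteristic
function in the model, so that induction and choice apply to every `DecP` predicate. -/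
theorem of_qfDef (hp : QFDef p) : DecP (.full M) p := by
  obtain ⟨φ, hφ⟩ := hp
  have hterm : ∀ t : QFTerm (str M) n, IsFun (.full M) fun v => t.eval v := by
    intro t
    induction t with
    | var i => exact .proj i
    | param c => exact .const c
    | sym c t ih => exact (IsFun.sym c).comp ih
    | app F hF t ih => exact IsFun.comp hF ih
  have : DecP (.full M) fun v => φ.Holds v := by
    clear hφ
    induction φ with
    | eq s t => exact .eq (hterm s) (hterm t)
    | lt s t => exact .lt (hterm s) (hterm t)
    | not φ ih => exact ih.not
    | and φ ψ ih₁ ih₂ => exact ih₁.and ih₂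
  exact this.of_iff fun v => (hφ v).symm

theorem ite {dec : ∀ v, Decidable (p v)} (hp : DecP Φ p) (hf : IsFun Φ f) (hg : IsFun Φ g) :
    IsFun Φ fun v => if p v then f v else g v := by
  have := (hp.mul hf).add (hp.not.mul hg)
  convert this using 2 with v
  split_ifs <;> simp_all

end DecP

theorem induct_dec {Φ : FunClass M} {p : M → Prop} (hp : DecP Φ fun v : Fin 1 → M => p (v 0))
    (h0 : p 0) (hs : ∀ x, p x → p (x + 1)) (x : M) : p x :=
  induct_add_one hp.qfDef h0 hs x

theorem induct_le {Φ : FunClass M} {p : M → Prop} (hp : DecP Φ fun v : Fin 1 → M => p (v 0))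
    {a : M} (h0 : p a) (hs : ∀ x, a ≤ x → p x → p (x + 1)) {x : M} (hx : a ≤ x) : p x := by
  obtain ⟨y, rfl⟩ := exists_add_of_le hx
  refine induct_dec (p := fun y : M => p (a + y)) (hp.comp₁ (.add (.const a) (.proj 0)))
    (by rwa [add_zero]) (fun y ih => ?_) y
  rw [← add_assoc]
  exact hs _ le_self_add ih

open Classical in
/-- The least `y < b` with `p y`, and `b` if there is none. -/
noncomputable def leastBelow (p : M → Prop) (b : M) : M :=
  if h : ∃ y < b, p y ∧ ∀ z < y, ¬ p z then h.choose else b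

/-- `leastBelow` is defined by choice outside the model. This characterization identifies it with
the search function that any class Φ supplies. -/
theorem leastBelow_eq {p : M → Prop} {b c : M} (h : c < b ∧ p c ∨ c = b) (h' : ∀ z < c, ¬ p z) :
    leastBelow p b = c := by
  unfold leastBelow
  split_ifs with H
  · obtain ⟨h1, h2, h3⟩ := H.choose_spec
    rcases lt_trichotomy H.choose c with hc | hc | hc
    · exact (h' _ hc h2).elim
    · exact hc
    · rcases h with ⟨_, h⟩ | rfl
      · exact (h3 _ hc h).elim
      · exact (hc.not_gt h1).elim
  · rcases h with ⟨hb, hp⟩ | rfl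
    · exact (H ⟨c, hb, hp, h'⟩).elim
    · rfl

/-- Recursion on the bound: a value already below b is kept; otherwise b itself is tested, and b + 1
records failure. -/
theorem exists_leastBelow {Φ : FunClass M} {n : ℕ} {p : (Fin n → M) → M → Prop}
    (hp : DecP Φ fun v : Fin (n + 1) → M => p (Fin.tail v) (v 0)) :
    ∃ h : M → (Fin n → M) → M, IsFun Φ (fun v : Fin (n + 1) → M => h (v 0) (Fin.tail v)) ∧
      ∀ b v, (h b v < b ∧ p v (h b v) ∨ h b v = b) ∧ ∀ z < h b v, ¬ p v z := by
  classical
  have hp' : DecP Φ fun v : Fin (n + 2) → M => p (Fin.tail (Fin.tail v)) (v 0) :=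
    hp.comp (n := n + 2) (g := Fin.cons (fun v => v 0) fun i v => Fin.tail (Fin.tail v) i)
      fun i => by
        refine Fin.cases ?_ (fun j => ?_) i
        · exact .proj 0
        · exact .proj j.succ.succ
  obtain ⟨h, hh, h0, hs⟩ := IsFun.exists_prec (Φ := Φ) (n := n) (.const 0)
    (DecP.ite (dec := fun _ => Classical.propDecidable _) (.lt (.proj 1) (.proj 0)) (.proj 1)
      (DecP.ite (dec := fun _ => Classical.propDecidable _) hp' (.proj 0) (.add (.proj 0) (.const 1))))
  simp only [Fin.cons_zero, Fin.cons_one, Fin.tail_cons] at hs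
  refine ⟨h, hh, fun b v => ?_⟩
  have hv : IsFun Φ fun w : Fin 1 → M => h (w 0) v :=
    hh.comp (n := 1) (g := Fin.cons (fun w => w 0) fun i _ => v i) fun i => by
      refine Fin.cases ?_ (fun j => ?_) i
      · exact .proj 0
      · exact .const _
  have hpv : DecP Φ fun w : Fin 1 → M => p v (h (w 0) v) :=
    hp.comp (n := 1) (g := Fin.cons (fun w => h (w 0) v) fun i _ => v i) fun i => by
      refine Fin.cases ?_ (fun j => ?_) i
      · exact hv
      · exact .const _
  constructor
  · refine induct_dec (p := fun b : M => h b v < b ∧ p v (h b v) ∨ h b v = b)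
      (.or (.and (.lt hv (.proj 0)) hpv) (.eq hv (.proj 0))) (.inr (h0 v)) (fun b ih => ?_) b
    rw [hs]
    split_ifs with h1 h2
    · exact .inl ⟨h1.trans (lt_self_add_one b), (ih.resolve_right h1.ne).2⟩
    · exact .inl ⟨lt_self_add_one b, h2⟩
    · exact .inr rfl
  · intro z hz hpz
    refine hz.not_ge ?_
    have : ∀ b, z < b → h b v ≤ z := by
      refine induct_dec (.imp (.lt (.const _) (.proj 0)) (.le hv (.const _)))
        (fun h => (_root_.not_lt_zero h).elim) (fun b ih hb => ?_)
      rw [hs]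
      rcases (lt_add_one_iff.1 hb).eq_or_lt with rfl | hb
      · rw [if_pos hpz]
        split_ifs with h1
        · exact h1.le
        · exact le_rfl
      · rw [if_pos ((ih hb).trans_lt hb)]
        exact ih hb
    rcases lt_or_ge z b with h1 | h1
    · exact this b h1
    · have : h b v ≤ b := by
        refine induct_dec (p := fun b : M => h b v ≤ b) (.le hv (.proj 0)) (h0 v).le
          (fun b ih => ?_) b
        rw [hs]
        split_ifs
        · exact ih.trans (lt_self_add_one b).le
        · exact (lt_self_add_one b).le
        · exact le_rfl
      exact this.trans h1

theorem IsFun.leastBelow {Φ : FunClass M} {n : ℕ} {p : (Fin n → M) → M → Prop}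
    {b : (Fin n → M) → M} (hp : DecP Φ fun v : Fin (n + 1) → M => p (Fin.tail v) (v 0))
    (hb : IsFun Φ b) : IsFun Φ fun v => leastBelow (p v) (b v) := by
  obtain ⟨h, hh, H⟩ := exists_leastBelow hp
  have : (fun v => _root_.leastBelow (p v) (b v)) = fun v => h (b v) v :=
    funext fun v => leastBelow_eq (H _ v).1 (H _ v).2
  rw [this]
  refine hh.comp (n := n) (g := Fin.cons b fun i v => v i) fun i => ?_
  refine Fin.cases ?_ (fun j => ?_) i
  · exact hb
  · exact .proj j

section Least

variable {Φ : FunClass M} {p : M → Prop}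

theorem leastBelow_spec (hp : DecP Φ fun v : Fin 1 → M => p (v 0)) (b : M) :
    (leastBelow p b < b ∧ p (leastBelow p b) ∨ leastBelow p b = b) ∧
      ∀ z < leastBelow p b, ¬ p z := by
  obtain ⟨h, hh, H⟩ := exists_leastBelow (n := 0) (p := fun _ => p) hp
  rw [leastBelow_eq (H b ![]).1 (H b ![]).2]
  exact H b ![]

theorem leastBelow_of_lt (hp : DecP Φ fun v : Fin 1 → M => p (v 0)) {b y : M} (hy : y < b)
    (hpy : p y) : leastBelow p b ≤ y ∧ p (leastBelow p b) := by
  obtain ⟨h1, h2⟩ := leastBelow_spec hp b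
  have h3 : leastBelow p b ≤ y := not_lt.1 fun h => h2 _ h hpy
  exact ⟨h3, (h1.resolve_right (h3.trans_lt hy).ne).2⟩

theorem exists_least (hp : DecP Φ fun v : Fin 1 → M => p (v 0)) (h : ∃ y, p y) :
    ∃ y, p y ∧ ∀ z < y, ¬ p z := by
  obtain ⟨y, hy⟩ := h
  exact ⟨_, (leastBelow_of_lt hp (lt_self_add_one y) hy).2, (leastBelow_spec hp _).2⟩

end Least

theorem DecP.bex {Φ : FunClass M} {n : ℕ} {p : (Fin n → M) → M → Prop}
    {b : (Fin n → M) → M} (hp : DecP Φ fun v : Fin (n + 1) → M => p (Fin.tail v) (v 0))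
    (hb : IsFun Φ b) : DecP Φ fun v => ∃ y < b v, p v y := by
  refine (DecP.lt (IsFun.leastBelow hp hb) hb).of_iff fun v => ?_
  have hv : DecP Φ fun w : Fin 1 → M => p v (w 0) :=
    hp.comp (n := 1) (g := Fin.cons (fun w => w 0) fun i _ => v i) fun i => by
      refine Fin.cases ?_ (fun j => ?_) i
      · exact .proj 0
      · exact .const _
  constructor
  · rintro ⟨y, hy, hpy⟩
    exact (leastBelow_of_lt hv hy hpy).1.trans_lt hy
  · exact fun h => ⟨_, h, ((leastBelow_spec hv _).1.resolve_right h.ne).2⟩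

theorem DecP.ball {Φ : FunClass M} {n : ℕ} {p : (Fin n → M) → M → Prop}
    {b : (Fin n → M) → M} (hp : DecP Φ fun v : Fin (n + 1) → M => p (Fin.tail v) (v 0))
    (hb : IsFun Φ b) : DecP Φ fun v => ∀ y < b v, p v y :=
  (DecP.bex (p := fun v y => ¬ p v y) hp.not hb).not.of_iff fun v => by push Not; rfl

end Functions

/-! ### Division, powers of two and the binary logarithm -/

section Numbers

variable {M : Type u} [PRAModel M]

open PRAModel

/-- The quotient of `x` by `y`, rounded down. -/
noncomputable def quo (x y : M) : M := leastBelow (fun q => x < (q + 1) * y) (x + 1)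

theorem IsFun.quo {Φ : FunClass M} {n : ℕ} {f g : (Fin n → M) → M} (hf : IsFun Φ f)
    (hg : IsFun Φ g) : IsFun Φ fun v => quo (f v) (g v) := by
  refine IsFun.comp₂ ?_ hf hg
  exact IsFun.leastBelow (p := fun v q => v 0 < (q + 1) * v 1)
    (.lt (.proj (Fin.succ 0)) (.mul (.add (.proj 0) (.const 1)) (.proj (Fin.succ 1))))
    (.add (.proj 0) (.const 1))

theorem quo_spec (x : M) {y : M} (hy : 0 < y) : quo x y * y ≤ x ∧ x < (quo x y + 1) * y := by
  have hd : DecP (.full M) fun v : Fin 1 → M => x < (v 0 + 1) * y :=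
    .lt (.const _) (.mul (.add (.proj 0) (.const 1)) (.const _))
  have hx : x < (x + 1) * y :=
    (lt_self_add_one x).trans_le (le_mul_of_one_le_right (zero_le' _) (by simpa using add_one_le_iff.2 hy))
  refine ⟨?_, (leastBelow_of_lt (p := fun q => x < (q + 1) * y) hd (lt_self_add_one x) hx).2⟩
  rcases eq_zero_or_eq_add_one (quo x y) with h | ⟨z, h⟩
  · rw [h, zero_mul]; exact zero_le' _
  · rw [h]
    exact not_lt.1 ((leastBelow_spec (p := fun q => x < (q + 1) * y) hd (x + 1)).2 z (by rw [← quo, h]; exact lt_self_add_one z))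

/-- The power `2 ^ k`, computed in the model. -/
def pow2 (k : M) : M := (str M).predTwoPow k + 1

theorem IsFun.predTwoPow {Φ : FunClass M} {n : ℕ} {f : (Fin n → M) → M} (hf : IsFun Φ f) :
    IsFun Φ fun v => (str M).predTwoPow (f v) :=
  hf.sym₁ _

theorem IsFun.pow2 {Φ : FunClass M} {n : ℕ} {f : (Fin n → M) → M} (hf : IsFun Φ f) :
    IsFun Φ fun v => pow2 (f v) :=
  hf.predTwoPow.add (.const 1)

theorem predTwoPow_zero : (str M).predTwoPow 0 = 0 := by
  have := (isModel (M := M)).sym_prec_zero .zero (.comp .succ ![.comp .add ![.proj 1, .proj 1]]) ![]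
  exact this

theorem predTwoPow_add_one (k : M) :
    (str M).predTwoPow (k + 1) = (str M).predTwoPow k + (str M).predTwoPow k + 1 := by
  have := (isModel (M := M)).sym_prec_succ .zero (.comp .succ ![.comp .add ![.proj 1, .proj 1]]) k ![]
  rw [← succ_eq, ← succ_eq]
  refine this.trans ?_
  rw [sym_comp₁, sym_comp₂, sym_proj]
  rfl

@[simp] theorem pow2_zero : pow2 (0 : M) = 1 := by rw [pow2, predTwoPow_zero, zero_add]

@[simp] theorem pow2_add_one (k : M) : pow2 (k + 1) = 2 * pow2 k := by
  rw [pow2, pow2, predTwoPow_add_one]; ring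

@[simp] theorem pow2_one : pow2 (1 : M) = 2 := by
  rw [← zero_add (1 : M), pow2_add_one, pow2_zero, mul_one]

theorem pow2_pos (k : M) : 0 < pow2 k := zero_lt_add_one _

theorem pow2_add (a b : M) : pow2 (a + b) = pow2 a * pow2 b := by
  refine induct_dec (Φ := .full M) (p := fun b : M => pow2 (a + b) = pow2 a * pow2 b)
    (.eq (.pow2 (.add (.const _) (.proj 0))) (.mul (.const _) (.pow2 (.proj 0)))) (by simp)
    (fun b ih => ?_) b
  rw [← add_assoc, pow2_add_one, ih, pow2_add_one]; ring

theorem lt_pow2 (k : M) : k < pow2 k := by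
  refine induct_dec (Φ := .full M) (p := fun k : M => k < pow2 k) (.lt (.proj 0) (.pow2 (.proj 0)))
    (pow2_pos 0) (fun k ih => ?_) k
  rw [pow2_add_one, two_mul]
  exact add_lt_add_of_lt_of_le ih (by simpa using add_one_le_iff.2 (pow2_pos k))

theorem pow2_strictMono : StrictMono (pow2 : M → M) := fun a b h => by
  obtain ⟨c, rfl⟩ := exists_add_of_le (add_one_le_iff.2 h)
  rw [pow2_add, pow2_add_one]
  have h1 := pow2_pos a
  have h2 : 1 ≤ pow2 c := by simpa using add_one_le_iff.2 (pow2_pos c)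
  calc pow2 a < 2 * pow2 a := by rw [two_mul]; exact lt_add_of_pos_left _ h1
    _ ≤ 2 * pow2 a * pow2 c := le_mul_of_one_le_right (zero_le' _) h2

/-- The integer part of the binary logarithm. -/
noncomputable def lg (m : M) : M := leastBelow (fun l => m < pow2 (l + 1)) (m + 1)

theorem IsFun.lg {Φ : FunClass M} {n : ℕ} {f : (Fin n → M) → M} (hf : IsFun Φ f) :
    IsFun Φ fun v => lg (f v) := by
  refine IsFun.comp₁ ?_ hf
  exact IsFun.leastBelow (p := fun v (l : M) => v 0 < _root_.pow2 (l + 1))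
    (.lt (.proj (Fin.succ 0)) (.pow2 (.add (.proj 0) (.const 1)))) (.add (.proj 0) (.const 1))

theorem lg_spec {m : M} (hm : 0 < m) : pow2 (lg m) ≤ m ∧ m < pow2 (lg m + 1) := by
  have hd : DecP (.full M) fun v : Fin 1 → M => m < pow2 (v 0 + 1) :=
    .lt (.const _) (.pow2 (.add (.proj 0) (.const 1)))
  have hx : m < pow2 (m + 1) := (lt_self_add_one m).trans (lt_pow2 _)
  refine ⟨?_, (leastBelow_of_lt (p := fun l => m < pow2 (l + 1)) hd (lt_self_add_one m) hx).2⟩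
  rcases eq_zero_or_eq_add_one (lg m) with h | ⟨z, h⟩
  · rw [h, pow2_zero]; simpa using add_one_le_iff.2 hm
  · rw [h]
    exact not_lt.1 ((leastBelow_spec (p := fun l => m < pow2 (l + 1)) hd (m + 1)).2 z (by rw [← lg, h]; exact lt_self_add_one z))

theorem lg_eq {m l : M} (h1 : pow2 l ≤ m) (h2 : m < pow2 (l + 1)) : lg m = l := by
  obtain ⟨h3, h4⟩ := lg_spec ((pow2_pos l).trans_le h1)
  have h5 := pow2_strictMono.lt_iff_lt.1 (h1.trans_lt h4)
  have h6 := pow2_strictMono.lt_iff_lt.1 (h3.trans_lt h2)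
  exact le_antisymm (lt_add_one_iff.1 h6) (lt_add_one_iff.1 h5)

end Numbers

/-! ### Rational codes read in the ordered field `RatOf` -/

section Rationals

variable {M : Type u} [PRAModel M]

open PRAModel RatOf

theorem exists_of_le_lt_add_one {t : RatOf M} (ht : 0 ≤ t) : ∃ a : M, of a ≤ t ∧ t < of a + 1 := by
  obtain ⟨a, d, rfl⟩ := nonneg_iff'.1 ht
  have hd := of_add_one_pos d
  obtain ⟨h1, h2⟩ := quo_spec a (zero_lt_add_one d)
  refine ⟨quo a (d + 1), ?_, ?_⟩
  · rw [le_div_iff₀ hd]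
    simpa using of_le.2 h1
  · rw [div_lt_iff₀ hd]
    simpa using of_lt.2 h2

open Classical in
/-- The integer part of a nonnegative rational. -/
noncomputable def fl (t : RatOf M) : M := if ht : 0 ≤ t then (exists_of_le_lt_add_one ht).choose else 0

theorem fl_le {t : RatOf M} (ht : 0 ≤ t) : of (fl t) ≤ t := by
  rw [fl, dif_pos ht]; exact (exists_of_le_lt_add_one ht).choose_spec.1

theorem lt_fl_add_one (t : RatOf M) : t < of (fl t) + 1 := by
  by_cases ht : 0 ≤ t
  · rw [fl, dif_pos ht]; exact (exists_of_le_lt_add_one ht).choose_spec.2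
  · rw [fl, dif_neg ht, map_zero]; linarith

theorem of_lt_of_add_one {a b : M} : of a < of b + 1 ↔ a ≤ b := by
  rw [← map_one of, ← map_add, of_lt, lt_add_one_iff]

theorem fl_eq {t : RatOf M} {a : M} (h1 : of a ≤ t) (h2 : t < of a + 1) : fl t = a := by
  have h3 := fl_le ((of_nonneg a).trans h1)
  have h4 := lt_fl_add_one t
  exact le_antisymm (of_lt_of_add_one.1 (h3.trans_lt h2)) (of_lt_of_add_one.1 (h1.trans_lt h4))

theorem fl_div (a : M) {b : M} (hb : 0 < b) : fl (of a / of b) = quo a b := by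
  obtain ⟨h1, h2⟩ := quo_spec a hb
  refine fl_eq ?_ ?_
  · rw [le_div_iff₀ (of_pos.2 hb)]
    simpa using of_le.2 h1
  · rw [div_lt_iff₀ (of_pos.2 hb)]
    simpa using of_lt.2 h2

/-- The rational `2 ^ (-k)`. -/
noncomputable def pw (k : M) : RatOf M := (of (pow2 k))⁻¹

theorem of_pow2_pos (k : M) : 0 < of (pow2 k) := of_pos.2 (pow2_pos k)

theorem pw_pos (k : M) : 0 < pw k := inv_pos.2 (of_pow2_pos k)

@[simp] theorem pw_zero : pw (0 : M) = 1 := by simp [pw]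

theorem pw_add (a b : M) : pw (a + b) = pw a * pw b := by
  rw [pw, pow2_add, map_mul, mul_inv]; rfl

@[simp] theorem pw_one : pw (1 : M) = 1 / 2 := by
  rw [pw, ← zero_add (1 : M), pow2_add_one]; simp [map_ofNat]

theorem pw_add_one (k : M) : pw (k + 1) = pw k / 2 := by
  rw [pw_add, pw_one]; ring

theorem pw_strictAnti : StrictAnti (pw : M → RatOf M) := fun _ _ h =>
  (inv_lt_inv₀ (of_pow2_pos _) (of_pow2_pos _)).2 (of_lt.2 (pow2_strictMono h))

theorem pw_le_one (k : M) : pw k ≤ 1 := by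
  rw [← pw_zero]; exact pw_strictAnti.antitone (zero_le' _)

/-- The Archimedean property with exponents from the model: a positive ε is at least 1/(d+1) for
some d in M, and 2^(d+1) > d + 1. -/
theorem exists_pw_lt {ε : RatOf M} (hε : 0 < ε) : ∃ k : M, pw k < ε := by
  obtain ⟨a, d, rfl⟩ := nonneg_iff'.1 hε.le
  refine ⟨d + 1, ?_⟩
  have hd := of_add_one_pos d
  have ha : 1 ≤ of a := by
    rcases eq_zero_or_eq_add_one a with rfl | ⟨b, rfl⟩
    · simp at hε
    · simpa using of_nonneg b
  refine lt_of_lt_of_le ?_ (div_le_div_of_nonneg_right ha hd.le)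
  rw [pw, one_div]
  exact (inv_lt_inv₀ (of_pow2_pos _) hd).2 (by simpa using of_lt.2 (lt_pow2 (d + 1)))

namespace RatCode

/-- The rational coded by a triple of numbers. -/
noncomputable def toRat (r : RatCode M) : RatOf M := (of r.pos - of r.neg) / (of r.den + 1)

theorem toRat_ratNeg (r : RatCode M) : (PRA2Structure.ratNeg r).toRat = -r.toRat := by
  simp only [toRat, PRA2Structure.ratNeg]; ring

theorem toRat_ratAdd (r s : RatCode M) : ((str M).ratAdd r s).toRat = r.toRat + s.toRat := by
  have hr := (of_add_one_pos r.den).ne'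
  have hs := (of_add_one_pos s.den).ne'
  have h : of ((str M).mul r.den s.den + ((str M).add r.den s.den)) + 1 =
      (of r.den + 1) * (of s.den + 1) := by
    show of (r.den * s.den + (r.den + s.den)) + 1 = _
    simp only [map_mul, map_add]; ring
  have e1 : ∀ a b c d : M, of ((str M).add ((str M).mul a ((str M).succ b))
      ((str M).mul c ((str M).succ d))) = of a * (of b + 1) + of c * (of d + 1) := fun a b c d => by
    rw [succ_eq, succ_eq]
    show of (a * (b + 1) + c * (d + 1)) = _
    simp
  simp only [toRat, PRA2Structure.ratAdd, e1]
  rw [show of ((str M).add ((str M).mul r.den s.den) ((str M).add r.den s.den)) + 1 = _ from h]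
  field_simp
  ring

theorem toRat_ratSub (r s : RatCode M) : ((str M).ratSub r s).toRat = r.toRat - s.toRat := by
  rw [PRA2Structure.ratSub, toRat_ratAdd, toRat_ratNeg, sub_eq_add_neg]

theorem toRat_twoPowNeg (k : M) : ((str M).twoPowNeg k).toRat = pw k := by
  have h1 : of ((str M).one) = (1 : RatOf M) := map_one of
  have h2 : of ((str M).zero) = (0 : RatOf M) := map_zero of
  simp only [toRat, PRA2Structure.twoPowNeg, pw, pow2, h1, h2, map_add, map_one, sub_zero, one_div]

theorem toRat_ratZero : ((str M).ratZero).toRat = 0 := by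
  simp [toRat, PRA2Structure.ratZero]

theorem toRat_ratOne : ((str M).ratOne).toRat = 1 := by
  have h1 : of ((str M).one) = (1 : RatOf M) := map_one of
  have h2 : of ((str M).zero) = (0 : RatOf M) := map_zero of
  simp only [toRat, PRA2Structure.ratOne, h1, h2]; simp

theorem ratLt_iff (r s : RatCode M) : (str M).ratLt r s ↔ r.toRat < s.toRat := by
  have hr := of_add_one_pos r.den
  have hs := of_add_one_pos s.den
  rw [toRat, toRat, div_lt_div_iff₀ hr hs, PRA2Structure.ratLt, succ_eq, succ_eq]
  show r.pos * (s.den + 1) + s.neg * (r.den + 1) < s.pos * (r.den + 1) + r.neg * (s.den + 1) ↔ _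
  rw [← of_lt]
  simp only [map_add, map_mul, map_one]
  constructor <;> intro h <;> linarith

theorem ratAbsLt_iff (r q : RatCode M) : (str M).ratAbsLt r q ↔ |r.toRat| < q.toRat := by
  rw [PRA2Structure.ratAbsLt, ratLt_iff, ratLt_iff, toRat_ratNeg, abs_lt]
  constructor <;> rintro ⟨h1, h2⟩ <;> constructor <;> linarith

theorem ratInUnit_iff (r : RatCode M) : (str M).RatInUnit r ↔ 0 ≤ r.toRat ∧ r.toRat ≤ 1 := by
  rw [PRA2Structure.RatInUnit, ratLt_iff, ratLt_iff, not_lt, not_lt, toRat_ratZero, toRat_ratOne]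

theorem exists_toRat_eq {t : RatOf M} (ht : 0 ≤ t) : ∃ r : RatCode M, r.toRat = t := by
  obtain ⟨a, d, rfl⟩ := nonneg_iff'.1 ht
  exact ⟨⟨a, 0, d⟩, by simp [toRat]⟩

end RatCode

/-- The three components of a function to codes of rationals belong to the class. -/
structure IsRatFun (Φ : FunClass M) {n : ℕ} (f : (Fin n → M) → RatCode M) : Prop where
  pos : IsFun Φ fun v => (f v).pos
  neg : IsFun Φ fun v => (f v).neg
  den : IsFun Φ fun v => (f v).den

namespace IsRatFun

variable {Φ : FunClass M} {n : ℕ} {f g : (Fin n → M) → RatCode M}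

theorem const (r : RatCode M) : IsRatFun Φ fun _ : Fin n → M => r :=
  ⟨.const _, .const _, .const _⟩

theorem mk' {a b c : (Fin n → M) → M} (ha : IsFun Φ a) (hb : IsFun Φ b) (hc : IsFun Φ c) :
    IsRatFun Φ fun v => ⟨a v, b v, c v⟩ := ⟨ha, hb, hc⟩

theorem ratNeg (hf : IsRatFun Φ f) : IsRatFun Φ fun v => PRA2Structure.ratNeg (f v) :=
  ⟨hf.neg, hf.pos, hf.den⟩

theorem ratAdd (hf : IsRatFun Φ f) (hg : IsRatFun Φ g) :
    IsRatFun Φ fun v => (str M).ratAdd (f v) (g v) :=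
  ⟨(hf.pos.mul hg.den.succ).add (hg.pos.mul hf.den.succ),
   (hf.neg.mul hg.den.succ).add (hg.neg.mul hf.den.succ),
   (hf.den.mul hg.den).add (hf.den.add hg.den)⟩

theorem ratSub (hf : IsRatFun Φ f) (hg : IsRatFun Φ g) :
    IsRatFun Φ fun v => (str M).ratSub (f v) (g v) :=
  hf.ratAdd hg.ratNeg

theorem twoPowNeg {a : (Fin n → M) → M} (ha : IsFun Φ a) :
    IsRatFun Φ fun v => (str M).twoPowNeg (a v) :=
  ⟨.const _, .const _, ha.predTwoPow⟩

theorem comp₁ {x : M → RatCode M} (hx : IsRatFun Φ fun v : Fin 1 → M => x (v 0))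
    {a : (Fin n → M) → M} (ha : IsFun Φ a) : IsRatFun Φ fun v => x (a v) :=
  ⟨IsFun.comp₁ (F := fun i => (x i).pos) hx.pos ha, IsFun.comp₁ (F := fun i => (x i).neg) hx.neg ha,
    IsFun.comp₁ (F := fun i => (x i).den) hx.den ha⟩

theorem dec_lt (hf : IsRatFun Φ f) (hg : IsRatFun Φ g) :
    DecP Φ fun v => (f v).toRat < (g v).toRat := by
  refine (DecP.lt (IsFun.add (hf.pos.mul hg.den.succ) (hg.neg.mul hf.den.succ))
    (IsFun.add (hg.pos.mul hf.den.succ) (hf.neg.mul hg.den.succ))).of_iff fun v => ?_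
  exact (RatCode.ratLt_iff _ _).symm

theorem dec_le (hf : IsRatFun Φ f) (hg : IsRatFun Φ g) :
    DecP Φ fun v => (f v).toRat ≤ (g v).toRat :=
  (hg.dec_lt hf).not.of_iff fun _ => not_lt.symm

end IsRatFun

end Rationals

/-! ### Reals of the model and strict distance inequalities -/

section Reals

variable {M : Type u} [PRAModel M]

open PRAModel RatOf

/-- The class of the functions underlying a real. -/
theorem isReal_iff {x : M → RatCode M} : (str M).IsReal x ↔
    IsRatFun (.full M) (fun v : Fin 1 → M => x (v 0)) ∧
      ∀ i, |(x i).toRat - (x (i + 1)).toRat| < pw (i + 1) := by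
  simp only [PRA2Structure.IsReal, RatCode.ratAbsLt_iff, RatCode.toRat_ratSub,
    RatCode.toRat_twoPowNeg, succ_eq]
  exact and_congr_left fun _ => ⟨fun h => ⟨h.1, h.2.1, h.2.2⟩, fun h => ⟨h.1, h.2, h.3⟩⟩

theorem realInUnit_iff {x : M → RatCode M} : (str M).RealInUnit x ↔
    ∀ k, -pw k ≤ (x k).toRat ∧ (x k).toRat ≤ 1 + pw k := by
  simp only [PRA2Structure.RealInUnit, RatCode.ratLt_iff, RatCode.toRat_ratNeg,
    RatCode.toRat_ratAdd, RatCode.toRat_twoPowNeg, RatCode.toRat_ratOne, not_lt]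

/-- The successive errors 2^(-i-1), 2^(-i-2), … sum to exactly `pw i - pw j`. In this closed form
the bound is a decidable statement about j, open to induction. -/
theorem abs_sub_le_of_isReal {x : M → RatCode M} (hx : (str M).IsReal x) {i j : M} (hij : i ≤ j) :
    |(x i).toRat - (x j).toRat| ≤ pw i - pw j := by
  rw [isReal_iff] at hx
  refine induct_le (Φ := .full M) (p := fun j : M => |(x i).toRat - (x j).toRat| ≤ pw i - pw j)
    ?_ (by simp) (fun j _ ih => ?_) hij
  · have h1 := IsRatFun.ratSub (.const (x i)) hx.1
    have h2 := IsRatFun.ratSub (.const ((str M).twoPowNeg i))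
      (IsRatFun.twoPowNeg (Φ := .full M) (.proj (0 : Fin 1)))
    refine ((h1.dec_le h2).and (h1.ratNeg.dec_le h2)).of_iff fun v => ?_
    simp only [RatCode.toRat_ratNeg, RatCode.toRat_ratSub, RatCode.toRat_twoPowNeg, abs_le']
  · have h1 := (hx.2 j).le
    have h2 := abs_sub_le (x i).toRat (x j).toRat (x (j + 1)).toRat
    have h3 := pw_add_one j
    linarith

theorem abs_sub_lt_of_isReal {x : M → RatCode M} (hx : (str M).IsReal x) {i j : M} (hij : i ≤ j) :
    |(x i).toRat - (x j).toRat| < pw i :=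
  (abs_sub_le_of_isReal hx hij).trans_lt (by linarith [pw_pos j])

theorem distLt_def {x y : M → RatCode M} {q : RatCode M} : (str M).DistLt x y q ↔
    ∃ k, |(x k).toRat - (y k).toRat| < q.toRat - (pw k + pw k) := by
  simp only [PRA2Structure.DistLt, RatCode.ratAbsLt_iff, RatCode.toRat_ratSub,
    RatCode.toRat_ratAdd, RatCode.toRat_twoPowNeg]

theorem distLt_of_eventually {x y : M → RatCode M} {q : RatCode M} {ε : RatOf M} (hε : 0 < ε) {N : M}
    (h : ∀ j, N ≤ j → |(x j).toRat - (y j).toRat| ≤ q.toRat - ε) : (str M).DistLt x y q := by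
  rw [distLt_def]
  obtain ⟨k, hk⟩ := exists_pw_lt (half_pos hε)
  refine ⟨max N k, (h _ (le_max_left _ _)).trans_lt ?_⟩
  have := pw_strictAnti.antitone (le_max_right N k)
  linarith

/-- From index k onwards each real moves by less than 2^(-k), so the slack in one inequality at k
leaves a fixed margin ε at all later indices. With `distLt_of_eventually`, limits can be handled
through rational approximations only. -/
theorem DistLt.eventually {x y : M → RatCode M} {q : RatCode M} (hx : (str M).IsReal x)
    (hy : (str M).IsReal y) (h : (str M).DistLt x y q) :
    ∃ ε > 0, ∃ N, ∀ j, N ≤ j → |(x j).toRat - (y j).toRat| ≤ q.toRat - ε := by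
  obtain ⟨k, hk⟩ := distLt_def.1 h
  refine ⟨q.toRat - (pw k + pw k) - |(x k).toRat - (y k).toRat|, by linarith, k, fun j hj => ?_⟩
  have h1 := abs_sub_le_of_isReal hx hj
  have h2 := abs_sub_le_of_isReal hy hj
  have h3 := pw_pos j
  have h4 : |(x j).toRat - (y j).toRat| ≤ |(x k).toRat - (y k).toRat| +
      |(x k).toRat - (x j).toRat| + |(y k).toRat - (y j).toRat| := by
    have := abs_sub_abs_le_abs_sub (((x k).toRat - (y k).toRat) - ((x k).toRat - (x j).toRat)
      + ((y k).toRat - (y j).toRat)) 0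
    have e : (x j).toRat - (y j).toRat = ((x k).toRat - (y k).toRat) - ((x k).toRat - (x j).toRat)
      + ((y k).toRat - (y j).toRat) := by ring
    rw [e]
    exact (abs_add_le _ _).trans (by gcongr; exact abs_sub _ _)
  linarith

theorem isReal_const (r : RatCode M) : (str M).IsReal fun _ => r :=
  isReal_iff.2 ⟨.const r, fun i => by simpa using pw_pos (i + 1)⟩

end Reals

/-! ### Compactness: `WKL` and `QFAC` imply uniform continuity -/

section Compactness

variable {M : Type u} [PRAModel M]

open PRAModel RatOf

theorem isValue_iff {P : FunCode M} {x y : M → RatCode M} : (str M).IsValue P x y ↔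
    (str M).IsReal y ∧ ∀ r n, 0 ≤ r.toRat ∧ r.toRat ≤ 1 → (str M).InNbhd P x r n →
      (str M).DistLt y (P.val r) ((str M).twoPowNeg n) := by
  simp only [PRA2Structure.IsValue, RatCode.ratInUnit_iff]

theorem snoc_eq (m i : M) : (str M).snoc m i = 2 * m + i := by
  rw [two_mul]; rfl

theorem le_one_iff {i : M} : i ≤ 1 ↔ i = 0 ∨ i = 1 := by
  constructor
  · intro h
    rcases eq_zero_or_eq_add_one i with rfl | ⟨j, rfl⟩
    · exact .inl rfl
    · refine .inr ?_
      have : j ≤ 0 := by simpa using h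
      rw [le_antisymm this (zero_le' _), zero_add]
  · rintro (rfl | rfl)
    · exact zero_le' _
    · exact le_rfl

theorem lg_two_mul_add {m i : M} (hm : 0 < m) (hi : i ≤ 1) : lg (2 * m + i) = lg m + 1 := by
  obtain ⟨h1, h2⟩ := lg_spec hm
  refine lg_eq ?_ ?_
  · rw [pow2_add_one]
    exact (mul_le_mul_right h1 2).trans le_self_add
  · rw [pow2_add_one]
    have h3 : 2 * m + i < 2 * (m + 1) := by
      rw [mul_add, mul_one, ← one_add_one_eq_two, ← add_assoc]
      exact lt_add_one_iff.2 (by gcongr)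
    exact h3.trans_le (mul_le_mul_right (add_one_le_iff.2 h2) 2)

/-- The left end of the dyadic interval of the binary string with code `m`. -/
noncomputable def leftEnd (m : M) : RatOf M := of m * pw (lg m) - 1

/-- The code of the rational `m / 2 ^ l - 1`. -/
def dyadic (m l : M) : RatCode M := ⟨m, pow2 l, (str M).predTwoPow l⟩

theorem toRat_dyadic (m l : M) : (dyadic m l).toRat = of m * pw l - 1 := by
  have := (of_pow2_pos l).ne'
  rw [RatCode.toRat, dyadic, pw, ← map_one of, ← map_add, ← pow2, sub_div, div_self this, map_one]
  rfl

theorem IsRatFun.dyadic {Φ : FunClass M} {n : ℕ} {f g : (Fin n → M) → M} (hf : IsFun Φ f)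
    (hg : IsFun Φ g) : IsRatFun Φ fun v => dyadic (f v) (g v) :=
  ⟨hf, hg.pow2, hg.predTwoPow⟩

/-- The closed dyadic interval of the binary string `m`, enlarged by its length on both sides,
lies in the `n`-th neighbourhood of `r`. -/
def Covers (P : FunCode M) (n m : M) (r : RatCode M) : Prop :=
  (0 ≤ r.toRat ∧ r.toRat ≤ 1) ∧ leftEnd m + 2 * pw (lg m) < r.toRat + pw (P.δ r n) ∧
    r.toRat - pw (P.δ r n) < leftEnd m - pw (lg m)

/-- The string `m` is not covered by a neighbourhood of a rational with code below `m`. -/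
def Uncovered (P : FunCode M) (n m : M) : Prop :=
  0 < m ∧ ∀ p < m + 1, ∀ q < m + 1, ∀ d < m + 1, ¬ Covers P n m ⟨p, q, d⟩

/-- The bound on the codes of the rationals keeps the tree decidable. It loses nothing along a path,
since the codes of the strings grow without bound. -/
theorem dec_uncovered {P : FunCode M} (hP : (str M).HasFunCode P) :
    DecP (.full M) fun v : Fin 2 → M => Uncovered P (v 0) (v 1) := by
  have hδ {n : ℕ} {a b c k : (Fin n → M) → M} (ha : IsFun (.full M) a) (hb : IsFun (.full M) b)
      (hc : IsFun (.full M) c) (hk : IsFun (.full M) k) :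
      IsFun (.full M) fun v => P.δ ⟨a v, b v, c v⟩ (k v) :=
    IsFun.comp₄ (F := fun a b c k => P.δ ⟨a, b, c⟩ k) hP.2.2.2 ha hb hc hk
  refine (DecP.lt (.const 0) (.proj _)).and ?_
  refine DecP.ball (p := fun v p => ∀ q < v 1 + 1, ∀ d < v 1 + 1, ¬ Covers P (v 0) (v 1) ⟨p, q, d⟩)
    ?_ (.add (.proj _) (.const 1))
  refine DecP.ball (p := fun v q => ∀ d < v 2 + 1, ¬ Covers P (v 1) (v 2) ⟨v 0, q, d⟩)
    ?_ (.add (.proj _) (.const 1))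
  refine DecP.ball (p := fun v d => ¬ Covers P (v 2) (v 3) ⟨v 1, v 0, d⟩)
    ?_ (.add (.proj _) (.const 1))
  suffices h : DecP (.full M) fun v : Fin 5 → M => Covers P (v 3) (v 4) ⟨v 2, v 1, v 0⟩ from h.not
  have hr : IsRatFun (.full M) fun v : Fin 5 → M => ⟨v 2, v 1, v 0⟩ :=
    ⟨.proj 2, .proj 1, .proj 0⟩
  have hd := IsRatFun.twoPowNeg (hδ (.proj 2) (.proj 1) (.proj 0) (.proj (3 : Fin 5)))
  have hl := IsRatFun.twoPowNeg (IsFun.lg (Φ := .full M) (.proj (4 : Fin 5)))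
  have he := IsRatFun.dyadic (Φ := .full M) (.proj (4 : Fin 5)) (IsFun.lg (.proj (4 : Fin 5)))
  refine (((IsRatFun.const (str M).ratZero).dec_le hr).and
    (hr.dec_le (IsRatFun.const (str M).ratOne))).and
    (((he.ratAdd (hl.ratAdd hl)).dec_lt (hr.ratAdd hd)).and
    ((hr.ratSub hd).dec_lt (he.ratSub hl))) |>.of_iff fun v => ?_
  simp only [Covers, RatCode.toRat_ratAdd, RatCode.toRat_ratSub, RatCode.toRat_twoPowNeg,
    RatCode.toRat_ratZero, RatCode.toRat_ratOne, toRat_dyadic, leftEnd, two_mul]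

/-- Halving an interval also halves its margins, so the enlarged half lies inside the enlarged
whole. -/
theorem Covers.snoc {P : FunCode M} {n m : M} {r : RatCode M} (hm : 0 < m) (h : Covers P n m r)
    {i : M} (hi : i ≤ 1) : Covers P n (2 * m + i) r := by
  refine ⟨h.1, ?_⟩
  obtain ⟨h1, h2⟩ := h.2
  have h3 := pw_pos (lg m)
  simp only [leftEnd, lg_two_mul_add hm hi, pw_add_one, map_add, map_mul, map_ofNat] at h1 h2 ⊢
  rcases le_one_iff.1 hi with rfl | rfl
  · simp only [map_zero]
    constructor <;> linarith
  · simp only [map_one]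
    constructor <;> linarith

theorem Uncovered.of_snoc {P : FunCode M} {n m i : M} (hm : 0 < m) (hi : i ≤ 1)
    (h : Uncovered P n (2 * m + i)) : Uncovered P n m := by
  have hle : m + 1 ≤ 2 * m + i + 1 := by
    rw [two_mul, add_assoc m m i]
    gcongr
    exact le_self_add
  exact ⟨hm, fun p hp q hq d hd hc =>
    h.2 p (hp.trans_le hle) q (hq.trans_le hle) d (hd.trans_le hle) (hc.snoc hm hi)⟩

theorem lg_path {c : M → M} (hc : IsFun (.full M) fun v : Fin 1 → M => c (v 0)) (h0 : c 0 = 1)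
    (hs : ∀ n, ∃ i ≤ 1, c (n + 1) = 2 * c n + i) (n : M) : 0 < c n ∧ lg (c n) = n := by
  refine induct_dec (p := fun n => 0 < c n ∧ lg (c n) = n)
    (.and (.lt (.const _) hc) (.eq hc.lg (.proj 0))) ?_ (fun n ih => ?_) n
  · rw [h0]
    exact ⟨zero_lt_one, lg_eq (by simp) (by simp)⟩
  · obtain ⟨i, hi, h⟩ := hs n
    rw [h, lg_two_mul_add ih.1 hi, ih.2]
    exact ⟨(mul_pos zero_lt_two ih.1).trans_le le_self_add, rfl⟩

theorem leftEnd_nonneg {m : M} (hm : 0 < m) : 0 ≤ leftEnd m := by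
  have h1 := of_le.2 (lg_spec hm).1
  have h2 := pw_pos (lg m)
  have h3 : of (pow2 (lg m)) * pw (lg m) = 1 := mul_inv_cancel₀ (of_pow2_pos _).ne'
  rw [leftEnd]
  nlinarith

theorem leftEnd_add_pw_le_one {m : M} (hm : 0 < m) : leftEnd m + pw (lg m) ≤ 1 := by
  have h1 := of_le.2 (add_one_le_iff.2 (lg_spec hm).2)
  have h2 := pw_pos (lg m)
  have h3 : of (pow2 (lg m)) * pw (lg m) = 1 := mul_inv_cancel₀ (of_pow2_pos _).ne'
  rw [pow2_add_one] at h1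
  simp only [map_add, map_mul, map_ofNat, map_one] at h1
  rw [leftEnd]
  nlinarith

theorem not_uncovered_path {P : FunCode M} (hP : (str M).IsContinuousFun P) (n : M) {c : M → M}
    (hc : IsFun (.full M) fun v : Fin 1 → M => c (v 0)) (h0 : c 0 = 1)
    (hs : ∀ n, ∃ i ≤ 1, c (n + 1) = 2 * c n + i) : ∃ j, ¬ Uncovered P n (c j) := by
  have hlg := lg_path hc h0 hs
  -- Consecutive left ends of levels i and i + 1 may differ by exactly 2^(-i-1). The shift by one
  -- level makes the inequality required of a real strict.
  set x : M → RatCode M := fun i => dyadic (c (i + 1)) (i + 1) with hx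
  have hxv : ∀ i, (x i).toRat = leftEnd (c (i + 1)) := fun i => by
    rw [hx, leftEnd, toRat_dyadic, (hlg _).2]
  have hreal : (str M).IsReal x := by
    refine isReal_iff.2 ⟨.dyadic (IsFun.comp₁ hc (.add (.proj 0) (.const 1)))
      (.add (.proj 0) (.const 1)), fun i => ?_⟩
    obtain ⟨k, hk, h⟩ := hs (i + 1)
    have h1 := pw_pos (i + 1)
    rw [hxv, hxv, leftEnd, leftEnd, h, lg_two_mul_add (hlg _).1 hk, (hlg _).2, pw_add_one (i + 1)]
    simp only [map_add, map_mul, map_ofNat]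
    rw [abs_lt]
    rcases le_one_iff.1 hk with rfl | rfl
    · simp only [map_zero]
      constructor <;> linarith
    · simp only [map_one]
      constructor <;> linarith
  have hunit : (str M).RealInUnit x := realInUnit_iff.2 fun k => by
    have h1 := leftEnd_nonneg (hlg (k + 1)).1
    have h2 := leftEnd_add_pw_le_one (hlg (k + 1)).1
    have h3 := pw_pos k
    have h4 := pw_pos (lg (c (k + 1)))
    rw [hxv]
    constructor <;> linarith
  obtain ⟨r, hr, hn⟩ := (hP.2.2 x hreal hunit).1 n
  obtain ⟨ε, hε, N, hN⟩ := DistLt.eventually hreal (isReal_const r) hn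
  obtain ⟨k, hk⟩ := exists_pw_lt hε
  -- Beyond N the margin ε holds, beyond k the intervals are shorter than ε, and the remaining
  -- entries bring the code of r below that of the string.
  set j := max (max N k) (max r.pos (max r.neg r.den)) with hj
  have hjN : N ≤ j := (le_max_left _ _).trans (le_max_left _ _)
  have hjk : k ≤ j := (le_max_right _ _).trans (le_max_left _ _)
  have hjr : r.pos ≤ j ∧ r.neg ≤ j ∧ r.den ≤ j := by simp [hj]
  have hjc : j < c (j + 1) + 1 := by
    have h1 := (lg_spec (hlg (j + 1)).1).1
    rw [(hlg _).2] at h1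
    exact ((lt_self_add_one j).trans (lt_pow2 _)).trans_le (h1.trans (lt_self_add_one _).le)
  refine ⟨j + 1, fun hu => hu.2 r.pos (hjr.1.trans_lt hjc) r.neg (hjr.2.1.trans_lt hjc) r.den
    (hjr.2.2.trans_lt hjc) ⟨(RatCode.ratInUnit_iff r).1 hr, ?_⟩⟩
  have h1 := hN j hjN
  rw [RatCode.toRat_twoPowNeg, hxv, abs_le] at h1
  have h2 := pw_strictAnti.antitone hjk
  have h3 := pw_pos j
  rw [(hlg _).2, pw_add_one]
  constructor
  · linarith [h1.2]
  · linarith [h1.1]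

/-- The tree of uncovered strings has no path, so it is bounded. Speaking only of the strings of
length b keeps the conclusion a bounded quantification, to which `QFAC` can be applied. -/
theorem exists_bound_of_wkl (hW : (str M).WKL) {P : FunCode M} (hP : (str M).IsContinuousFun P)
    (n : M) : ∃ b, ∀ m < pow2 (b + 1), pow2 b ≤ m → ¬ Uncovered P n m := by
  classical
  set T : M → M := fun m => if Uncovered P n m then 1 else 0 with hT
  have hT1 : ∀ m, T m = 1 ↔ Uncovered P n m := fun m => by simp [hT]
  have hTf : IsFun (.full M) fun v : Fin 1 → M => T (v 0) := by
    exact ((dec_uncovered hP.1).comp₂ (.const n) (.proj (0 : Fin 1))).ite (.const 1) (.const 0)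
  have htree : (str M).IsBinaryTree T := by
    refine ⟨hTf, fun m => ?_, fun m i hm hi h => ?_⟩
    · by_cases h : Uncovered P n m
      · exact .inr (if_pos h)
      · exact .inl (if_neg h)
    · rw [snoc_eq] at h
      exact (hT1 _).2 (((hT1 _).1 h).of_snoc hm (le_one_iff.2 hi))
  have hinf : ¬ (str M).IsInfiniteTree T := by
    intro h
    obtain ⟨Q, -, hQ, c, hc, hc0, hcs, hcT⟩ := hW T htree h
    obtain ⟨j, hj⟩ := not_uncovered_path hP n hc hc0 fun n =>
      ⟨Q n, le_one_iff.2 (hQ n), by rw [← succ_eq, hcs, snoc_eq]⟩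
    exact hj ((hT1 _).1 (hcT j))
  rw [PRA2Structure.IsInfiniteTree] at hinf
  push Not at hinf
  obtain ⟨b, hb⟩ := hinf
  exact ⟨b, fun m _ hm hu => hb m ((lt_pow2 b).trans_le hm) ((hT1 _).2 hu)⟩

theorem qfac_dec (hQ : (str M).QFAC) {θ : M → M → Prop}
    (hθ : DecP (.full M) fun v : Fin 2 → M => θ (v 0) (v 1)) (h : ∀ x, ∃ y, θ x y) :
    ∃ F : M → M, IsFun (.full M) (fun v : Fin 1 → M => F (v 0)) ∧ ∀ x, θ x (F x) := by
  obtain ⟨φ, hφ⟩ := hθ.qfDef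
  obtain ⟨F, hF, H⟩ := hQ φ fun x => (h x).imp fun y hy => (hφ _).2 hy
  exact ⟨F, hF, fun x => (hφ _).1 (H x)⟩

theorem uniformContinuity_of_wkl_qfac (hW : (str M).WKL) (hQ : (str M).QFAC) :
    (str M).UniformContinuityOnUnitInterval := by
  intro P hP
  have hdec : DecP (.full M) fun v : Fin 2 → M =>
      ∀ m < pow2 (v 1 + 1), pow2 (v 1) ≤ m → ¬ Uncovered P (v 0) m :=
    DecP.ball (p := fun v m => pow2 (v 1) ≤ m → ¬ Uncovered P (v 0) m)
      ((DecP.le (IsFun.pow2 (.proj _)) (.proj 0)).imp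
        ((dec_uncovered hP.1).comp₂ (.proj _) (.proj 0)).not)
      (.pow2 (.add (.proj 1) (.const 1)))
  obtain ⟨B, hB, H⟩ := qfac_dec hQ (θ := fun n b => ∀ m < pow2 (b + 1), pow2 b ≤ m →
    ¬ Uncovered P n m) hdec (exists_bound_of_wkl hW hP)
  -- Precision n + 1 lets two errors against the same rational add up to 2^(-n). With b = B (n + 1),
  -- the summand 2 keeps the approximation error of x and the distance to x' within 2^(-b)/4 each,
  -- hence inside the enlarged interval.
  refine ⟨fun n => B (n + 1) + 2, ?_, ?_⟩
  · exact IsFun.add (IsFun.comp₁ hB (.add (.proj 0) (.const 1))) (.const 2)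
  intro n x x' y y' hx hxu hx' hxu' hy hy' hxx'
  set b := B (n + 1) with hb
  have hpb : pw (b + 2) = pw b / 4 := by
    rw [← one_add_one_eq_two, ← add_assoc, pw_add_one, pw_add_one]; ring
  have hb0 := pw_pos b
  have hb1 : of (pow2 b) * pw b = 1 := mul_inv_cancel₀ (of_pow2_pos _).ne'
  -- the dyadic interval of length `2 ^ (-b)` near `x`
  obtain ⟨a, ha, hA1, hA2⟩ : ∃ a : M, a < pow2 b ∧ of a * pw b - pw b / 4 ≤ (x (b + 2)).toRat ∧
      (x (b + 2)).toRat ≤ (of a + 1) * pw b + pw b / 4 := by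
    obtain ⟨h1, h2⟩ := realInUnit_iff.1 hxu (b + 2)
    rw [hpb] at h1 h2
    set X := (x (b + 2)).toRat
    -- An approximation of a real in [0,1] may leave [0,1] by its error; the first or the last
    -- dyadic interval then serves.
    rcases lt_or_ge X 0 with h0 | h0
    · exact ⟨0, pow2_pos b, by rw [map_zero]; linarith, by rw [map_zero]; linarith⟩
    rcases lt_or_ge X 1 with h3 | h3
    · have h4 : 0 ≤ X * of (pow2 b) := mul_nonneg h0 (of_pow2_pos b).le
      have h5 := fl_le h4
      have h6 := lt_fl_add_one (X * of (pow2 b))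
      have h7 : X = X * of (pow2 b) * pw b := by rw [mul_assoc, hb1, mul_one]
      refine ⟨fl (X * of (pow2 b)), ?_, ?_, ?_⟩
      · rw [← of_lt]
        exact h5.trans_lt (mul_lt_of_lt_one_left (of_pow2_pos b) h3)
      · have := mul_le_mul_of_nonneg_right h5 hb0.le
        linarith
      · have := mul_le_mul_of_nonneg_right h6.le hb0.le
        linarith
    · obtain ⟨c, hc⟩ : ∃ c, pow2 b = c + 1 := ⟨_, rfl⟩
      have h4 : (of c + 1) * pw b = 1 := by
        have := hb1
        rwa [hc, map_add, map_one] at this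
      exact ⟨c, hc ▸ lt_self_add_one c, by linarith, by linarith⟩
  have hlg : lg (pow2 b + a) = b := lg_eq le_self_add (by
    rw [pow2_add_one, two_mul]; gcongr)
  have hle : leftEnd (pow2 b + a) = of a * pw b := by
    rw [leftEnd, hlg, map_add, add_mul, hb1]; ring
  have hcov : ¬ Uncovered P (n + 1) (pow2 b + a) :=
    H (n + 1) _ (by rw [pow2_add_one, two_mul]; gcongr) le_self_add
  obtain ⟨r, hr⟩ : ∃ r, Covers P (n + 1) (pow2 b + a) r := by
    by_contra! h
    exact hcov ⟨(pow2_pos b).trans_le le_self_add, fun p _ q _ d _ => h _⟩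
  obtain ⟨hr0, hr1, hr2⟩ := hr
  rw [hle, hlg] at hr1 hr2
  have near : ∀ j, b + 2 ≤ j → |(x j).toRat - r.toRat| ≤ pw (P.δ r (n + 1)) - pw b / 2 :=
    fun j hj => by
      have h1 := (abs_le.1 (abs_sub_lt_of_isReal hx hj).le)
      rw [hpb] at h1
      rw [abs_le]
      constructor <;> linarith [h1.1, h1.2]
  have hn : (str M).InNbhd P x r (n + 1) :=
    distLt_of_eventually (half_pos hb0) (N := b + 2) fun j hj => by
      rw [RatCode.toRat_twoPowNeg]; exact near j hj
  have hn' : (str M).InNbhd P x' r (n + 1) := by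
    obtain ⟨ε, hε, N, hN⟩ := DistLt.eventually hx hx' hxx'
    refine distLt_of_eventually (ε := pw b / 4) (by positivity) (N := max N (b + 2)) fun j hj => ?_
    have h1 := hN j ((le_max_left _ _).trans hj)
    have h2 := near j ((le_max_right _ _).trans hj)
    rw [RatCode.toRat_twoPowNeg, hpb] at h1
    rw [RatCode.toRat_twoPowNeg]
    have h3 := abs_sub_le (x' j).toRat (x j).toRat r.toRat
    rw [abs_sub_comm (x' j).toRat (x j).toRat] at h3
    linarith
  have hval := hP.2.1 r ((RatCode.ratInUnit_iff r).2 hr0)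
  obtain ⟨ε, hε, N, hN⟩ := DistLt.eventually hy.1 hval ((isValue_iff.1 hy).2 r _ hr0 hn)
  obtain ⟨ε', hε', N', hN'⟩ := DistLt.eventually hy'.1 hval ((isValue_iff.1 hy').2 r _ hr0 hn')
  refine distLt_of_eventually hε (N := max N N') fun j hj => ?_
  have h1 := hN j ((le_max_left _ _).trans hj)
  have h2 := hN' j ((le_max_right _ _).trans hj)
  rw [RatCode.toRat_twoPowNeg, pw_add_one] at h1 h2
  rw [RatCode.toRat_twoPowNeg]
  have h3 := abs_sub_le (y j).toRat (P.val r j).toRat (y' j).toRat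
  rw [abs_sub_comm (P.val r j).toRat] at h3
  linarith

end Compactness

/-! ### A subdivision in base 8 whose intervals avoid the rationals -/

section Nodes

variable {M : Type u} [PRAModel M]

open PRAModel RatOf

/-- The power `8 ^ n`. -/
def oct (n : M) : M := pow2 (3 * n)

theorem IsFun.oct {Φ : FunClass M} {n : ℕ} {f : (Fin n → M) → M} (hf : IsFun Φ f) :
    IsFun Φ fun v => oct (f v) :=
  ((IsFun.const 3).mul hf).pow2

theorem oct_pos (n : M) : 0 < oct n := pow2_pos _

theorem of_oct_pos (n : M) : 0 < of (oct n) := of_pos.2 (oct_pos n)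

theorem oct_add (a b : M) : oct (a + b) = oct a * oct b := by
  rw [oct, mul_add, pow2_add]; rfl

@[simp] theorem oct_zero : oct (0 : M) = 1 := by rw [oct, mul_zero, pow2_zero]

theorem oct_add_one (n : M) : oct (n + 1) = 8 * oct n := by
  rw [oct_add, oct, oct, mul_one, ← two_add_one_eq_three, pow2_add_one, ← one_add_one_eq_two,
    pow2_add_one, pow2_one]
  ring

theorem oct_mono : Monotone (oct : M → M) := fun _ _ h =>
  pow2_strictMono.monotone (mul_le_mul_right h 3)

theorem lt_oct (n : M) : n < oct n :=
  (lt_pow2 n).trans_le (pow2_strictMono.monotone (le_mul_of_one_le_left (zero_le' n)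
    (by rw [← two_add_one_eq_three]; exact le_add_self)))

theorem of_oct_mul_pw (n : M) : of (oct n) * pw (3 * n) = 1 :=
  mul_inv_cancel₀ (of_oct_pos n).ne'

/-- The closed interval `[a / 8 ^ i, (a + 1) / 8 ^ i]` contains a multiple of `1 / i`. -/
def Excluded (i a : M) : Prop :=
  ∃ z < (a + 1) * i + 1, a * i ≤ z * oct i ∧ z * oct i ≤ (a + 1) * i

theorem IsFun.dec_excluded {Φ : FunClass M} {n : ℕ} {f g : (Fin n → M) → M} (hf : IsFun Φ f)
    (hg : IsFun Φ g) : DecP Φ fun v => Excluded (f v) (g v) := by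
  refine DecP.comp₂ ?_ hf hg
  refine DecP.bex (p := fun v (z : M) => v 1 * v 0 ≤ z * _root_.oct (v 0) ∧
    z * _root_.oct (v 0) ≤ (v 1 + 1) * v 0) ?_
    (.add (.mul (.add (.proj 1) (.const 1)) (.proj 0)) (.const 1))
  exact (DecP.le (.mul (.proj _) (.proj _)) (.mul (.proj 0) (.oct (.proj _)))).and
    (DecP.le (.mul (.proj 0) (.oct (.proj _))) (.mul (.add (.proj _) (.const 1)) (.proj _)))

open Classical in
/-- The bit of the string contributed by the octal digit `a % 8`. -/
noncomputable def octBit (a : M) : M := if 4 ≤ a - 8 * quo a 8 then 1 else 0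

theorem octBit_le_one (a : M) : octBit a ≤ 1 := by
  rw [octBit]; split_ifs
  · exact le_rfl
  · exact zero_le' 1

theorem IsFun.octBit {Φ : FunClass M} {n : ℕ} {f : (Fin n → M) → M} (hf : IsFun Φ f) :
    IsFun Φ fun v => octBit (f v) :=
  (DecP.le (.const 4) (hf.tsub (.mul (.const 8) (hf.quo (.const 8))))).ite (.const 1) (.const 0)

open Classical in
/-- The code of the string of the `a`-th interval of level `i`, where `m` is the code for
its parent; `0` means that the interval is discarded. -/
noncomputable def childCode (m i a : M) : M :=
  if m ≠ 0 ∧ 2 * quo a 2 = a ∧ ¬ Excluded i a then 2 * m + octBit a else 0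

theorem IsFun.childCode {Φ : FunClass M} {n : ℕ} {f g h : (Fin n → M) → M} (hf : IsFun Φ f)
    (hg : IsFun Φ g) (hh : IsFun Φ h) : IsFun Φ fun v => childCode (f v) (g v) (h v) :=
  ((DecP.eq hf (.const 0)).not.and ((DecP.eq (.mul (.const 2) (hh.quo (.const 2))) hh).and
    (hg.dec_excluded hh).not)).ite (.add (.mul (.const 2) hf) hh.octBit) (.const 0)

open Classical in
theorem exists_nodeFun (Φ : FunClass M) : ∃ h : M → M → M → M,
    IsFun Φ (fun v : Fin 3 → M => h (v 0) (v 1) (v 2)) ∧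
    (∀ x y, h 0 x y = if x < y then 1 else 0) ∧
    ∀ i x y, h (i + 1) x y = childCode (h i x y) (i + 1) (quo (oct (i + 1) * x) y) := by
  obtain ⟨h, h1, h2, h3⟩ := IsFun.exists_rec₃ (Φ := Φ) (F := fun x y : M => if x < y then 1 else 0)
    (G := fun i m x y => childCode m (i + 1) (quo (oct (i + 1) * x) y))
    ((DecP.lt (M := M) (.proj 0) (.proj 1)).ite (.const 1) (.const 0))
    (.childCode (.proj 1) (.add (.proj 0) (.const 1))
      (.quo (.mul (.oct (.add (.proj 0) (.const 1))) (.proj 2)) (.proj 3)))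
  exact ⟨h, h1, h2, h3⟩

/-- The code of the string of the interval of level `i` containing the rational `x / y`. -/
noncomputable def nodeFun : M → M → M → M := (exists_nodeFun (.full M)).choose

open Classical in
theorem nodeFun_zero (x y : M) : nodeFun 0 x y = if x < y then 1 else 0 :=
  (exists_nodeFun (.full M)).choose_spec.2.1 x y

theorem nodeFun_add_one (i x y : M) :
    nodeFun (i + 1) x y = childCode (nodeFun i x y) (i + 1) (quo (oct (i + 1) * x) y) :=
  (exists_nodeFun (.full M)).choose_spec.2.2 i x y

/-- `nodeFun` was chosen among all functions of the model. The class Φ contains a function with the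
same recursion equations, and induction on the level shows that the two agree. -/
theorem IsFun.nodeFun {Φ : FunClass M} {n : ℕ} {f g h : (Fin n → M) → M} (hf : IsFun Φ f)
    (hg : IsFun Φ g) (hh : IsFun Φ h) : IsFun Φ fun v => nodeFun (f v) (g v) (h v) := by
  refine IsFun.comp₃ ?_ hf hg hh
  obtain ⟨F, h1, h2, h3⟩ := exists_nodeFun Φ
  have h4 : IsFun (.full M) fun v : Fin 3 → M => _root_.nodeFun (v 0) (v 1) (v 2) :=
    (exists_nodeFun (.full M)).choose_spec.1
  have : (_root_.nodeFun : M → M → M → M) = F := by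
    funext i x y
    refine induct_dec (p := fun i => _root_.nodeFun i x y = F i x y)
      (.eq (IsFun.comp₃ h4 (.proj 0) (.const x) (.const y))
        (IsFun.comp₃ h1.toFull (.proj 0) (.const x) (.const y))) ?_ (fun i ih => ?_) i
    · rw [nodeFun_zero, h2]
    · rw [nodeFun_add_one, h3, ih]
  rw [this]
  exact h1

/-- The index of the interval of level `i` containing `t`. -/
noncomputable def grid (t : RatOf M) (i : M) : M := fl (of (oct i) * t)

theorem grid_le {t : RatOf M} (ht : 0 ≤ t) (i : M) : of (grid t i) ≤ of (oct i) * t :=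
  fl_le (mul_nonneg (of_oct_pos i).le ht)

theorem lt_grid_add_one (t : RatOf M) (i : M) : of (oct i) * t < of (grid t i) + 1 :=
  lt_fl_add_one _

theorem grid_div (a : M) {b : M} (hb : 0 < b) (i : M) : grid (of a / of b) i = quo (oct i * a) b := by
  rw [grid, ← mul_div_assoc, ← map_mul, fl_div _ hb]

theorem exists_eq_div {t : RatOf M} (ht : 0 ≤ t) : ∃ a b : M, 0 < b ∧ t = of a / of b := by
  obtain ⟨a, d, rfl⟩ := nonneg_iff'.1 ht
  exact ⟨a, d + 1, zero_lt_add_one d, by simp⟩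

theorem isFun_grid {Φ : FunClass M} {t : RatOf M} (ht : 0 ≤ t) :
    IsFun Φ fun v : Fin 1 → M => grid t (v 0) := by
  obtain ⟨a, b, hb, rfl⟩ := exists_eq_div ht
  simp only [grid_div a hb]
  exact .quo (.mul (.oct (.proj 0)) (.const a)) (.const b)

theorem grid_eq_quo {t : RatOf M} (ht : 0 ≤ t) (i : M) : grid t i = quo (grid t (i + 1)) 8 := by
  have h1 := grid_le ht (i + 1)
  have h2 := lt_grid_add_one t (i + 1)
  rw [oct_add_one, map_mul, map_ofNat] at h1 h2
  obtain ⟨h3, h4⟩ := quo_spec (grid t (i + 1)) (y := 8) (by positivity)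
  have h5 := of_le.2 h3
  have h6 := of_le.2 (add_one_le_iff.2 h4)
  simp only [map_add, map_mul, map_ofNat, map_one] at h5 h6
  refine fl_eq ?_ ?_ <;> linarith

theorem grid_congr {s t : RatOf M} (hs : 0 ≤ s) (ht : 0 ≤ t) {i j : M} (hij : i ≤ j)
    (h : grid s j = grid t j) : grid s i = grid t i := by
  revert h
  refine induct_le (Φ := .full M) (p := fun j => grid s j = grid t j → grid s i = grid t i)
    ((DecP.eq (isFun_grid hs) (isFun_grid ht)).imp (.const _)) id (fun j _ ih h => ih ?_) hij
  rw [grid_eq_quo hs, grid_eq_quo ht, h]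

theorem grid_of_div_oct (a n : M) : grid (of a / of (oct n)) n = a := by
  rw [grid, mul_div_cancel₀ _ (of_oct_pos n).ne']
  exact fl_eq le_rfl (by simp)

open Classical in
/-- The code of the string of the interval of level `i` containing `t`; `0` if it is discarded. -/
noncomputable def node (t : RatOf M) (i : M) : M :=
  if ht : 0 ≤ t then nodeFun i (exists_eq_div ht).choose (exists_eq_div ht).choose_spec.choose else 0

open Classical in
theorem node_zero {t : RatOf M} (ht : 0 ≤ t) : node t 0 = if grid t 0 = 0 then 1 else 0 := by
  obtain ⟨h1, h2⟩ := (exists_eq_div ht).choose_spec.choose_spec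
  rw [node, dif_pos ht, nodeFun_zero]
  set a := (exists_eq_div ht).choose
  set b := (exists_eq_div ht).choose_spec.choose
  refine if_congr ?_ rfl rfl
  have h3 : a < b ↔ t < 1 := by
    rw [h2, div_lt_one (of_pos.2 h1), of_lt]
  rw [h3]
  have h4 := grid_le ht 0
  have h5 := lt_grid_add_one t 0
  rw [oct_zero, map_one, one_mul] at h4 h5
  constructor
  · intro h
    refine fl_eq ?_ ?_
    · simpa using ht
    · simpa using h
  · intro h
    rw [h] at h5
    simpa using h5

theorem node_add_one {t : RatOf M} (ht : 0 ≤ t) (i : M) :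
    node t (i + 1) = childCode (node t i) (i + 1) (grid t (i + 1)) := by
  obtain ⟨h1, h2⟩ := (exists_eq_div ht).choose_spec.choose_spec
  rw [node, dif_pos ht, nodeFun_add_one, node, dif_pos ht, ← grid_div _ h1, ← h2]

theorem node_of_neg {t : RatOf M} (ht : t < 0) (i : M) : node t i = 0 := dif_neg ht.not_ge

theorem isFun_node {Φ : FunClass M} (t : RatOf M) : IsFun Φ fun v : Fin 1 → M => node t (v 0) := by
  by_cases ht : 0 ≤ t
  · simp only [node, dif_pos ht]
    exact .nodeFun (.proj 0) (.const _) (.const _)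
  · simp only [node, dif_neg ht]
    exact .const 0

/-- The index of an interval determines the indices of all its ancestors by division by 8, and these
determine the string. -/
theorem node_congr {s t : RatOf M} (hs : 0 ≤ s) (ht : 0 ≤ t) {i : M}
    (h : grid s i = grid t i) : node s i = node t i := by
  revert h
  refine induct_dec (Φ := .full M) (p := fun i => grid s i = grid t i → node s i = node t i)
    ((DecP.eq (isFun_grid hs) (isFun_grid ht)).imp (DecP.eq (isFun_node s) (isFun_node t)))
    (fun h => ?_) (fun i ih h => ?_) i
  · rw [node_zero hs, node_zero ht, h]
  · rw [node_add_one hs, node_add_one ht, h,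
      ih (grid_congr hs ht (lt_self_add_one i).le h)]

theorem node_div (a : M) {b : M} (hb : 0 < b) (i : M) : node (of a / of b) i = nodeFun i a b := by
  have ht : 0 ≤ of a / of b := div_nonneg (of_nonneg a) (of_nonneg b)
  refine induct_dec (Φ := .full M) (p := fun i => node (of a / of b) i = nodeFun i a b)
    (DecP.eq (isFun_node _) (.nodeFun (.proj 0) (.const a) (.const b))) ?_ (fun i ih => ?_) i
  · rw [node_zero ht, nodeFun_zero, grid_div _ hb, oct_zero, one_mul]
    refine if_congr ?_ rfl rfl
    obtain ⟨h1, h2⟩ := quo_spec a hb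
    constructor
    · intro h; rw [h] at h2; simpa using h2
    · intro h
      by_contra h3
      have h4 : 1 ≤ quo a b := by simpa using add_one_le_iff.2 (pos_iff_ne_zero.2 h3)
      exact absurd (h1.trans_lt h) (not_lt.2 (le_mul_of_one_le_left (zero_le' b) h4))
  · rw [node_add_one ht, nodeFun_add_one, ih, grid_div _ hb]

theorem nonneg_of_node_ne_zero {t : RatOf M} {i : M} (h : node t i ≠ 0) : 0 ≤ t := by
  by_contra! ht
  exact h (node_of_neg ht i)

theorem node_add_one_ne_zero {t : RatOf M} {i : M} (h : node t (i + 1) ≠ 0) :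
    node t i ≠ 0 ∧ 2 * quo (grid t (i + 1)) 2 = grid t (i + 1) ∧
      ¬ Excluded (i + 1) (grid t (i + 1)) ∧
      node t (i + 1) = 2 * node t i + octBit (grid t (i + 1)) := by
  have ht := nonneg_of_node_ne_zero h
  rw [node_add_one ht, childCode] at h ⊢
  split_ifs at h ⊢ with h1
  · exact ⟨h1.1, h1.2.1, h1.2.2, rfl⟩
  · exact (h rfl).elim

theorem node_zero_ne_zero {t : RatOf M} (h : node t 0 ≠ 0) : grid t 0 = 0 ∧ node t 0 = 1 := by
  have ht := nonneg_of_node_ne_zero h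
  rw [node_zero ht] at h ⊢
  split_ifs at h ⊢ with h1
  · exact ⟨h1, rfl⟩
  · exact (h rfl).elim

theorem even_grid {t : RatOf M} {i : M} (h : node t i ≠ 0) : ∃ b, grid t i = 2 * b := by
  rcases eq_zero_or_eq_add_one i with rfl | ⟨i, rfl⟩
  · exact ⟨0, by rw [(node_zero_ne_zero h).1, mul_zero]⟩
  · exact ⟨_, (node_add_one_ne_zero h).2.1.symm⟩

theorem node_ne_zero_of_le {t : RatOf M} {i j : M} (hij : i ≤ j) (h : node t j ≠ 0) :
    node t i ≠ 0 := by
  revert h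
  exact induct_le (Φ := .full M) (p := fun j => node t j ≠ 0 → node t i ≠ 0)
    ((DecP.eq (isFun_node t) (.const 0)).not.imp (.const _)) id
    (fun j _ ih h => ih (node_add_one_ne_zero h).1) hij

/-- Intervals of level `i` that are not discarded keep away from the multiples of `1 / i`. -/
theorem one_le_of_node_ne_zero {t : RatOf M} {i : M} (hi : 0 < i) (h : node t i ≠ 0) (z : M) :
    1 ≤ of i * of (oct i) * |t - of z / of i| := by
  obtain rfl | ⟨i, rfl⟩ := eq_zero_or_eq_add_one i
  · exact (lt_irrefl _ hi).elim
  have ht := nonneg_of_node_ne_zero h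
  have h1 := (node_add_one_ne_zero h).2.2.1
  have h2 := grid_le ht (i + 1)
  have h3 := lt_grid_add_one t (i + 1)
  set a := grid t (i + 1)
  set D := i + 1
  have hD : 0 < of D := of_pos.2 hi
  have hE := of_oct_pos D
  rw [← abs_of_pos (mul_pos hD hE), ← abs_mul]
  have e : of D * of (oct D) * (t - of z / of D) = of D * (of (oct D) * t) - of z * of (oct D) := by
    field_simp
  rw [e]
  by_contra! hlt
  rw [abs_lt] at hlt
  refine h1 ⟨z, ?_⟩
  have h4 := mul_le_mul_of_nonneg_left h2 hD.le
  have h5 := mul_lt_mul_of_pos_left h3 hD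
  have h6 : a * D ≤ z * oct D := by
    rw [← lt_add_one_iff, ← of_lt]
    simp only [map_add, map_mul, map_one]
    linarith [hlt.2]
  have h7 : z * oct D ≤ (a + 1) * D := by
    rw [← lt_add_one_iff, ← of_lt]
    simp only [map_add, map_mul, map_one]
    linarith [hlt.1]
  refine ⟨lt_add_one_iff.2 (le_trans ?_ h7), h6, h7⟩
  exact le_mul_of_one_le_right (zero_le' z) (by simpa using add_one_le_iff.2 (oct_pos D))

end Nodes

/-! ### Tents over first dead intervals, and estimates for their sum -/

section Schemes

variable {M : Type u} [PRAModel M]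

open PRAModel RatOf

/-- A set of binary strings closed under extension, and a weight that
increases along extensions. -/
structure Scheme (Φ : FunClass M) where
  dead : M → Prop
  weight : M → M
  dec_dead : DecP Φ fun v : Fin 1 → M => dead (v 0)
  isFun_weight : IsFun Φ fun v : Fin 1 → M => weight (v 0)
  dead_snoc : ∀ {m i : M}, 0 < m → i ≤ 1 → dead m → dead (2 * m + i)
  weight_snoc : ∀ {m i : M}, 0 < m → i ≤ 1 → weight m ≤ weight (2 * m + i)

/-- The tent of height `1` over the interval `[a / 8 ^ l, (a + 1) / 8 ^ l]`. -/
noncomputable def tent (a l : M) (t : RatOf M) : RatOf M :=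
  max 0 (1 - |2 * (of (oct l) * t) - (2 * of a + 1)|)

theorem tent_nonneg (a l : M) (t : RatOf M) : 0 ≤ tent a l t := le_max_left _ _

theorem tent_le_one (a l : M) (t : RatOf M) : tent a l t ≤ 1 :=
  max_le zero_le_one (by linarith [abs_nonneg (2 * (of (oct l) * t) - (2 * of a + 1))])

theorem tent_le_add (a l : M) (s t : RatOf M) :
    tent a l s ≤ tent a l t + 2 * of (oct l) * |s - t| := by
  have hE := of_oct_pos l
  refine max_le ?_ ?_
  · have := tent_nonneg a l t
    have := abs_nonneg (s - t)
    positivity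
  · have h1 : 1 - |2 * (of (oct l) * t) - (2 * of a + 1)| ≤ tent a l t := le_max_right _ _
    have h2 := abs_sub_abs_le_abs_sub (2 * (of (oct l) * t) - (2 * of a + 1))
      (2 * (of (oct l) * s) - (2 * of a + 1))
    have h3 : |2 * (of (oct l) * t) - (2 * of a + 1) - (2 * (of (oct l) * s) - (2 * of a + 1))| =
        2 * of (oct l) * |s - t| := by
      rw [show 2 * (of (oct l) * t) - (2 * of a + 1) - (2 * (of (oct l) * s) - (2 * of a + 1)) =
        (2 * of (oct l)) * (t - s) by ring, abs_mul, abs_of_pos (by positivity), abs_sub_comm]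
    linarith

theorem abs_tent_sub_le (a l : M) (s t : RatOf M) :
    |tent a l s - tent a l t| ≤ 2 * of (oct l) * |s - t| := by
  have h1 := tent_le_add a l s t
  have h2 := tent_le_add a l t s
  rw [abs_sub_comm t s] at h2
  rw [abs_le]; constructor <;> linarith

theorem tent_eq_zero {a l : M} {t : RatOf M} (h : 0 ≤ t → grid t l ≠ a) : tent a l t = 0 := by
  refine max_eq_left ?_
  have hE := of_oct_pos l
  suffices h1 : of (oct l) * t ≤ of a ∨ of a + 1 ≤ of (oct l) * t by
    rcases h1 with h1 | h1
    · rw [abs_of_nonpos (by linarith)]; linarith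
    · rw [abs_of_nonneg (by linarith)]; linarith
  rcases lt_or_ge t 0 with ht | ht
  · exact .inl ((mul_neg_of_pos_of_neg hE ht).le.trans (of_nonneg a))
  · have h1 := grid_le ht l
    have h2 := lt_grid_add_one t l
    rcases lt_or_gt_of_ne (h ht) with h3 | h3
    · have := of_le.2 (add_one_le_iff.2 h3)
      rw [map_add, map_one] at this
      exact .inl (by linarith)
    · have := of_le.2 (add_one_le_iff.2 h3)
      rw [map_add, map_one] at this
      exact .inr (by linarith)

namespace Scheme

variable {Φ : FunClass M} (σ : Scheme Φ)

/-- The string `m` is dead or has weight larger than `k`. -/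
def Settled (k m : M) : Prop := σ.dead m ∨ k + 1 ≤ σ.weight m

/-- The first dead interval around `t` has level `l`. -/
def FirstDead (t : RatOf M) (l : M) : Prop :=
  node t l ≠ 0 ∧ σ.dead (node t l) ∧ ∀ j < l, ¬ σ.dead (node t j)

variable {σ}

theorem weight_le_of_le {t : RatOf M} {i j : M} (hij : i ≤ j) (h : node t j ≠ 0) :
    σ.weight (node t i) ≤ σ.weight (node t j) := by
  revert h
  refine induct_le (Φ := Φ) (p := fun j => node t j ≠ 0 → σ.weight (node t i) ≤ σ.weight (node t j))
    ((DecP.eq (isFun_node t) (.const 0)).not.imp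
      (DecP.le (.const _) (σ.isFun_weight.comp₁ (isFun_node t)))) (fun _ => le_rfl)
    (fun j _ ih h => ?_) hij
  obtain ⟨h1, -, -, h2⟩ := node_add_one_ne_zero h
  rw [h2]
  exact (ih h1).trans (σ.weight_snoc (pos_iff_ne_zero.2 h1) (octBit_le_one _))

theorem exists_firstDead {t : RatOf M} {i : M} (h : node t i ≠ 0) (hd : σ.dead (node t i)) :
    ∃ l ≤ i, σ.FirstDead t l := by
  obtain ⟨l, hl, H⟩ := exists_least (Φ := Φ) (p := fun l => node t l ≠ 0 ∧ σ.dead (node t l))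
    ((DecP.eq (isFun_node t) (.const 0)).not.and (σ.dec_dead.comp₁ (isFun_node t))) ⟨i, h, hd⟩
  exact ⟨l, not_lt.1 fun hi => H i hi ⟨h, hd⟩, hl.1, hl.2,
    fun j hj hj' => H j hj ⟨node_ne_zero_of_le hj.le hl.1, hj'⟩⟩

theorem FirstDead.unique {t : RatOf M} {l l' : M} (h : σ.FirstDead t l) (h' : σ.FirstDead t l') :
    l = l' := by
  rcases lt_trichotomy l l' with hl | hl | hl
  · exact (h'.2.2 l hl h.2.1).elim
  · exact hl
  · exact (h.2.2 l' hl h'.2.1).elim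

theorem FirstDead.congr {s t : RatOf M} {l : M} (h : σ.FirstDead s l) (ht : 0 ≤ t)
    (hst : grid t l = grid s l) : σ.FirstDead t l ∧ node t l = node s l := by
  have hs := nonneg_of_node_ne_zero h.1
  have hn : ∀ j ≤ l, node t j = node s j := fun j hj =>
    node_congr ht hs (grid_congr ht hs hj hst)
  refine ⟨⟨?_, ?_, fun j hj => ?_⟩, hn l le_rfl⟩
  · rw [hn l le_rfl]; exact h.1
  · rw [hn l le_rfl]; exact h.2.1
  · rw [hn j hj.le]; exact h.2.2 j hj

variable (σ)

open Classical in
/-- The sum of tents of height `2 ^ (-weight)` over the first dead intervals. -/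
noncomputable def tents (t : RatOf M) : RatOf M :=
  if h : ∃ l, σ.FirstDead t l then
    pw (σ.weight (node t h.choose)) * tent (grid t h.choose) h.choose t else 0

variable {σ}

theorem tents_eq {t : RatOf M} {l : M} (h : σ.FirstDead t l) :
    σ.tents t = pw (σ.weight (node t l)) * tent (grid t l) l t := by
  have H : ∃ l, σ.FirstDead t l := ⟨l, h⟩
  rw [tents, dif_pos H, H.choose_spec.unique h]

theorem tents_eq_zero {t : RatOf M} (h : ¬ ∃ l, σ.FirstDead t l) : σ.tents t = 0 := dif_neg h

theorem tents_nonneg (t : RatOf M) : 0 ≤ σ.tents t := by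
  by_cases h : ∃ l, σ.FirstDead t l
  · obtain ⟨l, h⟩ := h
    rw [tents_eq h]
    exact mul_nonneg (pw_pos _).le (tent_nonneg _ _ _)
  · rw [tents_eq_zero h]

/-- If t lies in the interval of s, the two sides agree, because being first dead depends only on
the interval; elsewhere this tent vanishes. -/
theorem tent_le_tents {s : RatOf M} {l : M} (h : σ.FirstDead s l) (t : RatOf M) :
    pw (σ.weight (node s l)) * tent (grid s l) l t ≤ σ.tents t := by
  by_cases ht : 0 ≤ t ∧ grid t l = grid s l
  · obtain ⟨h1, h2⟩ := h.congr ht.1 ht.2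
    rw [tents_eq h1, h2, ht.2]
  · rw [tent_eq_zero fun h0 h1 => ht ⟨h0, h1⟩, mul_zero]
    exact tents_nonneg t

variable (σ) in
/-- All intervals of level `n` near `r` are settled. -/
def Good (r : RatOf M) (n k : M) : Prop :=
  ∀ s, 4 * of (oct n) * |s - r| < 1 → node s n ≠ 0 → σ.Settled k (node s n)

/-- If the tent at s has level at most n, its slope is at most 2·8ⁿ, and the move from s to t costs
at most 2^(-k-2). If its level is larger, the string of s at level n is settled but not dead, so its
weight exceeds k and the tent is no higher than 2^(-k-1). -/
theorem tents_le_add {r s t : RatOf M} {n k : M} (hr : σ.Good r n k)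
    (hs : 4 * of (oct n) * |s - r| < 1) (hst : |s - t| ≤ pw (3 * n + k + 3)) :
    σ.tents s ≤ σ.tents t + pw (k + 1) := by
  have hk := pw_pos k
  have ht := σ.tents_nonneg t
  by_cases h : ∃ l, σ.FirstDead s l
  swap
  · rw [tents_eq_zero h]
    exact add_nonneg ht (pw_pos _).le
  obtain ⟨l, h⟩ := h
  have hw := pw_pos (σ.weight (node s l))
  rcases le_or_gt l n with hl | hl
  · have h1 := tent_le_tents h t
    have h2 := mul_le_mul_of_nonneg_left (tent_le_add (grid s l) l s t) hw.le
    rw [← tents_eq h, mul_add] at h2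
    have h3 : of (oct l) * |s - t| ≤ pw k / 8 := by
      calc of (oct l) * |s - t| ≤ of (oct n) * pw (3 * n + k + 3) :=
            mul_le_mul (of_le.2 (oct_mono hl)) hst (abs_nonneg _) (of_oct_pos n).le
        _ = pw k / 8 := by
            rw [← two_add_one_eq_three, ← one_add_one_eq_two, ← add_assoc, ← add_assoc, pw_add_one,
              pw_add_one, pw_add_one, pw_add, one_add_one_eq_two, two_add_one_eq_three]
            linear_combination (pw k / 8) * of_oct_mul_pw n
    have h4 : pw (σ.weight (node s l)) * (2 * of (oct l) * |s - t|) ≤ 1 * (pw k / 4) :=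
      mul_le_mul (pw_le_one _) (by linarith) (by have := of_oct_pos l; positivity) zero_le_one
    rw [pw_add_one]
    linarith
  · have hn := node_ne_zero_of_le hl.le h.1
    have h1 := (hr s hs hn).resolve_left (h.2.2 n hl)
    have h2 := pw_strictAnti.antitone (h1.trans (weight_le_of_le hl.le h.1))
    have h3 := mul_le_mul h2 (tent_le_one (grid s l) l s) (tent_nonneg _ _ _) (pw_pos _).le
    rw [← tents_eq h, mul_one] at h3
    linarith

theorem pw_small (n k : M) : 8 * of (oct n) * pw (3 * n + k + 3) ≤ 1 := by
  have e : 8 * of (oct n) * pw (3 * n + k + 3) = pw k := by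
    rw [← two_add_one_eq_three, ← one_add_one_eq_two, ← add_assoc, ← add_assoc, pw_add_one,
      pw_add_one, pw_add_one, pw_add, one_add_one_eq_two, two_add_one_eq_three]
    linear_combination (pw k) * of_oct_mul_pw n
  rw [e]
  exact pw_le_one k

theorem abs_tents_sub_le {r t : RatOf M} {n k : M} (hr : σ.Good r n k)
    (ht : |t - r| ≤ pw (3 * n + k + 3)) : |σ.tents t - σ.tents r| ≤ pw (k + 1) := by
  have hE := of_oct_pos n
  have h0 : 4 * of (oct n) * |t - r| < 1 := by
    have h1 := mul_le_mul_of_nonneg_left ht (by positivity : 0 ≤ 4 * of (oct n))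
    have h2 := pw_small n k
    linarith
  have h1 := tents_le_add hr h0 ht
  have h2 := tents_le_add (s := r) (t := t) hr (by simp) (by rwa [abs_sub_comm])
  rw [abs_le]; constructor <;> linarith

/-- Close to a rational with denominator `D` there are no intervals of level `2 D`. -/
theorem one_le_of_node_two_mul {s : RatOf M} {D : M} (hD : 0 < D) (hn : node s (2 * D) ≠ 0) (u : M) :
    1 ≤ of (oct (2 * D)) * |s - of u / of D| := by
  have hle : D ≤ 2 * D := by rw [two_mul]; exact le_self_add
  have h1 := one_le_of_node_ne_zero hD (node_ne_zero_of_le hle hn) u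
  have h2 : of D ≤ of (oct D) := of_le.2 (lt_oct D).le
  rw [two_mul, oct_add, map_mul]
  have h3 := abs_nonneg (s - of u / of D)
  have hE := of_oct_pos D
  refine h1.trans ?_
  gcongr

variable (σ) in
/-- The only interval of level `n` that may be near `u / D` is not there, or not near, or settled. -/
def Check (u D n k : M) : Prop :=
  4 * oct n * u < (8 * quo (4 * oct n * u + D) (8 * D) + 5) * D →
  nodeFun n (2 * quo (4 * oct n * u + D) (8 * D)) (oct n) ≠ 0 →
  σ.Settled k (nodeFun n (2 * quo (4 * oct n * u + D) (8 * D)) (oct n))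

theorem dec_settled {n : ℕ} {f g : (Fin n → M) → M} (hf : IsFun Φ f) (hg : IsFun Φ g) :
    DecP Φ fun v => σ.Settled (f v) (g v) :=
  (σ.dec_dead.comp₁ hg).or (DecP.le (.add hf (.const 1)) (IsFun.comp₁ σ.isFun_weight hg))

theorem dec_check {n : ℕ} {f g h l : (Fin n → M) → M} (hf : IsFun Φ f) (hg : IsFun Φ g)
    (hh : IsFun Φ h) (hl : IsFun Φ l) : DecP Φ fun v => σ.Check (f v) (g v) (h v) (l v) := by
  have h1 : IsFun Φ fun v => quo (4 * oct (h v) * f v + g v) (8 * g v) :=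
    .quo (.add (.mul (.mul (.const 4) hh.oct) hf) hg) (.mul (.const 8) hg)
  have h2 : IsFun Φ fun v =>
      nodeFun (h v) (2 * quo (4 * oct (h v) * f v + g v) (8 * g v)) (oct (h v)) :=
    .nodeFun hh (.mul (.const 2) h1) hh.oct
  exact (DecP.lt (.mul (.mul (.const 4) hh.oct) hf)
    (.mul (.add (.mul (.const 8) h1) (.const 5)) hg)).imp
    ((DecP.eq h2 (.const 0)).not.imp (dec_settled hl h2))

theorem lt_five_iff {u D n b : M} (hD : 0 < D) : 4 * oct n * u < (8 * b + 5) * D ↔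
    4 * (of (oct n) * (of u / of D)) < 8 * of b + 5 := by
  have hD' := of_pos.2 hD
  rw [← of_lt, ← mul_div_assoc, ← mul_div_assoc, div_lt_iff₀ hD']
  simp only [map_mul, map_add, map_ofNat]
  rw [mul_assoc]

/-- With X = 8ⁿu/D, the quotient b is the integer part of (X + 1/4)/2. So 2b is the only even index
whose unit interval can come within 1/4 of X, and `lt_five_iff` expresses the remaining condition X
< 2b + 5/4. -/
theorem quo_eight {u D n : M} (hD : 0 < D) :
    8 * of (quo (4 * oct n * u + D) (8 * D)) ≤ 4 * (of (oct n) * (of u / of D)) + 1 ∧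
    4 * (of (oct n) * (of u / of D)) + 1 < 8 * of (quo (4 * oct n * u + D) (8 * D)) + 8 := by
  have hD' := of_pos.2 hD
  obtain ⟨h1, h2⟩ := quo_spec (4 * oct n * u + D) (y := 8 * D) (mul_pos (by positivity) hD)
  have h3 := of_le.2 h1
  have h4 := of_lt.2 h2
  simp only [map_mul, map_add, map_ofNat, map_one] at h3 h4
  have e : 4 * (of (oct n) * (of u / of D)) + 1 = (4 * of (oct n) * of u + of D) / of D := by
    field_simp
  rw [e, le_div_iff₀ hD', div_lt_iff₀ hD']
  constructor <;> linarith

/-- Surviving intervals have even index, so gaps of length at least 8^(-n) separate them, and a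
single test at one candidate decides about all of them near u/D. -/
theorem Check.good {u D n k : M} (hD : 0 < D) (h : σ.Check u D n k) :
    σ.Good (of u / of D) n k := by
  intro s hs hn
  have hs0 := nonneg_of_node_ne_zero hn
  have hE := of_oct_pos n
  obtain ⟨b, hb⟩ := even_grid hn
  have h1 := grid_le hs0 n
  have h2 := lt_grid_add_one s n
  rw [hb, map_mul, map_ofNat] at h1 h2
  have h3 : 4 * |of (oct n) * s - of (oct n) * (of u / of D)| < 1 := by
    rwa [← mul_sub, abs_mul, abs_of_pos hE, ← mul_assoc]
  obtain ⟨h4, h5⟩ := quo_eight (u := u) (n := n) hD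
  obtain ⟨h6, h7⟩ := abs_lt.1 (show |of (oct n) * s - of (oct n) * (of u / of D)| < 1 / 4 by linarith)
  have h8 : quo (4 * oct n * u + D) (8 * D) = b := by
    refine le_antisymm (of_lt_of_add_one.1 ?_) (of_lt_of_add_one.1 ?_) <;> linarith
  rw [Check, h8, lt_five_iff hD, ← node_div _ (oct_pos n)] at h
  have h9 : node (of (2 * b) / of (oct n)) n = node s n :=
    node_congr (div_nonneg (of_nonneg _) hE.le) hs0 (by rw [grid_of_div_oct, hb])
  rw [h9] at h
  exact h (by linarith) hn

/-- The test concerns an interval within 1/4 of X = 8ⁿu/D, but intervals are half-open and the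
nearest point may be the missing right end. The point 2b + 15/16 replaces it, at distance at most
1/4 + 1/16 = 5/16. -/
theorem check_of_settled {u D n k : M} (hD : 0 < D)
    (h : ∀ s, 16 * (of (oct n) * |s - of u / of D|) ≤ 5 → node s n ≠ 0 → σ.Settled k (node s n)) :
    σ.Check u D n k := by
  have hE := of_oct_pos n
  rw [Check, lt_five_iff hD]
  obtain ⟨h1, h2⟩ := quo_eight (u := u) (n := n) hD
  set b := quo (4 * oct n * u + D) (8 * D)
  intro h3 hn
  rw [← node_div _ (oct_pos n)] at hn ⊢
  set r := of u / of D
  have hb := of_nonneg b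
  obtain ⟨z, hz1, hz2, hz3⟩ : ∃ z, 2 * of b ≤ z ∧ z < 2 * of b + 1 ∧ 16 * |z - of (oct n) * r| ≤ 5 := by
    rcases lt_or_ge (of (oct n) * r) (2 * of b) with h4 | h4
    · refine ⟨2 * of b, le_rfl, by linarith, ?_⟩
      rw [abs_of_nonneg (by linarith)]; linarith
    rcases lt_or_ge (of (oct n) * r) (2 * of b + 15 / 16) with h5 | h5
    · exact ⟨of (oct n) * r, h4, by linarith, by simp⟩
    · refine ⟨2 * of b + 15 / 16, by linarith, by linarith, ?_⟩
      rw [abs_of_nonpos (by linarith)]; linarith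
  have hz0 : 0 ≤ z / of (oct n) := div_nonneg (by linarith) hE.le
  have hg : grid (z / of (oct n)) n = 2 * b := by
    rw [grid, mul_div_cancel₀ _ hE.ne']
    exact fl_eq (by simpa [map_ofNat] using hz1) (by simpa [map_ofNat] using hz2)
  have h9 : node (of (2 * b) / of (oct n)) n = node (z / of (oct n)) n :=
    node_congr (div_nonneg (of_nonneg _) hE.le) hz0 (by rw [grid_of_div_oct, hg])
  rw [h9] at hn ⊢
  refine h _ ?_ hn
  have : of (oct n) * |z / of (oct n) - r| = |z - of (oct n) * r| := by
    rw [← abs_of_pos hE, ← abs_mul, abs_of_pos hE, mul_sub, mul_div_cancel₀ _ hE.ne']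
  rw [this]
  exact hz3

variable (σ) in
/-- Each path meets settled strings. -/
def PathSettled : Prop :=
  ∀ c : M → M, IsFun (.full M) (fun v : Fin 1 → M => c (v 0)) → c 0 = 1 →
    (∀ n, ∃ i ≤ 1, c (n + 1) = 2 * c n + i) → ∀ k, ∃ n, σ.Settled k (c n)

/-- Around a real, all intervals of a suitable level are settled. -/
theorem exists_settled_near (hσ : σ.PathSettled) {x : M → RatCode M} (hx : (str M).IsReal x) (k : M) :
    ∃ n, ∀ s, 8 * (of (oct n) * |s - (x (3 * n + 6)).toRat|) ≤ 3 → node s n ≠ 0 →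
      σ.Settled k (node s n) := by
  by_contra! H
  -- The points s n are chosen outside the model. The string of s n, however, can be computed from
  -- x, since only one surviving interval comes near; the resulting path is in the model and
  -- contradicts `PathSettled`.
  choose s hs hn hset using H
  -- the index of the interval of level `n` near `x`
  have hx' := (isReal_iff.1 hx).1
  set X : M → RatOf M := fun n => of (oct n) * (x (3 * n + 6)).toRat with hX
  have hnear : ∀ n t, 8 * (of (oct n) * |t - (x (3 * n + 6)).toRat|) ≤ 3 →
      |of (oct n) * t - X n| ≤ 3 / 8 := fun n t h => by
    rw [hX, ← mul_sub, abs_mul, abs_of_pos (of_oct_pos n)]; linarith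
  -- The code of X n + 3/8; the code ⟨3, 0, 7⟩ denotes 3/8. An interval with index 2b within 3/8 of
  -- X n has 2b ≤ X n + 3/8 < 2b + 2, so halving and rounding down recovers b.
  let y : M → RatCode M := fun n =>
    (str M).ratAdd ⟨oct n * (x (3 * n + 6)).pos, oct n * (x (3 * n + 6)).neg, (x (3 * n + 6)).den⟩
      ⟨3, 0, 7⟩
  have hy : IsRatFun (.full M) fun v : Fin 1 → M => y (v 0) := by
    have h1 : IsRatFun (.full M) fun v : Fin 1 → M => x (3 * v 0 + 6) :=
      hx'.comp₁ (.add (.mul (.const 3) (.proj 0)) (.const 6))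
    have h2 : IsFun (.full M) fun v : Fin 1 → M => oct (v 0) := .oct (.proj 0)
    exact (IsRatFun.mk' (h2.mul h1.pos) (h2.mul h1.neg) h1.den).ratAdd (.const _)
  have hyX : ∀ n, (y n).toRat = X n + 3 / 8 := fun n => by
    rw [RatCode.toRat_ratAdd]
    have h7 : of (7 : M) + 1 = 8 := by rw [map_ofNat of 7]; norm_num
    have h3 : of (3 : M) = 3 := map_ofNat of 3
    simp only [RatCode.toRat, map_mul, hX, h7, h3, map_zero, sub_zero]
    ring
  let a : M → M := fun n => 2 * quo ((y n).pos - (y n).neg) (2 * ((y n).den + 1))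
  have ha : IsFun (.full M) fun v : Fin 1 → M => a (v 0) :=
    .mul (.const 2) (.quo (.tsub hy.pos hy.neg) (.mul (.const 2) (.add hy.den (.const 1))))
  have grid_eq : ∀ n t, 8 * (of (oct n) * |t - (x (3 * n + 6)).toRat|) ≤ 3 → node t n ≠ 0 →
      grid t n = a n := by
    intro n t ht hnt
    have ht0 := nonneg_of_node_ne_zero hnt
    obtain ⟨b, hb⟩ := even_grid hnt
    have h1 := grid_le ht0 n
    have h2 := lt_grid_add_one t n
    rw [hb, map_mul, map_ofNat] at h1 h2
    obtain ⟨h3, h4⟩ := abs_le.1 (hnear n t ht)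
    have h5 : 2 * of b ≤ (y n).toRat := by rw [hyX]; linarith
    have h6 : (y n).toRat < 2 * of b + 2 := by rw [hyX]; linarith
    have hd := of_add_one_pos (y n).den
    rw [RatCode.toRat, le_div_iff₀ hd] at h5
    rw [RatCode.toRat, div_lt_iff₀ hd] at h6
    have h7 : (y n).neg ≤ (y n).pos := by
      rw [← of_le]
      have := mul_nonneg (of_nonneg b) hd.le
      linarith
    have h8 : of ((y n).pos - (y n).neg) = of (y n).pos - of (y n).neg := by
      conv_rhs => rw [← tsub_add_cancel_of_le h7, map_add]
      ring
    obtain ⟨h9, h10⟩ := quo_spec ((y n).pos - (y n).neg) (y := 2 * ((y n).den + 1))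
      (mul_pos (by positivity) (zero_lt_add_one _))
    have h11 := of_le.2 h9
    have h12 := of_lt.2 h10
    simp only [h8, map_mul, map_add, map_ofNat, map_one] at h11 h12
    rw [hb]
    refine congrArg (2 * ·) (le_antisymm (of_lt_of_add_one.1 ?_) (of_lt_of_add_one.1 ?_))
    · refine lt_of_mul_lt_mul_right (a := of (y n).den + 1) ?_ hd.le
      linarith
    · refine lt_of_mul_lt_mul_right (a := of (y n).den + 1) ?_ hd.le
      linarith
  let c : M → M := fun n => nodeFun n (a n) (oct n)
  have hc : IsFun (.full M) fun v : Fin 1 → M => c (v 0) := .nodeFun (.proj 0) ha (.oct (.proj 0))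
  have hcn : ∀ n t, 8 * (of (oct n) * |t - (x (3 * n + 6)).toRat|) ≤ 3 → node t n ≠ 0 →
      node t n = c n := fun n t ht hnt => by
    show _ = nodeFun n (a n) (oct n)
    rw [← node_div _ (oct_pos n)]
    exact node_congr (nonneg_of_node_ne_zero hnt) (div_nonneg (of_nonneg _) (of_nonneg _))
      (by rw [grid_of_div_oct, grid_eq n t ht hnt])
  have hc0 : c 0 = 1 := by
    rw [← hcn 0 (s 0) (hs 0) (hn 0)]
    exact (node_zero_ne_zero (hn 0)).2
  have hcs : ∀ n, ∃ i ≤ 1, c (n + 1) = 2 * c n + i := by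
    intro n
    have h1 := hn (n + 1)
    obtain ⟨h2, -, -, h3⟩ := node_add_one_ne_zero h1
    refine ⟨octBit (grid (s (n + 1)) (n + 1)), octBit_le_one _, ?_⟩
    rw [← hcn (n + 1) _ (hs (n + 1)) h1, ← hcn n (s (n + 1)) ?_ h2]
    · exact h3
    -- A point near x at scale 8^(-n-1) is near x at scale 8^(-n): in units of 8^(-n) its distance
    -- is at most 3/64 plus the change of the approximation, which is at most 1/8.
    have h4 := hs (n + 1)
    rw [oct_add_one, map_mul, map_ofNat] at h4
    have hle : 3 * n + 6 ≤ 3 * (n + 1) + 6 := by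
      rw [mul_add, add_right_comm]; exact le_self_add
    have h5 := (abs_sub_lt_of_isReal hx hle).le
    have h6 : of (oct n) * pw (3 * n + 6) ≤ 1 / 8 := by
      have h7 := mul_le_mul_of_nonneg_left (pw_strictAnti.antitone
        (show 3 * n + 0 + 3 ≤ 3 * n + 6 by
          rw [add_zero, show (6 : M) = 3 + 3 by norm_num, ← add_assoc]; exact le_self_add))
        (of_oct_pos n).le
      have := pw_small n 0
      linarith
    have h8 := abs_sub_le (s (n + 1)) (x (3 * (n + 1) + 6)).toRat (x (3 * n + 6)).toRat
    rw [abs_sub_comm (x (3 * (n + 1) + 6)).toRat] at h8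
    have hE := of_oct_pos n
    have h9 := mul_le_mul_of_nonneg_left (h8.trans (add_le_add_right h5 _)) hE.le
    rw [mul_add] at h9
    linarith
  obtain ⟨n, h⟩ := hσ c hc hc0 hcs k
  rw [← hcn n (s n) (hs n) (hn n)] at h
  exact hset n h

end Scheme

end Schemes

/-! ### The function of a scheme: its presentation, continuity and values -/

section SchemeFunction

variable {M : Type u} [PRAModel M]

open PRAModel RatOf

theorem RatOf.of_tsub (x y : M) : of (x - y) = max 0 (of x - of y) := by
  rcases le_total x y with h | h
  · rw [tsub_eq_zero_of_le h, map_zero, max_eq_left (by linarith [of_le.2 h])]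
  · rw [max_eq_right (by linarith [of_le.2 h])]
    conv_rhs => rw [← tsub_add_cancel_of_le h, map_add]
    ring

theorem RatCode.max_toRat (r : RatCode M) : max 0 r.toRat = of (r.pos - r.neg) / of (r.den + 1) := by
  have hd := of_add_one_pos r.den
  rw [of_tsub, RatCode.toRat, map_add, map_one, ← max_div_div_right hd.le, zero_div]

theorem RatCode.toRat_eq_div {r : RatCode M} (hr : 0 ≤ r.toRat) :
    r.toRat = of (r.pos - r.neg) / of (r.den + 1) := by
  rw [← RatCode.max_toRat, max_eq_right hr]

/-- The code of the value at `r` of the tent of height `2 ^ (-w)` over the `a`-th interval of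
level `l`. -/
def tentCode (a l w : M) (r : RatCode M) : RatCode M :=
  ⟨(r.den + 1) - ((2 * (oct l * (r.pos - r.neg)) - (2 * a + 1) * (r.den + 1)) +
      ((2 * a + 1) * (r.den + 1) - 2 * (oct l * (r.pos - r.neg)))), 0,
    (str M).predTwoPow w * (r.den + 1) + r.den⟩

theorem toRat_tentCode (a l w : M) (r : RatCode M) :
    (tentCode a l w r).toRat = pw w * tent a l (max 0 r.toRat) := by
  have hD : 0 < of r.den + 1 := of_add_one_pos r.den
  have hw := of_pow2_pos w
  have e1 : ∀ x y : RatOf M, max 0 (x - y) + max 0 (y - x) = |x - y| := fun x y => by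
    rcases le_total x y with h | h
    · rw [max_eq_left (by linarith), max_eq_right (by linarith), abs_of_nonpos (by linarith)]; ring
    · rw [max_eq_right (by linarith), max_eq_left (by linarith), abs_of_nonneg (by linarith)]; ring
  have e2 : of ((str M).predTwoPow w * (r.den + 1) + r.den) + 1 = of (pow2 w) * (of r.den + 1) := by
    simp only [pow2, map_add, map_mul, map_one]; ring
  rw [RatCode.max_toRat]
  simp only [RatCode.toRat, tentCode, e2]
  generalize r.pos - r.neg = v
  rw [of_tsub (r.den + 1), map_add of (_ - _), of_tsub, of_tsub, e1]
  simp only [map_add, map_mul, map_one, map_zero, sub_zero, map_ofNat]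
  set u := of v
  have e3 : 2 * (of (oct l) * u) - (2 * of a + 1) * (of r.den + 1) =
      (2 * (of (oct l) * (u / (of r.den + 1))) - (2 * of a + 1)) * (of r.den + 1) := by
    field_simp
  rw [e3, abs_mul, abs_of_pos hD, tent, pw, div_eq_iff (by positivity)]
  have e4 : (of r.den + 1) - |2 * (of (oct l) * (u / (of r.den + 1))) - (2 * of a + 1)| *
      (of r.den + 1) =
      (1 - |2 * (of (oct l) * (u / (of r.den + 1))) - (2 * of a + 1)|) * (of r.den + 1) := by ring
  rw [e4, show (0 : RatOf M) = 0 * (of r.den + 1) by ring, ← max_mul_of_nonneg _ _ hD.le, zero_mul]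
  field_simp

theorem IsRatFun.tentCode {Φ : FunClass M} {n : ℕ} {a l w : (Fin n → M) → M}
    {r : (Fin n → M) → RatCode M} (ha : IsFun Φ a) (hl : IsFun Φ l) (hw : IsFun Φ w)
    (hr : IsRatFun Φ r) : IsRatFun Φ fun v => tentCode (a v) (l v) (w v) (r v) := by
  have hD := hr.den.add (.const 1)
  have h1 := IsFun.mul (.const 2) (hl.oct.mul (hr.pos.tsub hr.neg))
  have h2 := IsFun.mul (.add (.mul (.const 2) ha) (.const 1)) hD
  exact .mk' (hD.tsub ((h1.tsub h2).add (h2.tsub h1))) (.const 0)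
    ((hw.predTwoPow.mul hD).add hr.den)

theorem IsRatFun.ite {Φ : FunClass M} {n : ℕ} {p : (Fin n → M) → Prop} {dec : ∀ v, Decidable (p v)}
    {f g : (Fin n → M) → RatCode M} (hp : DecP Φ p) (hf : IsRatFun Φ f) (hg : IsRatFun Φ g) :
    IsRatFun Φ fun v => if p v then f v else g v := by
  constructor
  · simp only [apply_ite RatCode.pos]
    exact hp.ite hf.pos hg.pos
  · simp only [apply_ite RatCode.neg]
    exact hp.ite hf.neg hg.neg
  · simp only [apply_ite RatCode.den]
    exact hp.ite hf.den hg.den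

namespace Scheme

variable {Φ : FunClass M} (σ : Scheme Φ)

/-- The level of the first dead interval around `u / D`. -/
noncomputable def deadLevel (u D : M) : M :=
  leastBelow (fun l => nodeFun l u D ≠ 0 ∧ σ.dead (nodeFun l u D)) (D + 1)

/-- The least level at which the intervals around `u / D` are settled. -/
noncomputable def checkLevel (u D k : M) : M := leastBelow (fun n => σ.Check u D n k) (2 * D + 1)

open Classical in
/-- The presentation of the function `tents`. -/
noncomputable def code : FunCode M where
  val r _ := if σ.deadLevel (r.pos - r.neg) (r.den + 1) < (r.den + 1) + 1 then
    tentCode (quo (oct (σ.deadLevel (r.pos - r.neg) (r.den + 1)) * (r.pos - r.neg)) (r.den + 1))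
      (σ.deadLevel (r.pos - r.neg) (r.den + 1))
      (σ.weight (nodeFun (σ.deadLevel (r.pos - r.neg) (r.den + 1)) (r.pos - r.neg) (r.den + 1))) r
    else ⟨0, 0, 0⟩
  δ r k := 3 * σ.checkLevel (r.pos - r.neg) (r.den + 1) k + k + 3

variable {σ}

theorem isFun_deadLevel {n : ℕ} {f g : (Fin n → M) → M} (hf : IsFun Φ f) (hg : IsFun Φ g) :
    IsFun Φ fun v => σ.deadLevel (f v) (g v) := by
  refine IsFun.comp₂ ?_ hf hg
  have h : IsFun Φ fun v : Fin 3 → M => nodeFun (v 0) (v 1) (v 2) :=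
    .nodeFun (.proj 0) (.proj 1) (.proj 2)
  exact IsFun.leastBelow (p := fun v l => nodeFun l (v 0) (v 1) ≠ 0 ∧
    σ.dead (nodeFun l (v 0) (v 1))) ((DecP.eq h (.const 0)).not.and (σ.dec_dead.comp₁ h))
    (.add (.proj 1) (.const 1))

theorem isFun_checkLevel {n : ℕ} {f g h : (Fin n → M) → M} (hf : IsFun Φ f) (hg : IsFun Φ g)
    (hh : IsFun Φ h) : IsFun Φ fun v => σ.checkLevel (f v) (g v) (h v) := by
  refine IsFun.comp₃ ?_ hf hg hh
  exact IsFun.leastBelow (p := fun v l => σ.Check (v 0) (v 1) l (v 2))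
    (dec_check (.proj _) (.proj _) (.proj _) (.proj _))
    (.add (.mul (.const 2) (.proj 1)) (.const 1))

theorem isFun_code :
    IsRatFun Φ (fun v : Fin 4 → M => σ.code.val ⟨v 0, v 1, v 2⟩ (v 3)) ∧
    IsFun Φ (fun v : Fin 4 → M => σ.code.δ ⟨v 0, v 1, v 2⟩ (v 3)) := by
  have hr : IsRatFun Φ fun v : Fin 4 → M => ⟨v 0, v 1, v 2⟩ := ⟨.proj 0, .proj 1, .proj 2⟩
  have hu : IsFun Φ fun v : Fin 4 → M => v 0 - v 1 := .tsub (.proj 0) (.proj 1)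
  have hD : IsFun Φ fun v : Fin 4 → M => v 2 + 1 := .add (.proj 2) (.const 1)
  have hl := isFun_deadLevel (σ := σ) hu hD
  constructor
  · exact IsRatFun.ite (DecP.lt hl (hD.add (.const 1)))
      (.tentCode (.quo (.mul hl.oct hu) hD) hl (IsFun.comp₁ σ.isFun_weight (.nodeFun hl hu hD)) hr)
      (.const _)
  · exact .add (.add (.mul (.const 3) (isFun_checkLevel hu hD (.proj 3))) (.proj 3)) (.const 3)

theorem hasFunCode : (str M).HasFunCode σ.code :=
  ⟨isFun_code.1.pos.toFull, isFun_code.1.neg.toFull, isFun_code.1.den.toFull, isFun_code.2.toFull⟩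

/-- A rational u/D lies in no surviving interval of level D, hence in none of higher level. The
bounded search therefore finds the first dead level if there is one, and the value at a rational is
exact. -/
theorem toRat_val {r : RatCode M} (hr : 0 ≤ r.toRat) (i : M) :
    (σ.code.val r i).toRat = σ.tents r.toRat := by
  have hD : 0 < r.den + 1 := zero_lt_add_one _
  have e := RatCode.toRat_eq_div hr
  simp only [code]
  set u := r.pos - r.neg with hu
  set D := r.den + 1 with hDdef
  have hp : DecP Φ fun v : Fin 1 → M => nodeFun (v 0) u D ≠ 0 ∧ σ.dead (nodeFun (v 0) u D) := by
    have h : IsFun Φ fun v : Fin 1 → M => nodeFun (v 0) u D :=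
      .nodeFun (.proj 0) (.const _) (.const _)
    exact (DecP.eq h (.const 0)).not.and (σ.dec_dead.comp₁ h)
  by_cases h : ∃ l, σ.FirstDead r.toRat l
  · obtain ⟨l, h⟩ := h
    have h1 : l < D + 1 := by
      by_contra! h2
      have h3 := node_ne_zero_of_le ((lt_self_add_one D).le.trans h2) h.1
      rw [e] at h3
      have := one_le_of_node_ne_zero hD h3 u
      rw [sub_self, abs_zero, mul_zero] at this
      exact this.not_gt zero_lt_one
    have hl : σ.deadLevel u D = l := by
      have h' := h
      rw [e] at h'
      simp only [FirstDead, node_div _ hD] at h'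
      exact leastBelow_eq (.inl ⟨h1, h'.1, h'.2.1⟩) fun z hz h2 => h'.2.2 z hz h2.2
    have eg : grid r.toRat l = quo (oct l * u) D := by rw [e, grid_div _ hD]
    have en : node r.toRat l = nodeFun l u D := by rw [e, node_div _ hD]
    rw [hl, if_pos h1, toRat_tentCode, max_eq_right hr, tents_eq h, eg, en]
  · rw [tents_eq_zero h, if_neg, RatCode.toRat]
    · simp
    · intro hlt
      have h2 := ((leastBelow_spec hp (D + 1)).1.resolve_right hlt.ne).2
      rw [← node_div _ hD, ← e] at h2
      obtain ⟨l, -, hl⟩ := exists_firstDead h2.1 h2.2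
      exact h ⟨l, hl⟩

/-- The search below 2D + 1 succeeds because the test is vacuous at level 2D: no surviving interval
of that level comes closer than 8^(-2D) to u/D. -/
theorem checkLevel_spec (u : M) {D : M} (hD : 0 < D) (k : M) :
    σ.Good (of u / of D) (σ.checkLevel u D k) k ∧
      ∀ n, σ.Check u D n k → σ.checkLevel u D k ≤ n := by
  have hp : DecP Φ fun v : Fin 1 → M => σ.Check u D (v 0) k :=
    dec_check (.const _) (.const _) (.proj 0) (.const _)
  have h : σ.Check u D (2 * D) k := check_of_settled hD fun s hs hn => by
    have := one_le_of_node_two_mul hD hn u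
    linarith
  obtain ⟨h1, h2⟩ := leastBelow_of_lt (p := fun n => σ.Check u D n k) hp (lt_self_add_one _) h
  refine ⟨h2.good hD, fun n hn => ?_⟩
  rcases lt_or_ge n (2 * D + 1) with h3 | h3
  · exact (leastBelow_of_lt (p := fun n => σ.Check u D n k) hp h3 hn).1
  · exact h1.trans ((lt_self_add_one _).le.trans h3)

theorem good_checkLevel {r : RatCode M} (hr : 0 ≤ r.toRat) (k : M) :
    ∃ n, σ.code.δ r k = 3 * n + k + 3 ∧ σ.Good r.toRat n k := by
  refine ⟨_, rfl, ?_⟩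
  conv in r.toRat => rw [RatCode.toRat_eq_div hr]
  exact (checkLevel_spec _ (zero_lt_add_one _) k).1

theorem pw_add_three (k : M) : pw (k + 3) = pw k / 8 := by
  rw [← two_add_one_eq_three, ← one_add_one_eq_two, ← add_assoc, ← add_assoc, pw_add_one,
    pw_add_one, pw_add_one]
  ring

/-- If all intervals of level n near x are settled, every rational r close enough to x passes the
test at n. Its radius is then at least 2^(-3n-k-3), however close r is to x, so x falls into the
neighbourhood of r. -/
theorem isContinuousAt (hσ : σ.PathSettled) {x : M → RatCode M} (hx : (str M).IsReal x)
    (hxu : (str M).RealInUnit x) : (str M).IsContinuousAt σ.code x := by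
  intro k
  obtain ⟨n, hn⟩ := exists_settled_near hσ hx k
  set j := 3 * n + k + 6 with hj
  have h63 : (6 : M) = 3 + 3 := by norm_num
  have hpj : pw j = pw (3 * n + k + 3) / 8 := by
    rw [hj, h63, ← add_assoc, pw_add_three]
  have hj0 := pw_pos j
  obtain ⟨hx0, hx1⟩ := realInUnit_iff.1 hxu j
  -- Clamping the approximation to [0,1] moves it by no more than its error.
  obtain ⟨r, hr⟩ := RatCode.exists_toRat_eq (t := max 0 (min 1 (x j).toRat)) (le_max_left _ _)
  have hr0 : 0 ≤ r.toRat := hr ▸ le_max_left _ _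
  have hr1 : r.toRat ≤ 1 := hr ▸ max_le zero_le_one (min_le_left _ _)
  have hxr : |(x j).toRat - r.toRat| ≤ pw j := by
    rw [hr, abs_le]
    rcases le_total (x j).toRat 1 with h1 | h1
    · rw [min_eq_right h1]
      rcases le_total (x j).toRat 0 with h2 | h2
      · rw [max_eq_left h2]; constructor <;> linarith
      · rw [max_eq_right h2]; constructor <;> linarith
    · rw [min_eq_left h1, max_eq_right zero_le_one]; constructor <;> linarith
  refine ⟨r, (RatCode.ratInUnit_iff r).2 ⟨hr0, hr1⟩, distLt_def.2 ⟨j, hxr.trans_lt ?_⟩⟩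
  have hcheck : σ.Check (r.pos - r.neg) (r.den + 1) n k := by
    refine check_of_settled (zero_lt_add_one _) fun s hs hsn => hn s ?_ hsn
    rw [← RatCode.toRat_eq_div hr0] at hs
    have hle : 3 * n + 6 ≤ j := by
      rw [hj, add_right_comm]; exact le_self_add
    have h1 := (abs_sub_lt_of_isReal hx hle).le
    have h2 := abs_sub_le s r.toRat (x (3 * n + 6)).toRat
    have h3 := abs_sub_le r.toRat (x j).toRat (x (3 * n + 6)).toRat
    rw [abs_sub_comm r.toRat (x j).toRat, abs_sub_comm (x j).toRat (x (3 * n + 6)).toRat] at h3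
    have hE := of_oct_pos n
    have h4 : of (oct n) * pw (3 * n + 6) = 1 / 64 := by
      rw [h63, ← add_assoc, pw_add_three, pw_add_three]
      linear_combination of_oct_mul_pw n / 64
    have h5 := mul_le_mul_of_nonneg_left (pw_strictAnti.antitone hle) hE.le
    have h6 := mul_le_mul_of_nonneg_left
      (h2.trans (add_le_add_right (h3.trans (add_le_add hxr h1)) _)) hE.le
    rw [mul_add, mul_add] at h6
    linarith
  have hle : σ.code.δ r k ≤ 3 * n + k + 3 := by
    have := (checkLevel_spec (σ := σ) (r.pos - r.neg) (zero_lt_add_one r.den) k).2 n hcheck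
    simp only [code]
    gcongr
  rw [RatCode.toRat_twoPowNeg]
  have := pw_strictAnti.antitone hle
  linarith

/-- A real approximated by the values of `tents` along `x` is the value at `x`. -/
theorem isValue_of_limit {x y : M → RatCode M} (hx : (str M).IsReal x) (hy : (str M).IsReal y)
    (h : ∀ k, ∃ N, ∀ j, N ≤ j → |(y j).toRat - σ.tents (x j).toRat| ≤ pw k) :
    (str M).IsValue σ.code x y := by
  refine isValue_iff.2 ⟨hy, fun r n hr hn => ?_⟩
  obtain ⟨ε, hε, N, hN⟩ := DistLt.eventually hx (isReal_const r) hn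
  obtain ⟨N', hN'⟩ := h (n + 1 + 1)
  obtain ⟨l, hl, hg⟩ := good_checkLevel (σ := σ) hr.1 n
  refine distLt_of_eventually (pw_pos (n + 1 + 1)) (N := max N N') fun j hj => ?_
  have h1 := hN j ((le_max_left _ _).trans hj)
  have h2 := hN' j ((le_max_right _ _).trans hj)
  rw [RatCode.toRat_twoPowNeg, hl] at h1
  have h3 := abs_tents_sub_le hg (h1.trans (by linarith))
  have h4 := abs_sub_le (y j).toRat (σ.tents (x j).toRat) (σ.tents r.toRat)
  rw [RatCode.toRat_twoPowNeg, toRat_val hr.1]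
  rw [pw_add_one (n + 1), pw_add_one] at h2 ⊢
  rw [pw_add_one] at h3
  linarith

/-- Without `QFAC` no rate of convergence can be extracted, so the value is found by cases. Either
`tents` tends to 0 along x and the value is 0, or x eventually stays in one first dead interval,
where the function is a single tent and can be computed from x directly. -/
theorem exists_isValue (hσ : σ.PathSettled) {x : M → RatCode M} (hx : (str M).IsReal x)
    (hxu : (str M).RealInUnit x) : ∃ y, (str M).IsValue σ.code x y := by
  by_cases hlim : ∀ k, ∃ N, ∀ j, N ≤ j → σ.tents (x j).toRat ≤ pw k
  · refine ⟨fun _ => ⟨0, 0, 0⟩, isValue_of_limit hx (isReal_const _) fun k => ?_⟩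
    obtain ⟨N, hN⟩ := hlim k
    refine ⟨N, fun j hj => ?_⟩
    have h0 : RatCode.toRat (⟨0, 0, 0⟩ : RatCode M) = 0 := by simp [RatCode.toRat]
    rw [h0, zero_sub, abs_neg, abs_of_nonneg (tents_nonneg _)]
    exact hN j hj
  push Not at hlim
  obtain ⟨k, hk⟩ := hlim
  obtain ⟨r, hr, hn⟩ := isContinuousAt hσ hx hxu k
  have hr0 := ((RatCode.ratInUnit_iff r).1 hr).1
  obtain ⟨ε, hε, N, hN⟩ := DistLt.eventually hx (isReal_const r) hn
  obtain ⟨n, hn, hg⟩ := good_checkLevel (σ := σ) hr0 k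
  have hN : ∀ j, N ≤ j → |(x j).toRat - r.toRat| ≤ pw (3 * n + k + 3) := fun j hj => by
    have := hN j hj
    rw [RatCode.toRat_twoPowNeg, hn] at this
    linarith
  have hpk := pw_pos k
  have hr1 : pw (k + 1) < σ.tents r.toRat := by
    obtain ⟨j, hj, h1⟩ := hk N
    have h2 := (abs_le.1 (abs_tents_sub_le hg (hN j hj))).2
    rw [pw_add_one] at h2 ⊢
    linarith
  obtain ⟨l, hl⟩ : ∃ l, σ.FirstDead r.toRat l := by
    by_contra h
    rw [tents_eq_zero h] at hr1
    exact (pw_pos _).not_gt hr1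
  set a := grid r.toRat l with ha
  set w := σ.weight (node r.toRat l) with hw
  have hE := of_oct_pos l
  have hpw := pw_pos w
  rw [tents_eq hl] at hr1
  -- A tent of level above n over a point near r has height at most 2^(-k-1), which the value at r
  -- exceeds.
  have hln : l ≤ n := by
    by_contra! h
    have h1 := node_ne_zero_of_le h.le hl.1
    have h2 := (hg r.toRat (by simp) h1).resolve_left (hl.2.2 n h)
    have h3 := pw_strictAnti.antitone (h2.trans (weight_le_of_le h.le hl.1))
    have h4 := mul_le_mul h3 (tent_le_one a l r.toRat) (tent_nonneg _ _ _) (pw_pos _).le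
    linarith
  have hEk : of (oct l) * pw (3 * n + k + 3) ≤ pw k / 8 := by
    have h1 := mul_le_mul_of_nonneg_right (of_le.2 (oct_mono hln)) (pw_pos (3 * n + k + 3)).le
    rw [pw_add_three, pw_add] at h1 ⊢
    have h2 := of_oct_mul_pw n
    have h3 : of (oct n) * (pw (3 * n) * pw k / 8) = pw k / 8 := by linear_combination pw k / 8 * h2
    linarith
  have htent : ∀ j, N ≤ j → 0 ≤ (x j).toRat ∧ σ.tents (x j).toRat = pw w * tent a l (x j).toRat := by
    intro j hj
    have h1 : pw (k + 1) < tent a l r.toRat :=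
      hr1.trans_le (mul_le_of_le_one_left (tent_nonneg _ _ _) (pw_le_one _))
    have h2 := tent_le_add a l r.toRat (x j).toRat
    have h3 := mul_le_mul_of_nonneg_left (hN j hj) hE.le
    rw [abs_sub_comm] at h2
    rw [pw_add_one] at h1
    have h4 : 0 < tent a l (x j).toRat := by linarith
    have h5 : 0 ≤ (x j).toRat ∧ grid (x j).toRat l = a := by
      by_contra h6
      exact h4.ne' (tent_eq_zero fun h0 h1 => h6 ⟨h0, h1⟩)
    obtain ⟨h6, h7⟩ := hl.congr h5.1 h5.2
    exact ⟨h5.1, by rw [tents_eq h6, h7, h5.2]⟩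
  have hmax : ∀ s t : RatOf M, |max 0 s - max 0 t| ≤ |s - t| := fun s t => by
    have := abs_max_sub_max_le_max 0 s 0 t
    rwa [sub_zero, abs_zero, max_eq_right (abs_nonneg (s - t))] at this
  have hdist : ∀ s t : RatOf M, |pw w * tent a l (max 0 s) - pw w * tent a l (max 0 t)| ≤
      2 * of (oct l) * |s - t| := fun s t => by
    rw [← mul_sub, abs_mul, abs_of_pos hpw]
    refine (mul_le_of_le_one_left (abs_nonneg _) (pw_le_one _)).trans
      ((abs_tent_sub_le _ _ _ _).trans ?_)
    exact mul_le_mul_of_nonneg_left (hmax s t) (by positivity)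
  -- The tent has slope at most 2·8^l; the shift by 3l + 3 absorbs it, so the values again converge
  -- at the rate of a real.
  refine ⟨fun i => tentCode a l w (x (3 * l + i + 3)), isValue_of_limit hx ?_ fun k' => ?_⟩
  · refine isReal_iff.2 ⟨.tentCode (.const _) (.const _) (.const _) ((isReal_iff.1 hx).1.comp₁
      (.add (.add (.const _) (.proj 0)) (.const 3))), fun i => ?_⟩
    rw [toRat_tentCode, toRat_tentCode]
    refine (hdist _ _).trans_lt ?_
    have h1 := (isReal_iff.1 hx).2 (3 * l + i + 3)
    rw [show 3 * l + i + 3 + 1 = 3 * l + (i + 1) + 3 by ring] at h1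
    have h2 := mul_lt_mul_of_pos_left h1 hE
    have h3 : of (oct l) * pw (3 * l + (i + 1) + 3) = pw (i + 1) / 8 := by
      rw [pw_add_three, pw_add]
      linear_combination pw (i + 1) / 8 * of_oct_mul_pw l
    have h4 := pw_pos (i + 1)
    linarith
  · refine ⟨max N (3 * l + k' + 3), fun j hj => ?_⟩
    obtain ⟨h1, h2⟩ := htent j ((le_max_left _ _).trans hj)
    rw [toRat_tentCode, h2, show tent a l (x j).toRat = tent a l (max 0 (x j).toRat) by
      rw [max_eq_right h1]]
    refine (hdist _ _).trans ?_
    have hj' : 3 * l + k' + 3 ≤ j := (le_max_right _ _).trans hj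
    have hle : j ≤ 3 * l + j + 3 := by
      rw [add_right_comm]; exact le_add_self
    have h3 := (abs_sub_lt_of_isReal hx hle).le
    rw [abs_sub_comm] at h3
    have h4 := mul_le_mul_of_nonneg_left (h3.trans (pw_strictAnti.antitone hj')) hE.le
    have h5 : of (oct l) * pw (3 * l + k' + 3) = pw k' / 8 := by
      rw [pw_add_three, pw_add]
      linear_combination pw k' / 8 * of_oct_mul_pw l
    have h6 := pw_pos k'
    linarith

theorem isContinuousFun_code (hσ : σ.PathSettled) : (str M).IsContinuousFun σ.code := by
  refine ⟨hasFunCode, fun r _ => ?_, fun x hx hxu =>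
    ⟨isContinuousAt hσ hx hxu, exists_isValue hσ hx hxu⟩⟩
  exact isReal_const (σ.code.val r 0)

end Scheme

end SchemeFunction

/-! ### A modulus bounds the levels at which strings first die -/

section SchemeModulus

variable {M : Type u} [PRAModel M]

open PRAModel RatOf

theorem quo_eq {x y q : M} (h1 : q * y ≤ x) (h2 : x < (q + 1) * y) : quo x y = q := by
  have hy : 0 < y := by
    by_contra! hy
    rw [le_antisymm hy (zero_le' y), mul_zero] at h2
    exact not_lt_zero x h2
  obtain ⟨h3, h4⟩ := quo_spec x hy
  exact le_antisymm (lt_add_one_iff.1 (lt_of_mul_lt_mul_right (h3.trans_lt h2) (zero_le' y)))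
    (lt_add_one_iff.1 (lt_of_mul_lt_mul_right (h1.trans_lt h4) (zero_le' y)))

theorem quo_mul_add {a y d : M} (hd : d < y) : quo (y * a + d) y = a := by
  refine quo_eq ?_ ?_
  · rw [mul_comm]; exact le_self_add
  · rw [add_mul, one_mul, mul_comm]; gcongr

theorem eq_of_two_mul_add_eq {x y i j : M} (hi : i ≤ 1) (hj : j ≤ 1)
    (h : 2 * x + i = 2 * y + j) : x = y := by
  have h1 : (1 : M) < 2 := by rw [← one_add_one_eq_two]; exact lt_self_add_one 1
  rw [← quo_mul_add (a := x) (hi.trans_lt h1), h, quo_mul_add (hj.trans_lt h1)]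

/-- Multiples of 1/(n+1) in both intervals would be distinct and at most 3·8^(-n-1) apart, which is
less than 1/(n+1). -/
theorem not_excluded (n a : M) : ¬ Excluded (n + 1) a ∨ ¬ Excluded (n + 1) (a + 2) := by
  rw [← not_and_or]
  rintro ⟨⟨z, -, h1, h2⟩, ⟨z', -, h3, h4⟩⟩
  have h5 := of_le.2 h1
  have h6 := of_le.2 h2
  have h7 := of_le.2 h3
  have h8 := of_le.2 h4
  have h9 := of_le.2 (add_one_le_iff.2 (lt_oct n))
  rw [oct_add_one] at h5 h6 h7 h8
  simp only [map_mul, map_add, map_one, map_ofNat] at h5 h6 h7 h8 h9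
  have hn := of_nonneg n
  have hE := of_oct_pos n
  have h10 : of z * (8 * of (oct n)) < of z' * (8 * of (oct n)) := by linarith
  have h11 := of_le.2 (add_one_le_iff.2 (of_lt.1 (lt_of_mul_lt_mul_right h10 (by linarith))))
  rw [map_add, map_one] at h11
  have h12 := mul_le_mul_of_nonneg_right h11 (by linarith : 0 ≤ 8 * of (oct n))
  linarith

/-- The even digits 0 and 2 carry the bit 0, and 4 and 6 carry the bit 1. Two digits per bit are
provided because at most one of them is excluded. -/
theorem exists_digit (n a : M) {i : M} (hi : i ≤ 1) :
    ∃ d < 8, 2 * quo (8 * a + d) 2 = 8 * a + d ∧ ¬ Excluded (n + 1) (8 * a + d) ∧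
      octBit (8 * a + d) = i := by
  classical
  have H : ∀ e : M, e < 4 → 2 * e < 8 ∧ 2 * quo (8 * a + 2 * e) 2 = 8 * a + 2 * e ∧
      octBit (8 * a + 2 * e) = if 4 ≤ 2 * e then 1 else 0 := fun e he => by
    have h2 : (0 : M) < 2 := by rw [← one_add_one_eq_two]; exact zero_lt_add_one 1
    have h8 : 2 * e < 8 := by
      rw [show (8 : M) = 2 * 4 by norm_num]; exact mul_lt_mul_of_pos_left he h2
    refine ⟨h8, ?_, ?_⟩
    · have h3 := quo_mul_add (a := 4 * a + e) (d := 0) h2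
      rw [add_zero, show 2 * (4 * a + e) = 8 * a + 2 * e by ring] at h3
      rw [h3]; ring
    · rw [octBit, quo_mul_add h8, add_tsub_cancel_left]
  have hlt : ∀ k l : ℕ, k < l → (k : M) < l := fun k l h => by
    rw [← of_lt, map_natCast, map_natCast]; exact_mod_cast h
  have h02 : (0 : M) < 4 := by exact_mod_cast hlt 0 4 (by norm_num)
  have h12 : (1 : M) < 4 := by exact_mod_cast hlt 1 4 (by norm_num)
  have h22 : (2 : M) < 4 := by exact_mod_cast hlt 2 4 (by norm_num)
  have h32 : (3 : M) < 4 := by exact_mod_cast hlt 3 4 (by norm_num)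
  have h46 : (4 : M) < 2 * 3 := by
    rw [show (2 * 3 : M) = 6 by norm_num]; exact_mod_cast hlt 4 6 (by norm_num)
  obtain ⟨a0, b0, c0⟩ := H 0 h02
  obtain ⟨a1, b1, c1⟩ := H 1 h12
  obtain ⟨a2, b2, c2⟩ := H 2 h22
  obtain ⟨a3, b3, c3⟩ := H 3 h32
  rw [if_neg (not_le.2 (by rwa [mul_zero]))] at c0
  rw [if_neg (not_le.2 (by rwa [mul_one]))] at c1
  rw [if_pos (by norm_num)] at c2
  rw [if_pos h46.le] at c3
  rcases le_one_iff.1 hi with rfl | rfl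
  · rcases not_excluded n (8 * a + 2 * 0) with h | h
    · exact ⟨_, a0, b0, h, c0⟩
    · exact ⟨_, a1, b1, by rwa [show 8 * a + 2 * 1 = 8 * a + 2 * 0 + 2 by ring], c1⟩
  · rcases not_excluded n (8 * a + 2 * 2) with h | h
    · exact ⟨_, a2, b2, h, c2⟩
    · exact ⟨_, a3, b3, by rwa [show 8 * a + 2 * 3 = 8 * a + 2 * 2 + 2 by ring], c3⟩

/-- Each string is the string of some interval. -/
theorem exists_node_eq {c : M → M} (hc : IsFun (.full M) fun v : Fin 1 → M => c (v 0))
    (h0 : c 0 = 1) (hs : ∀ n, ∃ i ≤ 1, c (n + 1) = 2 * c n + i) (n : M) :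
    ∃ t, node t n = c n := by
  suffices h : ∃ a < oct n, nodeFun n a (oct n) = c n by
    obtain ⟨a, -, ha⟩ := h
    exact ⟨_, (node_div a (oct_pos n) n).trans ha⟩
  refine induct_dec (Φ := .full M) (p := fun n : M => ∃ a < oct n, nodeFun n a (oct n) = c n)
    ?_ ?_ (fun n ih => ?_) n
  · refine DecP.bex (p := fun (v : Fin 1 → M) a => nodeFun (v 0) a (oct (v 0)) = c (v 0)) ?_
      (.oct (.proj 0))
    exact DecP.eq (.nodeFun (.proj 1) (.proj 0) (.oct (.proj 1))) (IsFun.comp₁ hc (.proj 1))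
  · refine ⟨0, oct_pos 0, ?_⟩
    rw [nodeFun_zero, if_pos (oct_pos 0), h0]
  · obtain ⟨a, ha, han⟩ := ih
    obtain ⟨i, hi, hci⟩ := hs n
    obtain ⟨d, hd, h1, h2, h3⟩ := exists_digit n a hi
    have hE := oct_pos n
    refine ⟨8 * a + d, ?_, ?_⟩
    · rw [oct_add_one]
      calc 8 * a + d < 8 * a + 8 := by gcongr
        _ = 8 * (a + 1) := by ring
        _ ≤ 8 * oct n := by gcongr; exact add_one_le_iff.2 ha
    · have ht : ∀ x y : M, 0 ≤ of x / of y := fun x y => div_nonneg (of_nonneg _) (of_nonneg _)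
      have h4 : node (of (8 * a + d) / of (oct (n + 1))) n = c n := by
        rw [← han, ← node_div _ hE]
        refine node_congr (ht _ _) (ht _ _) ?_
        rw [grid_eq_quo (ht _ _), grid_of_div_oct, grid_of_div_oct, quo_mul_add hd]
      rw [← node_div _ (oct_pos _), node_add_one (ht _ _), h4, grid_of_div_oct, childCode,
        if_pos ⟨(lg_path hc h0 hs n).1.ne', h1, h2⟩, h3, hci]

/-- The code 2m + i determines m, so the ancestors of an interval carrying a string carry its
prefixes. -/
theorem node_eq_of_le {c : M → M} (hc : IsFun (.full M) fun v : Fin 1 → M => c (v 0))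
    (h0 : c 0 = 1) (hs : ∀ n, ∃ i ≤ 1, c (n + 1) = 2 * c n + i) {t : RatOf M} {i j : M}
    (hij : i ≤ j) (h : node t j = c j) : node t i = c i := by
  revert h
  refine induct_le (Φ := .full M) (p := fun j => node t j = c j → node t i = c i)
    ((DecP.eq (isFun_node t) hc).imp (.const _)) id (fun j _ ih h => ih ?_) hij
  obtain ⟨e, he, hce⟩ := hs j
  have h1 := (node_add_one_ne_zero (h.trans_ne (lg_path hc h0 hs (j + 1)).1.ne')).2.2.2
  exact eq_of_two_mul_add_eq (octBit_le_one _) he ((h1.symm.trans h).trans hce)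

namespace Scheme

variable {Φ : FunClass M} {σ : Scheme Φ}

theorem isValue_const {r : RatCode M} (hr : 0 ≤ r.toRat ∧ r.toRat ≤ 1) {y : M → RatCode M}
    (h : (str M).IsValue σ.code (fun _ => r) y) (k : M) :
    ∃ N, ∀ j, N ≤ j → |(y j).toRat - σ.tents r.toRat| ≤ pw k := by
  obtain ⟨hy, H⟩ := isValue_iff.1 h
  have h1 := H r k hr (distLt_of_eventually (pw_pos (σ.code.δ r k)) (N := 0) fun j _ => by
    rw [RatCode.toRat_twoPowNeg, sub_self, sub_self, abs_zero])
  obtain ⟨ε, hε, N, hN⟩ := DistLt.eventually hy (isReal_const (σ.code.val r 0)) h1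
  refine ⟨N, fun j hj => ?_⟩
  have h2 := hN j hj
  rw [toRat_val hr.1, RatCode.toRat_twoPowNeg] at h2
  linarith

/-- A modulus of uniform continuity bounds the levels of the first dead strings. -/
theorem FirstDead.le_modulus (hσ : σ.PathSettled) {h : M → M} (hh : (str M).IsModulus σ.code h)
    {s : RatOf M} {l : M} (hl : σ.FirstDead s l) : l ≤ h (σ.weight (node s l) + 1) := by
  by_contra! hlt
  have hs := nonneg_of_node_ne_zero hl.1
  have hE := of_oct_pos l
  set w := σ.weight (node s l)
  have hs1 : s < 1 := by
    have h1 := lt_grid_add_one s 0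
    rw [(node_zero_ne_zero (node_ne_zero_of_le (zero_le' l) hl.1)).1] at h1
    simpa using h1
  set a := grid s l with ha
  have ha0 := of_nonneg a
  have haE : of a + 1 ≤ of (oct l) := by
    rw [← map_one of, ← map_add, of_le, add_one_le_iff, ← of_lt]
    exact (grid_le hs l).trans_lt (mul_lt_of_lt_one_right hE hs1)
  -- Used for b = 0, the foot of the tent with value 0, and for b = 1/2, its peak with value 2^(-w).
  -- The two points are 2^(-3l-1) apart.
  have key : ∀ b : RatOf M, 0 ≤ b → b < 1 → ∃ r : RatCode M, r.toRat = (of a + b) / of (oct l) ∧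
      (0 ≤ r.toRat ∧ r.toRat ≤ 1) ∧ σ.tents r.toRat = pw w * max 0 (1 - |2 * b - 1|) := by
    intro b hb hb1
    have hr0 : 0 ≤ (of a + b) / of (oct l) := div_nonneg (by linarith) hE.le
    obtain ⟨r, hr⟩ := RatCode.exists_toRat_eq hr0
    have hg : grid r.toRat l = a := by
      rw [hr, grid, mul_div_cancel₀ _ hE.ne']
      exact fl_eq (by linarith) (by linarith)
    obtain ⟨h1, h2⟩ := hl.congr (hr ▸ hr0) hg
    refine ⟨r, hr, ⟨hr ▸ hr0, ?_⟩, ?_⟩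
    · rw [hr, div_le_one hE]; linarith
    · rw [tents_eq h1, h2, hg, tent, hr, mul_div_cancel₀ _ hE.ne']
      congr 4; ring
  have hu : ∀ r : RatCode M, 0 ≤ r.toRat ∧ r.toRat ≤ 1 → (str M).RealInUnit fun _ => r :=
    fun r hr => realInUnit_iff.2 fun k => by
      have := pw_pos k
      constructor <;> linarith
  obtain ⟨r, hr, hru, hrt⟩ := key 0 le_rfl zero_lt_one
  obtain ⟨r', hr', hru', hrt'⟩ := key (1 / 2) (by norm_num) (by norm_num)
  obtain ⟨y, hy⟩ := exists_isValue hσ (isReal_const r) (hu r hru)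
  obtain ⟨y', hy'⟩ := exists_isValue hσ (isReal_const r') (hu r' hru')
  have hle : h (w + 1) < 3 * l + 1 := lt_add_one_iff.2 (hlt.le.trans
    (le_mul_of_one_le_left (zero_le' l) (by rw [← two_add_one_eq_three]; exact le_add_self)))
  have hd := hh.2 (w + 1) _ _ _ _ (isReal_const r) (hu r hru) (isReal_const r') (hu r' hru') hy hy'
    (distLt_of_eventually (sub_pos.2 (pw_strictAnti hle)) (N := 0) fun j _ => by
      rw [RatCode.toRat_twoPowNeg, sub_sub_cancel, hr, hr', pw_add_one, ← sub_div]
      have e : (of a + 0 - (of a + 1 / 2)) / of (oct l) = - (pw (3 * l) / 2) := by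
        rw [div_eq_iff hE.ne']
        linear_combination (1 / 2) * of_oct_mul_pw l
      rw [e, abs_neg, abs_of_pos (half_pos (pw_pos _))])
  obtain ⟨ε, hε, N, hN⟩ := DistLt.eventually hy.1 hy'.1 hd
  -- Two errors of 2^(-w-3) cannot close the gap between the true difference 2^(-w) and the bound
  -- 2^(-w-1) given by the modulus.
  obtain ⟨N1, hN1⟩ := isValue_const hru hy (w + 3)
  obtain ⟨N2, hN2⟩ := isValue_const hru' hy' (w + 3)
  have h1 := hN (max N (max N1 N2)) (le_max_left _ _)
  have h2 := hN1 (max N (max N1 N2)) ((le_max_left _ _).trans (le_max_right _ _))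
  have h3 := hN2 (max N (max N1 N2)) ((le_max_right _ _).trans (le_max_right _ _))
  have e1 : max 0 (1 - |2 * 0 - 1|) = (0 : RatOf M) := by norm_num
  have e2 : max 0 (1 - |2 * (1 / 2) - 1|) = (1 : RatOf M) := by norm_num
  rw [hrt, e1] at h2
  rw [hrt', e2] at h3
  rw [RatCode.toRat_twoPowNeg, pw_add_one] at h1
  rw [pw_add_three] at h2 h3
  have hpw := pw_pos w
  rw [abs_le] at h1 h2 h3
  linarith

theorem le_modulus_of_path (hσ : σ.PathSettled) {h : M → M} (hh : (str M).IsModulus σ.code h)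
    {c : M → M} (hc : IsFun (.full M) fun v : Fin 1 → M => c (v 0)) (h0 : c 0 = 1)
    (hs : ∀ n, ∃ i ≤ 1, c (n + 1) = 2 * c n + i) {l : M} (hl : σ.dead (c l))
    (hl' : ∀ j < l, ¬ σ.dead (c j)) : l ≤ h (σ.weight (c l) + 1) := by
  obtain ⟨t, ht⟩ := exists_node_eq hc h0 hs l
  rw [← ht] at hl ⊢
  refine FirstDead.le_modulus hσ hh ⟨ht.trans_ne (lg_path hc h0 hs l).1.ne', hl, fun j hj => ?_⟩
  rw [node_eq_of_le hc h0 hs hj.le ht]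
  exact hl' j hj

end Scheme

end SchemeModulus

/-! ### Uniform continuity implies `WKL` and `QFAC` -/

section Reversal

variable {M : Type u} [PRAModel M]

open PRAModel

theorem exists_quo_two_mul (x : M) {y : M} (hy : 0 < y) :
    ∃ i ≤ 1, quo (2 * x) y = 2 * quo x y + i := by
  obtain ⟨h1, h2⟩ := quo_spec x hy
  set q := quo x y
  have h3 : 2 * q * y ≤ 2 * x := by rw [mul_assoc]; gcongr
  rcases lt_or_ge (2 * x) ((2 * q + 1) * y) with h | h
  · exact ⟨0, zero_le' 1, by rw [add_zero]; exact quo_eq h3 h⟩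
  · refine ⟨1, le_rfl, quo_eq h ?_⟩
    rw [show (2 * q + 1 + 1) * y = 2 * ((q + 1) * y) by ring]
    exact mul_lt_mul_of_pos_left h2 (by rw [← one_add_one_eq_two]; exact zero_lt_add_one 1)

theorem isFun_of_mem {T : M → M} (hT : T ∈ (str M).Fun₁) :
    IsFun (.full M) fun v : Fin 1 → M => T (v 0) := hT

/-- The scheme of the strings outside `T`. -/
noncomputable def treeScheme {T : M → M} (hT : (str M).IsBinaryTree T) : Scheme (.full M) where
  dead m := T m ≠ 1
  weight _ := 0
  dec_dead := (DecP.eq (isFun_of_mem hT.1) (.const 1)).not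
  isFun_weight := .const 0
  dead_snoc hm hi h h' := h (hT.2.2 _ _ hm (le_one_iff.1 hi) (by rw [snoc_eq]; exact h'))
  weight_snoc _ _ := le_rfl

/-- The weight is 0, so a path of the model that is never settled stays in T forever; its successive
bits then form a path through T. -/
theorem pathSettled_treeScheme {T : M → M} (hT : (str M).IsBinaryTree T)
    (h : ¬ ∃ P, (str M).IsPath T P) : (treeScheme hT).PathSettled := by
  intro c hc h0 hs k
  by_contra! hset
  have halive : ∀ n, T (c n) = 1 := fun n => by
    by_contra hn
    exact hset n (.inl hn)
  have hstep : ∀ n, c (n + 1) - 2 * c n ≤ 1 ∧ c (n + 1) = 2 * c n + (c (n + 1) - 2 * c n) := fun n => by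
    obtain ⟨i, hi, h⟩ := hs n
    rw [h, add_tsub_cancel_left]
    exact ⟨hi, rfl⟩
  refine h ⟨fun n => c (n + 1) - 2 * c n, ?_, fun n => le_one_iff.1 (hstep n).1, c, hc, h0,
    fun n => ?_, halive⟩
  · exact IsFun.tsub (Φ := .full M) (IsFun.comp₁ hc (.add (.proj 0) (.const 1))) (.mul (.const 2) hc)
  · rw [succ_eq, snoc_eq]
    exact (hstep n).2

/-- If T has no path, a modulus h forces every branch to leave T by level h(1). An infinite tree
contains a longer string m, and the branch through m leaves T only after m. -/
theorem wkl_of_uniformContinuity (hU : (str M).UniformContinuityOnUnitInterval) : (str M).WKL := by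
  intro T hT hinf
  by_contra hno
  have hσ := pathSettled_treeScheme hT hno
  obtain ⟨h, hh⟩ := hU _ (Scheme.isContinuousFun_code hσ)
  obtain ⟨m, hm, hTm⟩ : ∃ m, pow2 (h (0 + 1) + 1) < m ∧ T m = 1 := hinf _
  have hm0 := (pow2_pos _).trans hm
  obtain ⟨hl1, hl2⟩ := lg_spec hm0
  have hlt : h (0 + 1) < lg m := by
    have h1 := pow2_strictMono.lt_iff_lt.1 (hm.trans hl2)
    exact (lt_self_add_one _).trans_le (lt_add_one_iff.1 h1)
  have hp := pow2_pos (lg m)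
  -- The prefixes of m, followed by m extended with zeros.
  let c : M → M := fun i => quo (m * pow2 i) (pow2 (lg m))
  have hc : IsFun (.full M) fun v : Fin 1 → M => c (v 0) :=
    .quo (.mul (.const m) (.pow2 (.proj 0))) (.const _)
  have h0 : c 0 = 1 := by
    refine quo_eq ?_ ?_
    · rwa [pow2_zero, one_mul, mul_one]
    · rwa [pow2_zero, mul_one, one_add_one_eq_two, ← pow2_add_one]
  have hs : ∀ n, ∃ i ≤ 1, c (n + 1) = 2 * c n + i := fun n => by
    simp only [c]
    rw [pow2_add_one, mul_left_comm]
    exact exists_quo_two_mul _ hp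
  have hcl : c (lg m) = m := by
    refine quo_eq le_rfl ?_
    rw [add_mul]
    exact lt_add_of_pos_right _ (by rwa [one_mul])
  obtain ⟨n, hn⟩ := hσ c hc h0 hs 0
  have hn : T (c n) ≠ 1 := hn.resolve_right fun h => (zero_lt_add_one (0 : M)).not_ge h
  have hd : DecP (.full M) fun v : Fin 1 → M => T (c (v 0)) ≠ 1 :=
    (DecP.eq (IsFun.comp₁ (isFun_of_mem hT.1) hc) (.const 1)).not
  obtain ⟨l, hl, hl'⟩ := exists_least (p := fun l => T (c l) ≠ 1) hd ⟨n, hn⟩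
  have hle := Scheme.le_modulus_of_path hσ hh hc h0 hs hl hl'
  refine induct_le (p := fun l => T (c l) ≠ 1) hd hl (fun j _ hj => ?_) (hle.trans hlt.le)
    (by rw [hcl]; exact hTm)
  obtain ⟨i, hi, e⟩ := hs j
  rw [e]
  exact (treeScheme hT).dead_snoc (lg_path hc h0 hs j).1 hi hj

/-- The code of the string `m` without its leading `1`. -/
noncomputable def rest (m : M) : M := m - pow2 (lg m)

theorem IsFun.rest {Φ : FunClass M} {n : ℕ} {f : (Fin n → M) → M} (hf : IsFun Φ f) :
    IsFun Φ fun v => rest (f v) :=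
  hf.tsub hf.lg.pow2

theorem rest_snoc {m i : M} (hm : 0 < m) (hi : i ≤ 1) : rest (2 * m + i) = 2 * rest m + i := by
  obtain ⟨r, hr⟩ := exists_add_of_le (lg_spec hm).1
  have h : rest m = r := by
    rw [rest]; nth_rw 1 [hr]; rw [add_tsub_cancel_left]
  rw [h, rest, lg_two_mul_add hm hi, pow2_add_one]
  nth_rw 1 [hr]
  rw [mul_add, add_assoc, add_tsub_cancel_left]

/-- The number of zeros before the first one in the string `m`. -/
noncomputable def firstOne (m : M) : M := lg m - (lg (rest m) + 1)

theorem IsFun.firstOne {Φ : FunClass M} {n : ℕ} {f : (Fin n → M) → M} (hf : IsFun Φ f) :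
    IsFun Φ fun v => firstOne (f v) :=
  hf.lg.tsub (.add hf.rest.lg (.const 1))

theorem snoc_of_rest_ne_zero {m i : M} (hm : 0 < m) (hi : i ≤ 1) (h : rest m ≠ 0) :
    rest (2 * m + i) ≠ 0 ∧ lg (rest (2 * m + i)) = lg (rest m) + 1 ∧
      firstOne (2 * m + i) = firstOne m := by
  have h1 := pos_iff_ne_zero.2 h
  have h2 := lg_two_mul_add h1 hi
  rw [← rest_snoc hm hi] at h2
  refine ⟨?_, h2, ?_⟩
  · rw [rest_snoc hm hi]
    refine (h1.trans_le (le_trans ?_ le_self_add)).ne'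
    rw [two_mul]; exact le_self_add
  · rw [firstOne, firstOne, h2, lg_two_mul_add hm hi, add_tsub_add_eq_tsub_right]

open Classical in
/-- Strings `0ⁿ1τ` die once `τ` has the length of a witness for `n`. -/
noncomputable def searchScheme {Φ : FunClass M} {θ : M → M → Prop}
    (hθ : DecP Φ fun v : Fin 2 → M => θ (v 0) (v 1)) : Scheme Φ where
  dead m := rest m ≠ 0 ∧ ∃ j < lg (rest m) + 1, θ (firstOne m) j
  weight m := if rest m = 0 then lg m else firstOne m
  dec_dead := by
    refine (DecP.eq (.rest (.proj 0)) (.const 0)).not.and ?_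
    refine DecP.bex (p := fun (v : Fin 1 → M) j => θ (firstOne (v 0)) j) ?_
      (.add (.lg (.rest (.proj 0))) (.const 1))
    exact hθ.comp₂ (.firstOne (.proj 1)) (.proj 0)
  isFun_weight := (DecP.eq (.rest (.proj 0)) (.const 0)).ite (.lg (.proj 0)) (.firstOne (.proj 0))
  dead_snoc := by
    rintro m i hm hi ⟨h, j, hj, hθj⟩
    obtain ⟨h1, h2, h3⟩ := snoc_of_rest_ne_zero hm hi h
    exact ⟨h1, j, by rw [h2]; exact hj.trans (lt_self_add_one _), by rwa [h3]⟩
  weight_snoc := by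
    intro m i hm hi
    by_cases h : rest m = 0
    · rw [if_pos h, rest_snoc hm hi, h, mul_zero, zero_add]
      rcases le_one_iff.1 hi with rfl | rfl
      · rw [if_pos rfl, lg_two_mul_add hm hi]
        exact le_self_add
      · have h1 : lg (1 : M) = 0 := lg_eq (by simp) (by
          rw [pow2_add_one, pow2_zero, mul_one, ← one_add_one_eq_two]; exact lt_self_add_one 1)
        rw [if_neg one_ne_zero, firstOne, rest_snoc hm hi, h, mul_zero, zero_add, h1,
          lg_two_mul_add hm hi, zero_add, add_tsub_cancel_right]
    · obtain ⟨h1, h2, h3⟩ := snoc_of_rest_ne_zero hm hi h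
      rw [if_neg h, if_neg h1, h3]

variable {Φ : FunClass M} {θ : M → M → Prop}

/-- The zero path is settled by its growing weight. After the first one, at position n, a path dies
once its remaining length reaches a witness for n. -/
theorem pathSettled_searchScheme (hθ : DecP Φ fun v : Fin 2 → M => θ (v 0) (v 1))
    (h : ∀ n, ∃ j, θ n j) : (searchScheme hθ).PathSettled := by
  intro c hc h0 hs k
  have hpath := lg_path hc h0 hs
  by_cases hr : ∀ n, rest (c n) = 0
  · refine ⟨k + 1, .inr ?_⟩
    simp only [searchScheme]
    rw [if_pos (hr _), (hpath _).2]
  · push Not at hr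
    obtain ⟨a, ha⟩ := hr
    obtain ⟨j, hj⟩ := h (firstOne (c a))
    have H : ∀ d, rest (c (a + d)) ≠ 0 ∧ lg (rest (c (a + d))) = lg (rest (c a)) + d ∧
        firstOne (c (a + d)) = firstOne (c a) := by
      intro d
      have hf : IsFun (.full M) fun v : Fin 1 → M => c (a + v 0) :=
        IsFun.comp₁ hc (.add (.const a) (.proj 0))
      refine induct_dec (p := fun d => rest (c (a + d)) ≠ 0 ∧
        lg (rest (c (a + d))) = lg (rest (c a)) + d ∧ firstOne (c (a + d)) = firstOne (c a))
        ((DecP.eq hf.rest (.const 0)).not.and ((DecP.eq hf.rest.lg (.add (.const _) (.proj 0))).and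
          (DecP.eq hf.firstOne (.const _)))) ?_ (fun d ih => ?_) d
      · rw [add_zero]
        exact ⟨ha, (add_zero _).symm, rfl⟩
      · obtain ⟨i, hi, e⟩ := hs (a + d)
        obtain ⟨h1, h2, h3⟩ := snoc_of_rest_ne_zero (hpath _).1 hi ih.1
        rw [← add_assoc, e]
        exact ⟨h1, by rw [h2, ih.2.1, add_assoc], h3.trans ih.2.2⟩
    obtain ⟨h1, h2, h3⟩ := H j
    refine ⟨a + j, .inl ⟨h1, j, ?_, by rwa [h3]⟩⟩
    rw [h2]
    exact lt_add_one_iff.2 le_add_self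

/-- The path 0ⁿ1000… has weight n after its one and first dies at a level n + 1 + d such that some j
≤ d is a witness. A modulus bounds that level, hence j. -/
theorem exists_le_modulus (hθ : DecP Φ fun v : Fin 2 → M => θ (v 0) (v 1))
    (H : ∀ n, ∃ j, θ n j) {h : M → M} (hh : (str M).IsModulus (searchScheme hθ).code h) (n : M) :
    ∃ j ≤ h (n + 1), θ n j := by
  have hσ := pathSettled_searchScheme hθ H
  have hp := pow2_pos (n + 1)
  -- The first i bits of 0ⁿ1000…, read as a binary number; adding 2^i supplies the leading one of
  -- the code.
  let q : M → M := fun i => quo (pow2 i) (pow2 (n + 1))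
  let c : M → M := fun i => pow2 i + q i
  have hc : IsFun (.full M) fun v : Fin 1 → M => c (v 0) :=
    .add (.pow2 (.proj 0)) (.quo (.pow2 (.proj 0)) (.const _))
  have hq : ∀ i ≤ n, q i = 0 := fun i hi => quo_eq (by rw [zero_mul]; exact zero_le' _)
    (by rw [zero_add, one_mul]; exact pow2_strictMono (lt_add_one_iff.2 hi))
  have hq' : ∀ d, q (n + 1 + d) = pow2 d := fun d => quo_eq (by rw [pow2_add (n + 1), mul_comm])
    (by rw [pow2_add (n + 1), mul_comm, add_mul]; exact lt_add_of_pos_right _ (by rwa [one_mul]))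
  have h0 : c 0 = 1 := by
    show pow2 0 + q 0 = 1
    rw [hq 0 (zero_le' n), pow2_zero, add_zero]
  have hs : ∀ n, ∃ i ≤ 1, c (n + 1) = 2 * c n + i := fun i => by
    obtain ⟨b, hb, e⟩ := exists_quo_two_mul (pow2 i) hp
    refine ⟨b, hb, ?_⟩
    simp only [c, q]
    rw [pow2_add_one, e]
    ring
  have hrest : ∀ i, rest (c i) = q i := fun i => by
    rw [rest, (lg_path hc h0 hs i).2, add_tsub_cancel_left]
  have hone : ∀ d, firstOne (c (n + 1 + d)) = n ∧ lg (rest (c (n + 1 + d))) = d := fun d => by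
    have hd : lg (pow2 d) = d := lg_eq le_rfl (pow2_strictMono (lt_self_add_one d))
    rw [firstOne, hrest, (lg_path hc h0 hs _).2, hq', hd, add_assoc, add_comm 1 d,
      add_tsub_cancel_right]
    exact ⟨rfl, rfl⟩
  have hdead : ∀ d, (searchScheme hθ).dead (c (n + 1 + d)) ↔ ∃ j < d + 1, θ n j := fun d => by
    obtain ⟨h1, h2⟩ := hone d
    simp only [searchScheme]
    rw [h1, h2, hrest, hq']
    exact and_iff_right (pow2_pos d).ne'
  obtain ⟨e, he⟩ := H n
  obtain ⟨l, hl, hl'⟩ := exists_least (p := fun l => (searchScheme hθ).dead (c l))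
    ((searchScheme hθ).dec_dead.toFull.comp₁ hc)
    ⟨n + 1 + e, (hdead e).2 ⟨e, lt_self_add_one e, he⟩⟩
  have hnl : n + 1 ≤ l := by
    by_contra! hlt
    exact hl.1 (by rw [hrest, hq l (lt_add_one_iff.1 hlt)])
  obtain ⟨d, rfl⟩ := exists_add_of_le hnl
  have hle := Scheme.le_modulus_of_path hσ hh hc h0 hs hl hl'
  have hw : (searchScheme hθ).weight (c (n + 1 + d)) = n := by
    simp only [searchScheme]
    rw [if_neg hl.1, (hone d).1]
  rw [hw] at hle
  obtain ⟨j, hj, hθj⟩ := (hdead d).1 hl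
  exact ⟨j, (lt_add_one_iff.1 hj).trans (le_add_self.trans hle), hθj⟩

/-- A modulus of the search scheme bounds a witness, and bounded search below it is a function of
the model. -/
theorem qfac_of_uniformContinuity (hU : (str M).UniformContinuityOnUnitInterval) :
    (str M).QFAC := by
  intro φ hφ
  have hθ : DecP (.full M) fun v : Fin 2 → M => φ.Holds ![v 0, v 1] :=
    .of_qfDef ⟨φ, fun v => by
      have : ![v 0, v 1] = v := funext fun i => by fin_cases i <;> rfl
      simp only [this]⟩
  obtain ⟨h, hh⟩ := hU _ (Scheme.isContinuousFun_code
    (pathSettled_searchScheme (θ := fun x y => φ.Holds ![x, y]) hθ hφ))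
  refine ⟨fun n => leastBelow (fun j => φ.Holds ![n, j]) (h (n + 1) + 1), ?_, fun n => ?_⟩
  · refine IsFun.leastBelow (Φ := .full M) (p := fun (v : Fin 1 → M) j => φ.Holds ![v 0, j])
      ?_ (.add (IsFun.comp₁ hh.1 (.add (.proj 0) (.const 1))) (.const 1))
    exact DecP.comp₂ (p := fun x y => φ.Holds ![x, y]) hθ (.proj 1) (.proj 0)
  · obtain ⟨j, hj, hφj⟩ := exists_le_modulus (θ := fun x y => φ.Holds ![x, y]) hθ hφ hh n
    refine (leastBelow_of_lt (Φ := .full M) (p := fun j => φ.Holds ![n, j]) ?_ (lt_add_one_iff.2 hj) hφj).2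
    exact DecP.comp₂ (p := fun x y => φ.Holds ![x, y]) hθ (.const n) (.proj 0)

theorem uniformContinuity_iff :
    (str M).UniformContinuityOnUnitInterval ↔ (str M).WKL ∧ (str M).QFAC :=
  ⟨fun h => ⟨wkl_of_uniformContinuity h, qfac_of_uniformContinuity h⟩,
    fun h => uniformContinuity_of_wkl_qfac h.1 h.2⟩

/-- For a total relation there is a presented continuous function whose moduli bound witnesses. -/
theorem exists_funCode_of_total {χ : M → M → M}
    (hχ : IsFun Φ fun v : Fin 2 → M => χ (v 0) (v 1)) (H : ∀ n, ∃ j, χ n j = (str M).zero) :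
    ∃ P : FunCode M, (IsRatFun Φ (fun v : Fin 4 → M => P.val ⟨v 0, v 1, v 2⟩ (v 3)) ∧
        IsFun Φ fun v : Fin 4 → M => P.δ ⟨v 0, v 1, v 2⟩ (v 3)) ∧
      (str M).IsContinuousFun P ∧ ∀ h, (str M).IsModulus P h →
        ∀ n, ∃ j, ¬ (str M).lt (h ((str M).succ n)) j ∧ χ n j = (str M).zero := by
  have hθ : DecP Φ fun v : Fin 2 → M => χ (v 0) (v 1) = (str M).zero := .eq hχ (.const _)
  refine ⟨_, Scheme.isFun_code (σ := searchScheme (θ := fun n j => χ n j = (str M).zero) hθ),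
    Scheme.isContinuousFun_code (pathSettled_searchScheme hθ H), fun h hh n => ?_⟩
  obtain ⟨j, hj, hθj⟩ := exists_le_modulus (θ := fun n j => χ n j = (str M).zero) hθ H hh n
  exact ⟨j, by rw [succ_eq]; exact not_lt.2 hj, hθj⟩

end Reversal

/-! ### ω-models: the separation from `WKL`, and computable functions -/

section OmegaModels

open PRA2Structure

/-- Closure of a class of functions on the natural numbers under the schemes of
primitive recursion. -/
structure IsPrimClosed (F : (n : ℕ) → Set ((Fin n → ℕ) → ℕ)) : Prop where
  const : ∀ c : ℕ, (fun _ : Fin 0 → ℕ => c) ∈ F 0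
  succ : (fun v : Fin 1 → ℕ => v 0 + 1) ∈ F 1
  proj : ∀ {n : ℕ} (i : Fin n), (fun v : Fin n → ℕ => v i) ∈ F n
  comp : ∀ {n k : ℕ} (f : (Fin k → ℕ) → ℕ) (g : Fin k → (Fin n → ℕ) → ℕ),
    f ∈ F k → (∀ i, g i ∈ F n) → (fun v => f fun i => g i v) ∈ F n
  prec : ∀ {n : ℕ} (f : (Fin n → ℕ) → ℕ) (g : (Fin (n + 2) → ℕ) → ℕ), f ∈ F n → g ∈ F (n + 2) →
    (fun v : Fin (n + 1) → ℕ => (Nat.rec (f (Fin.tail v))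
      (fun k y => g (Fin.cons k (Fin.cons y (Fin.tail v)))) (v 0) : ℕ)) ∈ F (n + 1)

namespace IsPrimClosed

variable {F : (n : ℕ) → Set ((Fin n → ℕ) → ℕ)}

theorem eval_mem (hF : IsPrimClosed F) {n : ℕ} (c : PRCode n) : c.eval ∈ F n := by
  induction c with
  | zero => exact hF.const 0
  | succ => exact hF.succ
  | proj i => exact hF.proj i
  | comp f g ihf ihg => exact hF.comp f.eval (fun i => (g i).eval) ihf ihg
  | prec f g ihf ihg => exact hF.prec f.eval g.eval ihf ihg

theorem exists_prec (hF : IsPrimClosed F) {n : ℕ} (f : (Fin n → ℕ) → ℕ) (g : (Fin (n + 2) → ℕ) → ℕ)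
    (hf : f ∈ F n) (hg : g ∈ F (n + 2)) : ∃ h ∈ F (n + 1), ∀ v : Fin n → ℕ,
      h (Fin.cons 0 v) = f v ∧
      ∀ m, h (Fin.cons (m + 1) v) = g (Fin.cons m (Fin.cons (h (Fin.cons m v)) v)) :=
  ⟨_, hF.prec f g hf hg, fun _ => ⟨rfl, fun _ => rfl⟩⟩

theorem isModel (hF : IsPrimClosed F) : (standard F).IsModel where
  zero_ne_succ x := (Nat.succ_ne_zero x).symm
  succ_inj _ _ h := Nat.succ.inj h
  not_lt_zero x := Nat.not_lt_zero x
  lt_succ_iff _ _ := Nat.lt_succ_iff_lt_or_eq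
  sym_proj _ _ := rfl
  sym_comp _ _ _ := rfl
  sym_prec_zero _ _ _ := rfl
  sym_prec_succ _ _ _ _ := rfl
  induction _ h0 hs x := Nat.rec h0 (fun x hx => hs x hx) x
  sym_mem c := hF.eval_mem c
  const_mem := hF.const
  comp_mem := hF.comp
  prec_mem := hF.exists_prec

end IsPrimClosed

theorem isPrimClosed_univ : IsPrimClosed fun _ => Set.univ :=
  ⟨fun _ => trivial, trivial, fun _ => trivial, fun _ _ _ _ => trivial, fun _ _ _ _ => trivial⟩

theorem isPrimClosed_primrec : IsPrimClosed fun _ => {f | Primrec f} where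
  const c := Primrec.const c
  succ := Primrec.succ.comp (Primrec.fin_app.comp .id (.const 0))
  proj i := Primrec.fin_app.comp .id (.const i)
  comp f g hf hg := Primrec.comp hf (Primrec.fin_curry.2 (Primrec.fin_curry₁.2 hg).swap)
  prec {n} f g hf hg := by
    have happ : ∀ {n : ℕ} (i : Fin n), Primrec fun v : Fin n → ℕ => v i :=
      fun i => Primrec.fin_app.comp .id (.const i)
    have htail : Primrec fun v : Fin (n + 1) → ℕ => Fin.tail v :=
      Primrec.fin_curry.2 (Primrec₂.swap (Primrec.fin_curry₁.2 fun i => happ i.succ))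
    refine Primrec.nat_rec' (happ 0) (Primrec.comp hf htail)
      (h := fun v p => g (Fin.cons p.1 (Fin.cons p.2 (Fin.tail v)))) (Primrec.comp hg ?_)
    refine Primrec.fin_curry.2 (Primrec₂.swap (Primrec.fin_curry₁.2 fun i => ?_))
    refine Fin.cases ?_ (fun i => Fin.cases ?_ (fun i => ?_) i) i
    · exact Primrec.fst.comp .snd
    · exact Primrec.snd.comp .snd
    · exact (happ i.succ).comp .fst

/-- The functions bounded by a level of the Ackermann function. -/
def ackBounded (n : ℕ) : Set ((Fin n → ℕ) → ℕ) :=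
  {f | ∃ m, ∀ v, f v < ack m (Finset.univ.sup v)}

theorem le_sup_univ {n : ℕ} (v : Fin n → ℕ) (i : Fin n) : v i ≤ Finset.univ.sup v :=
  Finset.le_sup (f := v) (Finset.mem_univ i)

/-- A recursion whose data are bounded at level m is bounded at level m + 1 in the sum of the
arguments, because ack (m+1) (k+1) = ack m (ack (m+1) k) absorbs one step. Composites of levels are
below a still higher level. -/
theorem isPrimClosed_ackBounded : IsPrimClosed ackBounded where
  const c := ⟨c, fun _ => lt_ack_left _ _⟩
  succ := ⟨1, fun v => by
    have := le_sup_univ v 0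
    rw [ack_one]
    show v 0 + 1 < _
    omega⟩
  proj i := ⟨0, fun v => (le_sup_univ v i).trans_lt (lt_ack_right 0 _)⟩
  comp {n k} f g := by
    rintro ⟨a, ha⟩ hg
    choose b hb using hg
    refine ⟨max a (Finset.univ.sup b) + 2, fun v => (ha _).trans_le ?_⟩
    refine (ack_mono_right a (Finset.sup_le fun i _ => ?_)).trans
      (ack_ack_lt_ack_max_add_two a (Finset.univ.sup b) (Finset.univ.sup v)).le
    exact (hb i v).le.trans (ack_mono_left _ (le_sup_univ b i))
  prec {n} f g := by
    rintro ⟨a, ha⟩ ⟨b, hb⟩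
    set m := max a b with hm
    refine ⟨max (m + 1) 2 + 2, fun v => ?_⟩
    have H : ∀ k : ℕ, (Nat.rec (f (Fin.tail v))
        (fun k y => g (Fin.cons k (Fin.cons y (Fin.tail v)))) k : ℕ) <
          ack (m + 1) (k + Finset.univ.sup (Fin.tail v)) := by
      intro k
      induction k with
      | zero =>
        rw [zero_add]
        exact (ha _).trans_le (ack_mono_left _ ((le_max_left a b).trans (Nat.le_succ _)))
      | succ k ih =>
        set y : ℕ := Nat.rec (f (Fin.tail v)) (fun k y => g (Fin.cons k (Fin.cons y (Fin.tail v)))) k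
        show g (Fin.cons k (Fin.cons y (Fin.tail v))) < _
        rw [add_right_comm, ack_succ_succ]
        refine (hb _).trans_le (ack_le_ack (le_max_right a b) (Finset.sup_le fun i _ => ?_))
        have h1 := lt_ack_right (m + 1) (k + Finset.univ.sup (Fin.tail v))
        refine Fin.cases ?_ (fun i => Fin.cases ?_ (fun i => ?_) i) i
        · simp only [Fin.cons_zero]; omega
        · simp only [Fin.cons_succ, Fin.cons_zero]; exact ih.le
        · simp only [Fin.cons_succ]
          have := le_sup_univ (Fin.tail v) i
          omega
    refine (H (v 0)).trans ((ack_strictMono_right (m + 1) ?_).trans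
      (ack_ack_lt_ack_max_add_two (m + 1) 2 (Finset.univ.sup v)))
    have h1 := le_sup_univ v 0
    have h2 : Finset.univ.sup (Fin.tail v) ≤ Finset.univ.sup v :=
      Finset.sup_le fun i _ => le_sup_univ v i.succ
    rw [ack_two]
    omega

/-- **Kőnig's lemma** for binary trees, with the coding of strings by positive numbers. -/
theorem exists_path_of_infinite {T : ℕ → Prop}
    (hT : ∀ m, 0 < m → ∀ i ≤ 1, T (2 * m + i) → T m) (hinf : {m | T m}.Infinite) :
    ∃ c : ℕ → ℕ, c 0 = 1 ∧ (∀ n, ∃ i ≤ 1, c (n + 1) = 2 * c n + i) ∧ ∀ n, T (c n) := by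
  classical
  -- The members of T extending m: dropping the last k bits is division by 2^k.
  let E : ℕ → Set ℕ := fun m => {x | T x ∧ ∃ k, x / 2 ^ k = m}
  have hE1 : (E 1).Infinite := by
    refine (hinf.sdiff (Set.finite_singleton 0)).mono ?_
    rintro x ⟨hx, hx0⟩
    refine ⟨hx, Nat.log 2 x, Nat.div_eq_of_lt_le ?_ ?_⟩
    · rw [one_mul]; exact Nat.pow_log_le_self 2 hx0
    · rw [one_add_one_eq_two, ← pow_succ']; exact Nat.lt_pow_succ_log_self one_lt_two x
  have hstep : ∀ m, (E m).Infinite → (E (2 * m)).Infinite ∨ (E (2 * m + 1)).Infinite := by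
    intro m hm
    rw [← Set.infinite_union]
    refine (hm.sdiff (Set.finite_singleton m)).mono ?_
    rintro x ⟨⟨hx, k, hk⟩, hxm⟩
    obtain _ | k := k
    · exact (hxm (by simpa using hk)).elim
    · rw [pow_succ, ← Nat.div_div_eq_div_mul] at hk
      rcases Nat.mod_two_eq_zero_or_one (x / 2 ^ k) with h | h
      · exact .inl ⟨hx, k, by omega⟩
      · exact .inr ⟨hx, k, by omega⟩
  have hTE : ∀ m, 0 < m → (E m).Infinite → T m := by
    intro m hm h
    obtain ⟨x, hx, k, rfl⟩ := h.nonempty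
    clear h
    induction k with
    | zero => simpa using hx
    | succ k ih =>
      rw [pow_succ, ← Nat.div_div_eq_div_mul] at hm ⊢
      refine hT _ hm (x / 2 ^ k % 2) (by omega) ?_
      rw [Nat.div_add_mod]
      exact ih (by omega)
  let c : ℕ → ℕ := fun n => Nat.rec 1
    (fun _ m => if (E (2 * m)).Infinite then 2 * m else 2 * m + 1) n
  have hcs : ∀ n, c (n + 1) = if (E (2 * c n)).Infinite then 2 * c n else 2 * c n + 1 := fun _ => rfl
  have hc : ∀ n, 0 < c n ∧ (E (c n)).Infinite := by
    intro n
    induction n with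
    | zero => exact ⟨one_pos, hE1⟩
    | succ n ih =>
      rw [hcs]
      split_ifs with h
      · exact ⟨by omega, h⟩
      · exact ⟨by omega, (hstep _ ih.2).resolve_left h⟩
  refine ⟨c, rfl, fun n => ?_, fun n => hTE _ (hc n).1 (hc n).2⟩
  rw [hcs]
  split_ifs
  · exact ⟨0, zero_le_one, rfl⟩
  · exact ⟨1, le_rfl, rfl⟩

theorem standard_add {F : (n : ℕ) → Set ((Fin n → ℕ) → ℕ)} (x y : ℕ) :
    (standard F).add x y = x + y := by
  show PRCode.add.eval ![x, y] = _
  induction x with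
  | zero => exact (zero_add y).symm
  | succ x ih =>
    rw [Nat.succ_add]
    exact congrArg Nat.succ ih

theorem standard_snoc {F : (n : ℕ) → Set ((Fin n → ℕ) → ℕ)} (m i : ℕ) :
    (standard F).snoc m i = 2 * m + i := by
  rw [snoc, standard_add, standard_add, two_mul]

/-- Every infinite tree has a path by the external Kőnig lemma, and that path belongs to the class:
its bits are at most 1, and its n-th code is below 2^(n+1). -/
theorem wkl_ackBounded : (standard ackBounded).WKL := by
  rintro T ⟨-, -, hT⟩ hinf
  obtain ⟨c, h0, hs, hc⟩ := exists_path_of_infinite (T := fun m => T m = 1)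
    (fun m hm i hi h => hT m i hm (by have : i = 0 ∨ i = 1 := by omega
                                      exact this) (by rw [standard_snoc]; exact h))
    (Set.infinite_of_forall_exists_gt fun b => by
      obtain ⟨m, hm, h⟩ := hinf b
      exact ⟨m, h, hm⟩)
  choose P hP hcP using hs
  refine ⟨P, ⟨1, fun v => (hP _).trans_lt (lt_ack_left _ _)⟩, fun n => ?_, c, ⟨3, fun v => ?_⟩, h0,
    fun n => ?_, hc⟩
  · have := hP n
    show P n = 0 ∨ P n = 1
    omega
  · have h1 : ∀ n, c n < 2 ^ (n + 1) := by
      intro n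
      induction n with
      | zero => rw [h0]; norm_num
      | succ n ih =>
        have := hP n
        rw [hcP, pow_succ]
        omega
    refine ((h1 _).trans_le ?_).trans_le (ack_mono_right 3 (le_sup_univ v 0))
    have := Nat.one_le_two_pow (n := v 0)
    rw [ack_three, pow_add, pow_add]
    omega
  · exact (hcP n).trans (standard_snoc _ _).symm

/-- The graph of n ↦ ack n n has a 0-1-valued characteristic function, which is in the class. A
choice function for it would be the diagonal itself, which no level of the Ackermann function
bounds. -/
theorem not_qfac_ackBounded : ¬ (standard ackBounded).QFAC := by
  intro h
  have hG : (fun v : Fin 2 → ℕ => if ack (v 0) (v 0) = v 1 then 1 else 0) ∈ ackBounded 2 := by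
    refine ⟨1, fun v => lt_of_le_of_lt ?_ (lt_ack_left _ _)⟩
    dsimp only
    split_ifs <;> omega
  obtain ⟨F, ⟨m, hm⟩, hF⟩ := h (.eq (.app _ hG .var) (.param 1)) fun n => ⟨ack n n, if_pos rfl⟩
  have h1 : ack m m = F m := by
    by_contra hne
    have := hF m
    change (if ack m m = F m then 1 else 0) = 1 at this
    rw [if_neg hne] at this
    exact zero_ne_one this
  have h2 : F m < ack m (Finset.univ.sup fun _ : Fin 1 => m) := hm fun _ => m
  rw [Finset.sup_const Finset.univ_nonempty, ← h1] at h2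
  exact lt_irrefl _ h2

-- The function χ n j is 1 while j steps do not suffice to compute g n, and afterwards g n
-- truncated-minus j. So a zero means that the computation has halted with a value at most j.
open Nat.Partrec in
theorem exists_primrec_search {g : ℕ → ℕ} (hg : Computable g) : ∃ χ : ℕ → ℕ → ℕ,
    Primrec (fun v : Fin 2 → ℕ => χ (v 0) (v 1)) ∧ (∀ n, ∃ j, χ n j = 0) ∧
      ∀ n j, χ n j = 0 → g n ≤ j := by
  obtain ⟨c, hc⟩ := Code.exists_code.1 (Partrec.nat_iff.1 hg.partrec)
  have hc' : ∀ n, Code.eval c n = Part.some (g n) := fun n => by rw [hc]; rfl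
  refine ⟨fun n j => ((Code.evaln j c n).map (· - j)).getD 1, ?_, fun n => ?_, fun n j h => ?_⟩
  · have happ : ∀ i : Fin 2, Primrec fun v : Fin 2 → ℕ => v i :=
      fun i => Primrec.fin_app.comp .id (.const i)
    refine Primrec.option_getD.comp (Primrec.option_map (Code.primrec_evaln.comp
      (((happ 1).pair (.const c)).pair (happ 0))) ?_) (.const 1)
    exact Primrec.nat_sub.comp .snd ((happ 1).comp .fst)
  · obtain ⟨k, hk⟩ := Code.evaln_complete.1 (show g n ∈ Code.eval c n by rw [hc']; exact Part.mem_some _)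
    have h1 := Option.mem_def.1 (Code.evaln_mono (le_max_left k (g n)) hk)
    refine ⟨max k (g n), ?_⟩
    dsimp only
    rw [h1]
    exact Nat.sub_eq_zero_of_le (le_max_right _ _)
  · dsimp only at h
    cases hv : Code.evaln j c n with
    | none => rw [hv] at h; exact (one_ne_zero h).elim
    | some w =>
      have h1 := Code.evaln_sound (Option.mem_def.2 hv)
      rw [hc', Part.mem_some_iff] at h1
      rw [hv] at h
      rw [← h1]
      exact Nat.sub_eq_zero_iff_le.1 h

theorem exists_funCode_of_computable (g : ℕ → ℕ) (hg : Computable g) : ∃ P : FunCode ℕ,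
    minimalOmega.HasFunCode P ∧ fullOmega.IsContinuousFun P ∧
      ∀ m : ℕ → ℕ, fullOmega.IsModulus P m →
        ∃ D : ℕ → ℕ, PrimrecIn m (fun v : Fin 1 → ℕ => D (v 0)) ∧ ∀ i, g i ≤ D i := by
  obtain ⟨χ, hχ, H, hχg⟩ := exists_primrec_search hg
  let _ : PRAModel ℕ := ⟨fullOmega, isPrimClosed_univ.isModel⟩
  let Φ : FunClass ℕ :=
    { Mem := fun _ => {f | Primrec f}
      sub := fun _ => trivial
      sym_mem := isPrimClosed_primrec.eval_mem
      const_mem := isPrimClosed_primrec.const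
      comp_mem := isPrimClosed_primrec.comp
      prec_mem := isPrimClosed_primrec.exists_prec }
  -- This result speaks of the zero, successor and order of the structure, which over ℕ unfold to
  -- the usual ones. Its generic notations would instead be instances derived from the model.
  obtain ⟨P, hP, hcont, hmod⟩ := exists_funCode_of_total (Φ := Φ) hχ H
  refine ⟨P, ⟨hP.1.pos, hP.1.neg, hP.1.den, hP.2⟩, hcont, fun m hm => ⟨fun i => m (i + 1),
    PrimrecIn.comp (g := fun (_ : Fin 1) v => v 0 + 1) .oracle fun _ => .succ, fun i => ?_⟩⟩
  obtain ⟨j, hj, hij⟩ := hmod m hm i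
  exact (hχg i j hij).trans (not_lt.1 hj)

end OmegaModels

/-! ### The three claims assembled -/

theorem mainTheorem6 :
    -- over PRA², uniform continuity on [0,1] is equivalent to WKL₀ + RCA₀
    (∀ (M : Type u) (S : PRA2Structure M), S.IsModel →
      (S.UniformContinuityOnUnitInterval ↔ S.WKL ∧ S.QFAC)) ∧
    -- over PRA², WKL₀ does not imply uniform continuity on [0,1]
    (∃ (M : Type) (S : PRA2Structure M),
      S.IsModel ∧ S.WKL ∧ ¬ S.UniformContinuityOnUnitInterval) ∧
    -- the recursion-theoretic lemma
    (∀ g : ℕ → ℕ, Computable g → ∃ P : FunCode ℕ,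
      PRA2Structure.minimalOmega.HasFunCode P ∧ PRA2Structure.fullOmega.IsContinuousFun P ∧
      ∀ m : ℕ → ℕ, PRA2Structure.fullOmega.IsModulus P m →
        ∃ D : ℕ → ℕ, PrimrecIn m (fun v : Fin 1 → ℕ => D (v 0)) ∧ ∀ i, g i ≤ D i) := by
  refine ⟨fun M S hS => ?_, ⟨ℕ, PRA2Structure.standard ackBounded, isPrimClosed_ackBounded.isModel,
    wkl_ackBounded, fun h => ?_⟩, exists_funCode_of_computable⟩
  · let _ : PRAModel M := ⟨S, hS⟩
    exact uniformContinuity_iff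
  · let _ : PRAModel ℕ := ⟨PRA2Structure.standard ackBounded, isPrimClosed_ackBounded.isModel⟩
    exact not_qfac_ackBounded (uniformContinuity_iff.1 h).2
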